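/- An ordered graph is a finite simple graph with a linear order on its vertices; ordered graphs are considered up to order isomorphism. An ordered graph $H$ contains an ordered graph $G$ if some (not necessarily induced) subgraph of $H$ is order isomorphic to $G$, and otherwise $H$ avoids $G$. Let $\mathrm{ex}_<(n,G)$ be the maximum number of edges in an ordered graph with $n$ vertices that avoids $G$ (and $0$ if there is no such graph). Call $G$ minimally non-linear if $\mathrm{ex}_<(n,G)=\omega(n)$, but $\mathrm{ex}_<(n,G')=O(n)$ for every ordered graph $G'\neq G$ contained in $G$. Say that $G$ is bipartite with $k$ nodes in one part if its vertex set is the union of two disjoint independent sets, one of which has exactly $k$ elements (no condition relates the two sets to the vertex order). For every integer $k>2$, the number of minimally non-linear bipartite ordered graphs with $k$ nodes in one part is finite and at most $$\sum_{i=\lceil (k+2)/4\rceil}^{4k-2}\binom{k+i}{k}\left(i^k-(i-1)^k\right)k^{i-1}.$$ -/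

import Mathlib

open Filter Asymptotics

/-- A finite ordered graph, up to order isomorphism: a simple graph on the linearly ordered vertex
set `0 < 1 < ⋯ < order - 1`. As a finite linear order is isomorphic to exactly one `Fin m`, by a
unique isomorphism, two ordered graphs are order isomorphic iff their representatives are equal. -/
structure OrderedGraph where
  /-- The number of vertices. -/
  order : ℕ
  /-- The underlying graph. -/
  graph : SimpleGraph (Fin order)

namespace OrderedGraph

/-- `H` contains `G`: some (not necessarily induced) subgraph of `H` is order isomorphic to `G`. -/
def Contains (H G : OrderedGraph) : Prop :=
  ∃ f : Fin G.order ↪o Fin H.order, ∀ a b, G.graph.Adj a b → H.graph.Adj (f a) (f b)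

/-- `H` avoids `G`: no subgraph of `H` is order isomorphic to `G`. -/
def Avoids (H G : OrderedGraph) : Prop := ¬ H.Contains G

/-- `G'` is strictly contained in `G`. -/
def StrictlyContainedIn (G' G : OrderedGraph) : Prop := G.Contains G' ∧ ¬ G'.Contains G

open Classical in
/-- The extremal function: the maximum number of edges of an ordered graph with `n` vertices that
avoids `G` (and `0` if no ordered graph with `n` vertices avoids `G`, which can only happen if `G`
has no edges). -/
noncomputable def ex (n : ℕ) (G : OrderedGraph) : ℕ :=
  (Finset.univ.filter fun H : SimpleGraph (Fin n) => (⟨n, H⟩ : OrderedGraph).Avoids G).sup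
    fun H => H.edgeSet.ncard

/-- `G` is minimally non-linear: its extremal function is `ω(n)`, whereas that of every ordered
graph strictly contained in `G` is `O(n)`. -/
def MinimallyNonlinear (G : OrderedGraph) : Prop :=
  (fun n : ℕ => (n : ℝ)) =o[atTop] (fun n : ℕ => (ex n G : ℝ)) ∧
    ∀ G' : OrderedGraph, G'.StrictlyContainedIn G →
      (fun n : ℕ => (ex n G' : ℝ)) =O[atTop] (fun n : ℕ => (n : ℝ))

/-- `G` is bipartite with `k` vertices in one part: the vertices split into two independent sets,
in any position relative to the order, one of which has exactly `k` elements. -/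
def IsBipartiteWithPart (G : OrderedGraph) (k : ℕ) : Prop :=
  ∃ U : Finset (Fin G.order), U.card = k ∧
    G.graph.IsBipartiteWith (U : Set (Fin G.order)) (U : Set (Fin G.order))ᶜ

end OrderedGraph

/-! Seven small patterns are shown to be superlinear: a monotone path, two consecutive edges, a
four-cycle, two forks, and two patterns in which vertices `a`, `b` to the left have neighbours
alternating `a b a b`. A minimally non-linear graph `G` that contains one of them equals it. As the
part `U` has more than two elements, the first three are too small to be `G`. A fork would need its
middle vertex in `U`, so two neighbours of a vertex outside `U` never both have further neighbours
beyond it (`not_fork`). An alternation leaves six vertices of degree at most two (`of_alternation`).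
The alternations are the hard patterns: they need matrices built by an Ackermann-type recursion
(`existsAlternationFree`).

Without the path and the consecutive edges, all edges cross one gap (`exists_crossing`). Deleting a
suitable vertex and comparing extremal functions shows that `G` has no isolated vertices, and no
leaf in the middle of three consecutive neighbours of one vertex on the same side. A
Davenport-Schinzel type argument then bounds each side by four times the other, minus two
(`sub_le_of_crossing`).

If `U` is one side and the other has `i` vertices, `G` is encoded by two functions: each vertex of
`U` is sent to its farthest neighbour, and each vertex outside `U` to its only neighbour for which
it is not the farthest one. The extreme vertex outside `U` needs no second value, which gives `(i ^
k - (i - 1) ^ k) * k ^ (i - 1)` graphs for each choice of the side.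

Otherwise the complement of `U` meets both sides. The core, that is `U` with the first and last
neighbours of its elements, has at most `3 * k` vertices and is encoded in the same way. It
determines `G` as soon as the number of remaining vertices in each of its gaps is known
(`eq_of_core`), and this number is at most two (`val_succ_le`). The one-sided graphs use up two of
the `(k + i).choose k` copies of each summand; all mixed graphs fit into what is left of the last
summand (`sum_mixed_le`). -/

namespace OrderedGraph

/-! ### Edge counts, growth of the extremal function, containment and reversal -/

open Classical in
/-- The edges of a graph on a linear order, as pairs `(a, b)` with `a < b`. -/
noncomputable def orderedEdges {V : Type*} [LinearOrder V] [Fintype V] (H : SimpleGraph V) :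
    Finset (V × V) :=
  Finset.univ.filter fun p => p.1 < p.2 ∧ H.Adj p.1 p.2

lemma mem_orderedEdges {V : Type*} [LinearOrder V] [Fintype V] {H : SimpleGraph V} {p : V × V} :
    p ∈ orderedEdges H ↔ p.1 < p.2 ∧ H.Adj p.1 p.2 := by
  simp [orderedEdges]

lemma ncard_edgeSet_eq {V : Type*} [LinearOrder V] [Fintype V] (H : SimpleGraph V) :
    H.edgeSet.ncard = (orderedEdges H).card := by
  classical
  have himg : H.edgeSet = ((orderedEdges H).image fun p => s(p.1, p.2) : Finset (Sym2 V)) := by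
    ext e
    induction e with
    | h a b =>
      simp only [SimpleGraph.mem_edgeSet, Finset.coe_image, Set.mem_image, Finset.mem_coe,
        mem_orderedEdges, Prod.exists]
      constructor
      · intro h
        rcases lt_or_gt_of_ne h.ne with hab | hab
        · exact ⟨a, b, ⟨hab, h⟩, rfl⟩
        · exact ⟨b, a, ⟨hab, h.symm⟩, Sym2.eq_swap⟩
      · rintro ⟨x, y, ⟨-, h⟩, hxy⟩
        rcases Sym2.eq_iff.1 hxy with ⟨rfl, rfl⟩ | ⟨rfl, rfl⟩
        · exact h
        · exact h.symm
  rw [himg, Set.ncard_coe_finset, Finset.card_image_of_injOn]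
  rintro ⟨a, b⟩ h ⟨c, d⟩ h' heq
  have h1 := (mem_orderedEdges.1 h).1
  have h2 := (mem_orderedEdges.1 h').1
  rcases Sym2.eq_iff.1 heq with ⟨h3, h4⟩ | ⟨h3, h4⟩
  · exact Prod.ext h3 h4
  · simp only at h1 h2 h3 h4
    rw [h3, h4] at h1
    exact absurd h1 (lt_asymm h2)

lemma card_orderedEdges_le_ex {n : ℕ} {H : SimpleGraph (Fin n)} {G : OrderedGraph}
    (h : (⟨n, H⟩ : OrderedGraph).Avoids G) : (orderedEdges H).card ≤ ex n G := by
  rw [← ncard_edgeSet_eq]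
  unfold ex
  exact Finset.le_sup (f := fun H : SimpleGraph (Fin n) => H.edgeSet.ncard)
    (by simpa using h)

lemma ex_le {n B : ℕ} {G : OrderedGraph}
    (h : ∀ H : SimpleGraph (Fin n), (⟨n, H⟩ : OrderedGraph).Avoids G →
      (orderedEdges H).card ≤ B) : ex n G ≤ B := by
  unfold ex
  refine Finset.sup_le fun H hH => ?_
  rw [ncard_edgeSet_eq]
  exact h H (by simpa using hH)

/-- The extremal function of `G` grows faster than linearly. -/
def Superlinear (G : OrderedGraph) : Prop :=
  ∀ K : ℕ, ∀ᶠ n : ℕ in atTop, K * n ≤ ex n G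

/-- The extremal function of `G` grows at most linearly. -/
def AtMostLinear (G : OrderedGraph) : Prop :=
  ∃ K : ℕ, ∀ᶠ n : ℕ in atTop, ex n G ≤ K * n

lemma superlinear_iff {G : OrderedGraph} :
    (fun n : ℕ => (n : ℝ)) =o[atTop] (fun n : ℕ => (ex n G : ℝ)) ↔ G.Superlinear := by
  rw [isLittleO_iff]
  constructor
  · intro h K
    have hK : (0 : ℝ) < ((K : ℝ) + 1)⁻¹ := by positivity
    filter_upwards [h hK] with n hn
    rw [Real.norm_natCast, Real.norm_natCast, inv_mul_eq_div, le_div_iff₀ (by positivity)] at hn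
    have : ((K * n : ℕ) : ℝ) ≤ (ex n G : ℝ) := by
      push_cast
      nlinarith [(Nat.cast_nonneg n : (0 : ℝ) ≤ n)]
    exact_mod_cast this
  · intro h c hc
    obtain ⟨K, hK⟩ := exists_nat_gt c⁻¹
    filter_upwards [h K] with n hn
    rw [Real.norm_natCast, Real.norm_natCast]
    have hn' : (K : ℝ) * n ≤ ex n G := by exact_mod_cast hn
    have h1 : c⁻¹ * n ≤ ex n G :=
      (mul_le_mul_of_nonneg_right hK.le (Nat.cast_nonneg n)).trans hn'
    have := mul_le_mul_of_nonneg_left h1 hc.le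
    rwa [← mul_assoc, mul_inv_cancel₀ hc.ne', one_mul] at this

lemma atMostLinear_iff {G : OrderedGraph} :
    (fun n : ℕ => (ex n G : ℝ)) =O[atTop] (fun n : ℕ => (n : ℝ)) ↔ G.AtMostLinear := by
  rw [isBigO_iff]
  constructor
  · rintro ⟨c, h⟩
    obtain ⟨K, hK⟩ := exists_nat_gt c
    refine ⟨K, ?_⟩
    filter_upwards [h] with n hn
    rw [Real.norm_natCast, Real.norm_natCast] at hn
    have : (ex n G : ℝ) ≤ (K * n : ℕ) := by
      push_cast
      exact hn.trans (mul_le_mul_of_nonneg_right hK.le (Nat.cast_nonneg n))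
    exact_mod_cast this
  · rintro ⟨K, h⟩
    refine ⟨K, ?_⟩
    filter_upwards [h] with n hn
    rw [Real.norm_natCast, Real.norm_natCast]
    exact_mod_cast hn

lemma Superlinear.not_atMostLinear {G : OrderedGraph} (h : G.Superlinear) :
    ¬ G.AtMostLinear := by
  rintro ⟨K, hK⟩
  obtain ⟨n, ⟨h1, h2⟩, h3⟩ := ((h (K + 1)).and hK |>.and (eventually_gt_atTop 0)).exists
  nlinarith

lemma contains_of_strictMono {H G : OrderedGraph} (f : Fin G.order → Fin H.order)
    (hf : StrictMono f) (h : ∀ a b, a < b → G.graph.Adj a b → H.graph.Adj (f a) (f b)) :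
    H.Contains G := by
  refine ⟨OrderEmbedding.ofStrictMono f hf, fun a b hab => ?_⟩
  rcases lt_or_gt_of_ne hab.ne with hlt | hlt
  · exact h a b hlt hab
  · exact (h b a hlt hab.symm).symm

lemma Contains.order_le {H G : OrderedGraph} (h : H.Contains G) : G.order ≤ H.order := by
  obtain ⟨f, -⟩ := h
  simpa using Fintype.card_le_of_injective f f.injective

/-- A strictly monotone self-map of `Fin n` never decreases a point, and neither does its inverse.
This makes containment antisymmetric without passing to isomorphism classes. -/
lemma orderEmbedding_fin_apply_self {n : ℕ} (f : Fin n ↪o Fin n) (a : Fin n) : f a = a := by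
  have h1 : ∀ g : Fin n ↪o Fin n, ∀ a, a ≤ g a := fun g _ => g.strictMono.le_apply
  have hbij : Function.Bijective f := Finite.injective_iff_bijective.1 f.injective
  let e : Fin n ≃o Fin n := RelIso.ofSurjective f hbij.2
  have := h1 e.symm.toOrderEmbedding (f a)
  have h2 : e.symm (f a) = a := e.symm_apply_apply a
  refine le_antisymm ?_ (h1 f a)
  calc f a ≤ e.symm (f a) := this
    _ = a := h2

lemma Contains.antisymm {H G : OrderedGraph} (h : H.Contains G) (h' : G.Contains H) : H = G := by
  obtain ⟨n, H⟩ := H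
  obtain ⟨m, G⟩ := G
  obtain rfl : n = m := le_antisymm h'.order_le h.order_le
  obtain ⟨f, hf⟩ := h
  obtain ⟨g, hg⟩ := h'
  simp only [orderEmbedding_fin_apply_self] at hf hg
  congr 1
  ext a b
  exact ⟨hg a b, hf a b⟩

lemma MinimallyNonlinear.superlinear {G : OrderedGraph} (h : G.MinimallyNonlinear) :
    G.Superlinear := superlinear_iff.1 h.1

lemma MinimallyNonlinear.atMostLinear {G G' : OrderedGraph} (h : G.MinimallyNonlinear)
    (h' : G'.StrictlyContainedIn G) : G'.AtMostLinear := atMostLinear_iff.1 (h.2 G' h')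

/-- This is how every superlinear pattern is used: strict containment would make the pattern linear.
-/
lemma MinimallyNonlinear.eq_of_contains {G P : OrderedGraph} (h : G.MinimallyNonlinear)
    (hP : P.Superlinear) (hGP : G.Contains P) : G = P := by
  by_contra hne
  exact hP.not_atMostLinear (h.atMostLinear ⟨hGP, fun h' => hne (hGP.antisymm h')⟩)

/-- The ordered graph obtained by reversing the order of the vertices. -/
def reverse (G : OrderedGraph) : OrderedGraph := ⟨G.order, G.graph.comap Fin.rev⟩

lemma reverse_reverse (G : OrderedGraph) : G.reverse.reverse = G := by
  obtain ⟨n, G⟩ := G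
  simp only [reverse, mk.injEq, heq_eq_eq, true_and]
  ext a b
  simp

lemma Contains.reverse {H G : OrderedGraph} (h : H.Contains G) : H.reverse.Contains G.reverse := by
  obtain ⟨f, hf⟩ := h
  refine contains_of_strictMono (fun a => (f a.rev).rev) ?_ ?_
  · intro a b hab
    exact Fin.rev_lt_rev.2 (f.strictMono (Fin.rev_lt_rev.2 hab))
  · intro a b _ hab
    simp only [OrderedGraph.reverse, SimpleGraph.comap_adj, Fin.rev_rev] at hab ⊢
    exact hf _ _ hab

lemma contains_reverse_iff {H G : OrderedGraph} :
    H.reverse.Contains G.reverse ↔ H.Contains G :=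
  ⟨fun h => by simpa [reverse_reverse] using h.reverse, Contains.reverse⟩

lemma ex_reverse_le (n : ℕ) (G : OrderedGraph) : ex n G ≤ ex n G.reverse := by
  refine ex_le fun H hH => ?_
  have hav : (⟨n, H.comap Fin.rev⟩ : OrderedGraph).Avoids G.reverse := by
    intro hc
    exact hH ((contains_reverse_iff (H := ⟨n, H⟩)).1 hc)
  refine le_trans ?_ (card_orderedEdges_le_ex hav)
  refine Finset.card_le_card_of_injOn (fun p => (p.2.rev, p.1.rev)) ?_ ?_
  · intro p hp
    rw [Finset.mem_coe, mem_orderedEdges] at hp ⊢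
    exact ⟨Fin.rev_lt_rev.2 hp.1, by simpa using hp.2.symm⟩
  · rintro ⟨a, b⟩ - ⟨c, d⟩ - h
    simpa [and_comm] using h

lemma ex_reverse (n : ℕ) (G : OrderedGraph) : ex n G.reverse = ex n G :=
  le_antisymm (by simpa [reverse_reverse] using ex_reverse_le n G.reverse) (ex_reverse_le n G)

lemma MinimallyNonlinear.reverse {G : OrderedGraph} (h : G.MinimallyNonlinear) :
    G.reverse.MinimallyNonlinear := by
  refine ⟨by simpa only [ex_reverse] using h.1, fun G' hG' => ?_⟩
  have := h.2 G'.reverse ⟨?_, fun hc => hG'.2 ?_⟩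
  · simpa only [ex_reverse] using this
  · simpa [reverse_reverse] using hG'.1.reverse
  · simpa [reverse_reverse] using hc.reverse

end OrderedGraph

/-! ### Reductions by deleting one vertex: leaves and isolated vertices -/

namespace OrderedGraph

/-- Delete the vertex `v`. -/
def erase {p : ℕ} (G : SimpleGraph (Fin (p + 1))) (v : Fin (p + 1)) : OrderedGraph :=
  ⟨p, G.comap v.succAbove⟩

lemma erase_strictlyContainedIn {p : ℕ} (G : SimpleGraph (Fin (p + 1))) (v : Fin (p + 1)) :
    (erase G v).StrictlyContainedIn ⟨p + 1, G⟩ :=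
  ⟨⟨Fin.succAboveOrderEmb v, fun _ _ h => h⟩, fun h => by
    have := h.order_le
    simp [erase] at this⟩

/-- Common frame of both reductions: a copy of the graph without `v` extends as soon as the host has
a vertex `w` in the right place with the right neighbours. -/
lemma contains_of_insert {n p : ℕ} {H : SimpleGraph (Fin n)} {G : SimpleGraph (Fin (p + 1))}
    (v : Fin (p + 1)) (φ : Fin p → Fin n) (hφ : StrictMono φ) (w : Fin n)
    (hlt : ∀ j, v.succAbove j < v → φ j < w) (hgt : ∀ j, v < v.succAbove j → w < φ j)
    (hadj : ∀ i j, i < j → G.Adj (v.succAbove i) (v.succAbove j) → H.Adj (φ i) (φ j))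
    (hv : ∀ j, G.Adj v (v.succAbove j) → H.Adj w (φ j)) :
    (⟨n, H⟩ : OrderedGraph).Contains ⟨p + 1, G⟩ := by
  refine contains_of_strictMono (H := ⟨n, H⟩) (G := ⟨p + 1, G⟩)
    (v.insertNth (α := fun _ => Fin n) w φ) ?_ ?_
  · intro a b hab
    rcases Fin.eq_self_or_eq_succAbove v b with hb | ⟨j, rfl⟩ <;>
    rcases Fin.eq_self_or_eq_succAbove v a with ha | ⟨i, rfl⟩
    · exact absurd hab (by rw [ha, hb]; exact lt_irrefl _)
    · subst hb
      simpa using hlt i hab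
    · subst ha
      simpa using hgt j hab
    · simpa using hφ ((Fin.strictMono_succAbove v).lt_iff_lt.1 hab)
  · intro a b hab h
    rcases Fin.eq_self_or_eq_succAbove v b with hb | ⟨j, rfl⟩ <;>
    rcases Fin.eq_self_or_eq_succAbove v a with ha | ⟨i, rfl⟩
    · exact absurd hab (by rw [ha, hb]; exact lt_irrefl _)
    · subst hb
      simpa using (hv i h.symm).symm
    · subst ha
      simpa using hv j h
    · simpa using hadj i j ((Fin.strictMono_succAbove v).lt_iff_lt.1 hab) h

open Classical in
/-- The number of neighbours of `a` strictly between `a` and `b`. -/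
noncomputable def forwardRank {n : ℕ} (H : SimpleGraph (Fin n)) (a b : Fin n) : ℕ :=
  (Finset.univ.filter fun c => a < c ∧ c < b ∧ H.Adj a c).card

/-- The edges whose rank at the left end has a given parity. -/
noncomputable def parityPart {n : ℕ} (H : SimpleGraph (Fin n)) (ε : ℕ) : SimpleGraph (Fin n) where
  Adj a b := H.Adj a b ∧ forwardRank H (min a b) (max a b) % 2 = ε
  symm := ⟨fun a b h => by rw [min_comm, max_comm]; exact ⟨h.1.symm, h.2⟩⟩
  loopless := ⟨fun _ h => h.1.ne rfl⟩

/-- In a parity class the ranks of `b` and `c` have the same parity. With no neighbour of `a`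
between them, the ranks would differ by exactly one. -/
lemma exists_adj_between {n : ℕ} {H : SimpleGraph (Fin n)} {ε : ℕ} {a b c : Fin n} (hab : a < b)
    (hbc : b < c) (h1 : (parityPart H ε).Adj a b) (h2 : (parityPart H ε).Adj a c) :
    ∃ w, b < w ∧ w < c ∧ H.Adj a w := by
  classical
  by_contra hcon
  push Not at hcon
  have hac := hab.trans hbc
  have e1 : forwardRank H a b % 2 = ε := by
    simpa [min_eq_left hab.le, max_eq_right hab.le] using h1.2
  have e2 : forwardRank H a c % 2 = ε := by
    simpa [min_eq_left hac.le, max_eq_right hac.le] using h2.2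
  have : forwardRank H a c = forwardRank H a b + 1 := by
    unfold forwardRank
    rw [← Finset.card_insert_of_notMem (a := b) (by simp)]
    congr 1
    ext d
    simp only [Finset.mem_filter, Finset.mem_univ, true_and, Finset.mem_insert]
    constructor
    · rintro ⟨h3, h4, h5⟩
      rcases lt_trichotomy d b with h | h | h
      · exact Or.inr ⟨h3, h, h5⟩
      · exact Or.inl h
      · exact absurd h5 (hcon d h h4)
    · rintro (rfl | ⟨h3, h4, h5⟩)
      · exact ⟨hab, hbc, h1.1⟩
      · exact ⟨h3, h4.trans hbc, h5⟩
  omega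

lemma card_orderedEdges_le_parityPart {n : ℕ} (H : SimpleGraph (Fin n)) :
    (orderedEdges H).card ≤
      (orderedEdges (parityPart H 0)).card + (orderedEdges (parityPart H 1)).card := by
  classical
  refine le_trans (Finset.card_le_card ?_) (Finset.card_union_le _ _)
  intro p hp
  rw [mem_orderedEdges] at hp
  rw [Finset.mem_union, mem_orderedEdges, mem_orderedEdges]
  rcases Nat.mod_two_eq_zero_or_one (forwardRank H (min p.1 p.2) (max p.1 p.2)) with h | h
  · exact Or.inl ⟨hp.1, hp.2, h⟩
  · exact Or.inr ⟨hp.1, hp.2, h⟩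

/-- In a minimally non-linear ordered graph, three consecutive vertices cannot have a common
neighbour to their left if the middle one is a leaf. -/
theorem MinimallyNonlinear.not_leaf_between {n : ℕ} {G : SimpleGraph (Fin n)}
    (hG : (⟨n, G⟩ : OrderedGraph).MinimallyNonlinear) {u x v y : Fin n} (hux : u < x)
    (hxv : x.val + 1 = v.val) (hvy : v.val + 1 = y.val) (h1 : G.Adj u x) (h2 : G.Adj u y)
    (hleaf : ∀ w, G.Adj v w → w = u) : False := by
  obtain _ | p := n
  · exact u.elim0
  have hne : ∀ {z : Fin (p + 1)}, z ≠ v → ∃ j, v.succAbove j = z := fun {z} hz =>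
    Fin.exists_succAbove_eq hz
  obtain ⟨u', rfl⟩ := hne (z := u) (by intro h; omega)
  obtain ⟨x', rfl⟩ := hne (z := x) (by intro h; omega)
  obtain ⟨y', rfl⟩ := hne (z := y) (by intro h; omega)
  have mono := Fin.strictMono_succAbove v
  have hux' : u' < x' := mono.lt_iff_lt.1 hux
  have hxy' : x' < y' := mono.lt_iff_lt.1 (by omega)
  have key : ∀ (N ε : ℕ) (H : SimpleGraph (Fin N)), (⟨N, H⟩ : OrderedGraph).Avoids ⟨p + 1, G⟩ →
      (orderedEdges (parityPart H ε)).card ≤ ex N (erase G v) := by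
    intro N ε H hH
    refine card_orderedEdges_le_ex ?_
    rintro ⟨φ, hφ⟩
    change Fin p ↪o Fin N at φ
    change ∀ a b, G.Adj (v.succAbove a) (v.succAbove b) → (parityPart H ε).Adj (φ a) (φ b) at hφ
    -- The neighbour skipped by the parity class can play the role of the leaf `v`: as `x`, `v`, `y`
    -- are consecutive, lying between the images of `x` and `y` is all that the order demands.
    obtain ⟨w, hw1, hw2, hw3⟩ := exists_adj_between (φ.strictMono hux') (φ.strictMono hxy')
      (hφ _ _ h1) (hφ _ _ h2)
    refine hH (contains_of_insert v φ φ.strictMono w ?_ ?_ (fun i j _ h => (hφ i j h).1) ?_)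
    · intro j hj
      refine lt_of_le_of_lt (φ.monotone ?_) hw1
      exact mono.le_iff_le.1 (by omega)
    · intro j hj
      refine lt_of_lt_of_le hw2 (φ.monotone ?_)
      exact mono.le_iff_le.1 (by omega)
    · intro j hj
      have := hleaf _ hj
      rw [mono.injective this]
      exact hw3.symm
  have hle : ∀ N, ex N ⟨p + 1, G⟩ ≤ 2 * ex N (erase G v) := fun N => ex_le fun H hH => by
    have := card_orderedEdges_le_parityPart H
    have := key N 0 H hH
    have := key N 1 H hH
    omega
  obtain ⟨K, hK⟩ := hG.atMostLinear (erase_strictlyContainedIn G v)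
  refine hG.superlinear.not_atMostLinear ⟨2 * K, ?_⟩
  filter_upwards [hK] with N hN
  have := hle N
  nlinarith

/-- All edges of `G` cross the gap in front of the vertex `t`. -/
def Crossing {n : ℕ} (G : SimpleGraph (Fin n)) (t : ℕ) : Prop :=
  ∀ a b, G.Adj a b → a < b → a.val < t ∧ t ≤ b.val

/-- A pair of vertices of a graph on `m` vertices, sent to a pair of vertices whose position and
distance have parities given by `α` and `β`. -/
def spread (m : ℕ) (α β : Fin 2) (p : Fin m × Fin m) : Fin (2 * m + 3) × Fin (2 * m + 3) :=
  (⟨2 * p.1.val + 1 + α.val, by omega⟩, ⟨2 * p.2.val + 1 + α.val + β.val, by omega⟩)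

/-- The edges of `H` of the form `spread m α β p`. -/
def contract (m : ℕ) (H : SimpleGraph (Fin (2 * m + 3))) (α β : Fin 2) : SimpleGraph (Fin m) where
  Adj i j := i ≠ j ∧ H.Adj (spread m α β (min i j, max i j)).1 (spread m α β (min i j, max i j)).2
  symm := ⟨fun i j h => by rw [min_comm, max_comm]; exact ⟨h.1.symm, h.2⟩⟩
  loopless := ⟨fun _ h => h.1 rfl⟩

/-- An edge starting at `0`, ending at one of the last two vertices, or joining consecutive vertices
falls into one of four families with at most one edge per vertex. Every other edge is a `spread` for
the parities of its position and its length. -/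
lemma card_orderedEdges_le_contract (m : ℕ) (H : SimpleGraph (Fin (2 * m + 3))) (B : ℕ)
    (hB : ∀ α β, (orderedEdges (contract m H α β)).card ≤ B) :
    (orderedEdges H).card ≤ 4 * (2 * m + 3) + 4 * B := by
  classical
  let e : Fin 4 → Fin (2 * m + 3) → Fin (2 * m + 3) × Fin (2 * m + 3) :=
    ![fun a => (0, a), fun a => (a, ⟨2 * m + 1, by omega⟩), fun a => (a, ⟨2 * m + 2, by omega⟩),
      fun a => (a, ⟨min (a.val + 1) (2 * m + 2), by omega⟩)]
  have hsub : orderedEdges H ⊆ (Finset.univ.biUnion fun i => Finset.univ.image (e i)) ∪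
      Finset.univ.biUnion fun q : Fin 2 × Fin 2 =>
        (orderedEdges (contract m H q.1 q.2)).image (spread m q.1 q.2) := by
    rintro ⟨a, b⟩ hp
    rw [mem_orderedEdges] at hp
    obtain ⟨hab, hadj⟩ := hp
    simp only at hab hadj
    rw [Finset.mem_union]
    by_cases h0 : a.val = 0
    · left
      refine Finset.mem_biUnion.2 ⟨0, Finset.mem_univ _, Finset.mem_image.2 ⟨b, Finset.mem_univ _, ?_⟩⟩
      exact Prod.ext (Fin.ext h0.symm) rfl
    by_cases h1 : b.val = 2 * m + 1
    · left
      refine Finset.mem_biUnion.2 ⟨1, Finset.mem_univ _, Finset.mem_image.2 ⟨a, Finset.mem_univ _, ?_⟩⟩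
      exact Prod.ext rfl (Fin.ext h1.symm)
    by_cases h2 : b.val = 2 * m + 2
    · left
      refine Finset.mem_biUnion.2 ⟨2, Finset.mem_univ _, Finset.mem_image.2 ⟨a, Finset.mem_univ _, ?_⟩⟩
      exact Prod.ext rfl (Fin.ext h2.symm)
    by_cases h3 : b.val = a.val + 1
    · left
      refine Finset.mem_biUnion.2 ⟨3, Finset.mem_univ _, Finset.mem_image.2 ⟨a, Finset.mem_univ _, ?_⟩⟩
      refine Prod.ext rfl (Fin.ext ?_)
      change min (a.val + 1) (2 * m + 2) = b.val
      omega
    right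
    have hab' : a.val < b.val := hab
    refine Finset.mem_biUnion.2 ⟨(⟨(a.val - 1) % 2, by omega⟩, ⟨(b.val - a.val) % 2, by omega⟩),
      Finset.mem_univ _, Finset.mem_image.2 ⟨(⟨(a.val - 1) / 2, by omega⟩,
        ⟨(b.val - 1 - (a.val - 1) % 2 - (b.val - a.val) % 2) / 2, by omega⟩), ?_, ?_⟩⟩
    · have hlt : (⟨(a.val - 1) / 2, by omega⟩ : Fin m) <
          ⟨(b.val - 1 - (a.val - 1) % 2 - (b.val - a.val) % 2) / 2, by omega⟩ := by
        rw [Fin.mk_lt_mk]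
        omega
      refine mem_orderedEdges.2 ⟨hlt, hlt.ne, ?_⟩
      rw [min_eq_left hlt.le, max_eq_right hlt.le]
      convert hadj using 1 <;> refine Fin.ext ?_ <;> simp only [spread] <;> omega
    · refine Prod.ext (Fin.ext ?_) (Fin.ext ?_) <;> simp only [spread] <;> omega
  refine (Finset.card_le_card hsub).trans ((Finset.card_union_le _ _).trans (add_le_add ?_ ?_))
  · refine Finset.card_biUnion_le.trans ((Finset.sum_le_sum fun i _ => Finset.card_image_le).trans ?_)
    simp
  · refine Finset.card_biUnion_le.trans ((Finset.sum_le_sum fun i _ =>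
      Finset.card_image_le.trans (hB _ _)).trans ?_)
    simp

/-- A minimally non-linear ordered graph all of whose edges cross one gap has no isolated
vertices. -/
theorem MinimallyNonlinear.exists_adj {n t : ℕ} {G : SimpleGraph (Fin n)}
    (hG : (⟨n, G⟩ : OrderedGraph).MinimallyNonlinear) (ht : Crossing G t) (v : Fin n) :
    ∃ w, G.Adj v w := by
  by_contra hiso
  push Not at hiso
  obtain _ | p := n
  · exact v.elim0
  have mono := Fin.strictMono_succAbove v
  have key : ∀ (m : ℕ) (H : SimpleGraph (Fin (2 * m + 3))),
      (⟨2 * m + 3, H⟩ : OrderedGraph).Avoids ⟨p + 1, G⟩ → ∀ α β,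
      (orderedEdges (contract m H α β)).card ≤ ex m (erase G v) := by
    intro m H hH α β
    refine card_orderedEdges_le_ex ?_
    rintro ⟨φ, hφ⟩
    change Fin p ↪o Fin m at φ
    change ∀ a b, G.Adj (v.succAbove a) (v.succAbove b) → (contract m H α β).Adj (φ a) (φ b) at hφ
    -- The vertices behind the gap are shifted by `β` more than those before it. As every edge
    -- crosses the gap, it is sent to its `spread`, and doubling keeps the images of distinct
    -- vertices at distance at least two.
    let δ : Fin p → ℕ := fun j => if (v.succAbove j).val < t then 0 else β.val
    have hδ : ∀ j, δ j ≤ 1 := fun j => by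
      simp only [δ]; split_ifs <;> omega
    have hδm : ∀ i j, i < j → δ i ≤ δ j := fun i j hij => by
      have : (v.succAbove i).val < (v.succAbove j).val := mono hij
      simp only [δ]; split_ifs <;> omega
    let ψ : Fin p → Fin (2 * m + 3) := fun j => ⟨2 * (φ j).val + 1 + α.val + δ j, by
      have := hδ j; omega⟩
    have hψ : ∀ i j, i < j → (ψ i).val + 2 ≤ (ψ j).val := fun i j hij => by
      have h1 : (φ i).val < (φ j).val := φ.strictMono hij
      have h2 := hδm i j hij
      simp only [ψ]
      omega
    have hψm : StrictMono ψ := fun i j hij => by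
      have := hψ i j hij
      rw [Fin.lt_def]; omega
    have hadj : ∀ i j, i < j → G.Adj (v.succAbove i) (v.succAbove j) → H.Adj (ψ i) (ψ j) := by
      intro i j hij h
      have h1 := (hφ i j h).2
      have h2 := ht _ _ h (mono hij)
      have h3 := φ.strictMono hij
      rw [min_eq_left h3.le, max_eq_right h3.le] at h1
      convert h1 using 1 <;> refine Fin.ext ?_
      · simp [ψ, δ, spread, h2.1]
      · simp [ψ, δ, spread, not_lt.2 h2.2]
    -- The isolated vertex goes right after the image of its predecessor, where a place is free, or
    -- to the vertex `0`, which no `spread` uses.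
    by_cases hv0 : v.val = 0
    · refine hH (contains_of_insert v ψ hψm 0 ?_ ?_ hadj fun j hj => absurd hj (hiso _))
      · intro j hj
        have : (v.succAbove j).val < v.val := hj
        omega
      · intro j _
        rw [Fin.lt_def]
        simp [ψ]
    · have hvp := v.isLt
      let q : Fin p := ⟨v.val - 1, by omega⟩
      have hψq : (ψ q).val < 2 * m + 2 := by
        have := hδ q
        simp only [ψ]; omega
      refine hH (contains_of_insert v ψ hψm ⟨(ψ q).val + 1, by omega⟩ ?_ ?_ hadj
        fun j hj => absurd hj (hiso _))
      · intro j hj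
        have hjq : j ≤ q := by
          rw [Fin.succAbove_lt_iff_castSucc_lt] at hj
          have : j.val < v.val := hj
          rw [Fin.le_def]
          simp only [q]; omega
        have : (ψ j).val ≤ (ψ q).val := hψm.monotone hjq
        rw [Fin.lt_def]
        simp only; omega
      · intro j hj
        have hjq : q < j := by
          rw [Fin.lt_succAbove_iff_le_castSucc] at hj
          have : v.val ≤ j.val := hj
          rw [Fin.lt_def]
          simp only [q]; omega
        have := hψ q j hjq
        rw [Fin.lt_def]
        simp only; omega
  obtain ⟨K, hK⟩ := hG.atMostLinear (erase_strictlyContainedIn G v)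
  obtain ⟨m₀, hm₀⟩ := eventually_atTop.1 hK
  obtain ⟨n₀, hn₀⟩ := eventually_atTop.1 (hG.superlinear (4 * K + 5))
  have h1 := hm₀ (m₀ + n₀) (by omega)
  have h2 := hn₀ (2 * (m₀ + n₀) + 3) (by omega)
  have h3 : ex (2 * (m₀ + n₀) + 3) ⟨p + 1, G⟩ ≤
      4 * (2 * (m₀ + n₀) + 3) + 4 * ex (m₀ + n₀) (erase G v) :=
    ex_le fun H hH => card_orderedEdges_le_contract _ H _ (key _ H hH)
  nlinarith

end OrderedGraph

/-! ### Superlinear patterns and the extension of a construction to all sizes -/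

namespace OrderedGraph

/-- The graph on `Fin n` whose edges are the pairs `a < b` related by `R`. -/
def ofRel (n : ℕ) (R : ℕ → ℕ → Prop) : SimpleGraph (Fin n) where
  Adj a b := (a < b ∧ R a b) ∨ (b < a ∧ R b a)
  symm := ⟨fun _ _ h => h.symm⟩
  loopless := ⟨fun _ h => h.elim (fun h => lt_irrefl _ h.1) fun h => lt_irrefl _ h.1⟩

lemma ofRel_adj {n : ℕ} {R : ℕ → ℕ → Prop} {a b : Fin n} (h : a < b) :
    (ofRel n R).Adj a b ↔ R a b :=
  ⟨fun h' => h'.elim (fun h' => h'.2) fun h' => absurd h'.1 (lt_asymm h), fun h' => Or.inl ⟨h, h'⟩⟩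

/-- The ordered graph on `m` vertices with a given list of edges. -/
def pattern (m : ℕ) (E : List (ℕ × ℕ)) : OrderedGraph := ⟨m, ofRel m fun a b => (a, b) ∈ E⟩

lemma pattern_adj {m : ℕ} {E : List (ℕ × ℕ)} {a b : Fin m} (h : a < b) :
    (pattern m E).graph.Adj a b ↔ (a.val, b.val) ∈ E := ofRel_adj (R := fun a b => (a, b) ∈ E) h

lemma Contains.exists_strictMono {n m : ℕ} {H : SimpleGraph (Fin n)} {E : List (ℕ × ℕ)}
    (h : (⟨n, H⟩ : OrderedGraph).Contains (pattern m E)) :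
    ∃ f : Fin m → Fin n, StrictMono f ∧ ∀ a b : Fin m, a < b → (a.val, b.val) ∈ E →
      H.Adj (f a) (f b) := by
  obtain ⟨f, hf⟩ := h
  exact ⟨f, f.strictMono, fun a b hab h => hf a b ((pattern_adj hab).2 h)⟩

/-- No proper division of the vertices into consecutive intervals separates the edges. -/
def Irreducible (G : OrderedGraph) : Prop :=
  ∀ h : Fin G.order → ℕ, Monotone h → (∀ a b, G.graph.Adj a b → h a = h b) → ∀ a b, h a = h b

/-- The `n` vertices are filled with consecutive disjoint copies of `H`. A copy of an irreducible
graph cannot spread over several blocks, so one dense example of each density suffices. -/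
theorem superlinear_of_irreducible {G : OrderedGraph} (hirr : G.Irreducible)
    (h : ∀ K : ℕ, ∃ v : ℕ, 0 < v ∧ ∃ H : SimpleGraph (Fin v),
      (⟨v, H⟩ : OrderedGraph).Avoids G ∧ K * v ≤ (orderedEdges H).card) : G.Superlinear := by
  intro K
  -- The factor two pays for the incomplete last block, since the complete ones cover at least half
  -- of the vertices when `v ≤ n`.
  obtain ⟨v, hv, H, hH, hcard⟩ := h (2 * K)
  filter_upwards [eventually_ge_atTop v] with n hn
  let B : SimpleGraph (Fin n) :=
    { Adj a b := a.val / v = b.val / v ∧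
        H.Adj ⟨a.val % v, Nat.mod_lt _ hv⟩ ⟨b.val % v, Nat.mod_lt _ hv⟩
      symm := ⟨fun _ _ h => ⟨h.1.symm, h.2.symm⟩⟩
      loopless := ⟨fun _ h => h.2.ne rfl⟩ }
  have hav : (⟨n, B⟩ : OrderedGraph).Avoids G := by
    rintro ⟨f, hf⟩
    have hconst := hirr (fun a => (f a).val / v)
      (fun a b hab => Nat.div_le_div_right (f.monotone hab)) fun a b hab => (hf a b hab).1
    refine hH (contains_of_strictMono (H := ⟨v, H⟩)
      (fun a => ⟨(f a).val % v, Nat.mod_lt _ hv⟩) ?_ fun a b _ hab => (hf a b hab).2)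
    intro a b hab
    have h1 : (f a).val < (f b).val := f.strictMono hab
    have h2 := hconst a b
    simp only at h2
    have h3 := Nat.div_add_mod (f a).val v
    have h4 := Nat.div_add_mod (f b).val v
    rw [Fin.mk_lt_mk]
    rw [h2] at h3
    omega
  have hlt : ∀ (j : Fin (n / v)) (x : Fin v), j.val * v + x.val < n := fun j x => by
    have h1 : (j.val + 1) * v ≤ n / v * v := Nat.mul_le_mul_right v j.isLt
    have h2 := Nat.div_mul_le_self n v
    have := x.isLt
    rw [add_mul] at h1
    omega
  have hdiv : ∀ (j : Fin (n / v)) (x : Fin v), (j.val * v + x.val) / v = j.val := fun j x => by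
    rw [mul_comm, Nat.mul_add_div hv, Nat.div_eq_of_lt x.isLt, add_zero]
  have hmod : ∀ (j : Fin (n / v)) (x : Fin v), (j.val * v + x.val) % v = x.val := fun j x => by
    rw [mul_comm, Nat.mul_add_mod, Nat.mod_eq_of_lt x.isLt]
  have hedges : (n / v) * (orderedEdges H).card ≤ (orderedEdges B).card := by
    rw [← Fintype.card_fin (n / v), ← Finset.card_univ, ← Finset.card_product]
    refine Finset.card_le_card_of_injOn
      (fun q => (⟨q.1.val * v + q.2.1.val, hlt _ _⟩, ⟨q.1.val * v + q.2.2.val, hlt _ _⟩)) ?_ ?_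
    · rintro ⟨j, x, y⟩ hq
      have hq' := mem_orderedEdges.1 (Finset.mem_product.1 hq).2
      refine mem_orderedEdges.2 ⟨?_, ?_, ?_⟩
      · have : x.val < y.val := hq'.1
        rw [Fin.mk_lt_mk]
        simpa using this
      · simp only [hdiv]
      · simpa only [hmod] using hq'.2
    · rintro ⟨j, x, y⟩ - ⟨j', x', y'⟩ - heq
      simp only [Prod.mk.injEq, Fin.mk.injEq] at heq
      have hj : j = j' := Fin.ext (by rw [← hdiv j x, heq.1, hdiv])
      have hx : x = x' := Fin.ext (by rw [← hmod j x, heq.1, hmod])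
      have hy : y = y' := Fin.ext (by rw [← hmod j y, heq.2, hmod])
      rw [hj, hx, hy]
  refine le_trans ?_ (hedges.trans (card_orderedEdges_le_ex hav))
  have hq : 1 ≤ n / v := (Nat.one_le_div_iff hv).2 hn
  have h1 := Nat.div_add_mod n v
  have h2 := Nat.mod_lt n hv
  have h3 : n ≤ 2 * (n / v * v) := by nlinarith
  calc K * n ≤ K * (2 * (n / v * v)) := Nat.mul_le_mul_left K h3
    _ = (n / v) * (2 * K * v) := by ring
    _ ≤ _ := Nat.mul_le_mul_left _ hcard

/-! ### Patterns avoided by complete bipartite graphs -/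

/-- The complete bipartite graph between the two halves of the vertices has quadratically many
edges. -/
lemma superlinear_of_avoids_bipartite {G : OrderedGraph}
    (h : ∀ n m : ℕ, (⟨n, ofRel n fun a b => a < m ∧ m ≤ b⟩ : OrderedGraph).Avoids G) :
    G.Superlinear := by
  intro K
  filter_upwards [eventually_ge_atTop (4 * K)] with n hn
  refine le_trans ?_ (card_orderedEdges_le_ex (h n (n / 2)))
  have : (n / 2) * (n - n / 2) ≤
      (orderedEdges (ofRel n fun a b => a < n / 2 ∧ n / 2 ≤ b)).card := by
    have hc : n / 2 * (n - n / 2) = (Finset.univ : Finset (Fin (n / 2) × Fin (n - n / 2))).card := by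
      simp
    rw [hc]
    refine Finset.card_le_card_of_injOn
      (fun q => (⟨q.1.val, by omega⟩, ⟨n / 2 + q.2.val, by omega⟩)) ?_ ?_
    · rintro ⟨a, b⟩ -
      have h1 : (⟨a.val, by omega⟩ : Fin n) < ⟨n / 2 + b.val, by omega⟩ := by
        rw [Fin.mk_lt_mk]; omega
      refine mem_orderedEdges.2 ⟨h1, (ofRel_adj h1).2 ⟨?_, ?_⟩⟩
      · exact a.isLt
      · exact Nat.le_add_right _ _
    · rintro ⟨a, b⟩ - ⟨c, d⟩ - heq
      simp only [Prod.mk.injEq, Fin.mk.injEq] at heq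
      exact Prod.ext (Fin.ext heq.1) (Fin.ext (by simpa using heq.2))
  refine le_trans ?_ this
  have h1 : 2 * K ≤ n / 2 := by omega
  have h2 : n ≤ 2 * (n - n / 2) := by omega
  calc K * n ≤ K * (2 * (n - n / 2)) := Nat.mul_le_mul_left _ h2
    _ = 2 * K * (n - n / 2) := by ring
    _ ≤ _ := Nat.mul_le_mul_right _ h1

lemma superlinear_monotone_path : (pattern 3 [(0, 1), (1, 2)]).Superlinear := by
  refine superlinear_of_avoids_bipartite fun n m h => ?_
  obtain ⟨f, hf, hadj⟩ := h.exists_strictMono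
  have l1 : f 0 < f 1 := hf (by decide)
  have l2 : f 1 < f 2 := hf (by decide)
  have h1 := (ofRel_adj l1).1 (hadj 0 1 (by decide) (by decide))
  have h2 := (ofRel_adj l2).1 (hadj 1 2 (by decide) (by decide))
  omega

lemma superlinear_consecutive_edges : (pattern 4 [(0, 1), (2, 3)]).Superlinear := by
  refine superlinear_of_avoids_bipartite fun n m h => ?_
  obtain ⟨f, hf, hadj⟩ := h.exists_strictMono
  have l1 : f 0 < f 1 := hf (by decide)
  have l2 : f 1 < f 2 := hf (by decide)
  have l3 : f 2 < f 3 := hf (by decide)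
  have h1 := (ofRel_adj l1).1 (hadj 0 1 (by decide) (by decide))
  have h2 := (ofRel_adj l3).1 (hadj 2 3 (by decide) (by decide))
  rw [Fin.lt_def] at l2
  omega

/-! ### Patterns avoided by graphs whose differences are powers of two -/

lemma two_mul_two_pow_le {a b : ℕ} (h : 2 ^ a < 2 ^ b) : 2 * 2 ^ a ≤ 2 ^ b := by
  rw [← pow_succ']
  exact Nat.pow_le_pow_right (by norm_num) ((Nat.pow_lt_pow_iff_right (by norm_num)).1 h)

/-- A bipartite graph between `[0, p)` and `[p, 3p)`, `p = 2 ^ T`, with `b = 2 p + a - 2 ^ t`. -/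
def powerGraph (T : ℕ) : SimpleGraph (Fin (3 * 2 ^ T)) :=
  ofRel _ fun a b => a < 2 ^ T ∧ 2 ^ T ≤ b ∧ ∃ t, t < T ∧ b + 2 ^ t = 2 * 2 ^ T + a

/-- The graph obtained from `powerGraph` by reversing the order of the first part. -/
def powerGraph' (T : ℕ) : SimpleGraph (Fin (3 * 2 ^ T)) :=
  ofRel _ fun a b => a < 2 ^ T ∧ 2 ^ T ≤ b ∧ ∃ t, t < T ∧ a + b + 2 ^ t + 1 = 3 * 2 ^ T

lemma card_powerGraph (T : ℕ) : 2 ^ T * T ≤ (orderedEdges (powerGraph T)).card := by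
  have hc : 2 ^ T * T = (Finset.univ : Finset (Fin (2 ^ T) × Fin T)).card := by simp
  rw [hc]
  have hpow : ∀ t : Fin T, 2 * 2 ^ t.val ≤ 2 ^ T := fun t =>
    two_mul_two_pow_le (Nat.pow_lt_pow_right (by norm_num) t.isLt)
  refine Finset.card_le_card_of_injOn (fun q => (⟨q.1.val, by omega⟩,
    ⟨2 * 2 ^ T + q.1.val - 2 ^ q.2.val, by have := hpow q.2; omega⟩)) ?_ ?_
  · rintro ⟨a, t⟩ -
    have ht := hpow t
    have ha := a.isLt
    have h1 : (⟨a.val, by omega⟩ : Fin (3 * 2 ^ T)) <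
        ⟨2 * 2 ^ T + a.val - 2 ^ t.val, by omega⟩ := by rw [Fin.mk_lt_mk]; omega
    refine mem_orderedEdges.2 ⟨h1, (ofRel_adj h1).2 ⟨ha, ?_, t.val, t.isLt, ?_⟩⟩ <;>
    simp only <;> omega
  · rintro ⟨a, t⟩ - ⟨c, s⟩ - heq
    simp only [Prod.mk.injEq, Fin.mk.injEq] at heq
    have := hpow t
    have := hpow s
    refine Prod.ext (Fin.ext heq.1) (Fin.ext (Nat.pow_right_injective (le_refl 2) ?_))
    simp only
    omega

lemma card_powerGraph' (T : ℕ) : 2 ^ T * T ≤ (orderedEdges (powerGraph' T)).card := by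
  have hc : 2 ^ T * T = (Finset.univ : Finset (Fin (2 ^ T) × Fin T)).card := by simp
  rw [hc]
  have hpow : ∀ t : Fin T, 2 * 2 ^ t.val ≤ 2 ^ T := fun t =>
    two_mul_two_pow_le (Nat.pow_lt_pow_right (by norm_num) t.isLt)
  refine Finset.card_le_card_of_injOn (fun q => (⟨q.1.val, by omega⟩,
    ⟨3 * 2 ^ T - 1 - q.1.val - 2 ^ q.2.val, by have := hpow q.2; omega⟩)) ?_ ?_
  · rintro ⟨a, t⟩ -
    have ht := hpow t
    have ha := a.isLt
    have hpos : 0 < 2 ^ t.val := by positivity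
    have h1 : (⟨a.val, by omega⟩ : Fin (3 * 2 ^ T)) <
        ⟨3 * 2 ^ T - 1 - a.val - 2 ^ t.val, by omega⟩ := by rw [Fin.mk_lt_mk]; omega
    refine mem_orderedEdges.2 ⟨h1, (ofRel_adj h1).2 ⟨ha, ?_, t.val, t.isLt, ?_⟩⟩ <;>
    simp only <;> omega
  · rintro ⟨a, t⟩ - ⟨c, s⟩ - heq
    simp only [Prod.mk.injEq, Fin.mk.injEq] at heq
    have := hpow t
    have := hpow s
    have := a.isLt
    have := c.isLt
    refine Prod.ext (Fin.ext heq.1) (Fin.ext (Nat.pow_right_injective (le_refl 2) ?_))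
    simp only
    omega

lemma superlinear_of_avoids_powerGraph {G : OrderedGraph} (hirr : G.Irreducible)
    (h : ∀ T, (⟨_, powerGraph T⟩ : OrderedGraph).Avoids G) : G.Superlinear :=
  superlinear_of_irreducible hirr fun K => ⟨3 * 2 ^ (3 * K), by positivity, _, h _, by
    have := card_powerGraph (3 * K)
    nlinarith⟩

lemma superlinear_of_avoids_powerGraph' {G : OrderedGraph} (hirr : G.Irreducible)
    (h : ∀ T, (⟨_, powerGraph' T⟩ : OrderedGraph).Avoids G) : G.Superlinear :=
  superlinear_of_irreducible hirr fun K => ⟨3 * 2 ^ (3 * K), by positivity, _, h _, by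
    have := card_powerGraph' (3 * K)
    nlinarith⟩

lemma irreducible_pattern {m : ℕ} {E : List (ℕ × ℕ)}
    (h : ∀ h : Fin m → ℕ, Monotone h → (∀ a b : Fin m, a < b → (a.val, b.val) ∈ E → h a = h b) →
      ∀ a b, h a = h b) : (pattern m E).Irreducible :=
  fun g hg hadj => h g hg fun a b hab hE => hadj a b ((pattern_adj hab).2 hE)

/-- With exponents `a`, `b`, `c`, `d` for the four edges in the listed order, `2 ^ a + 2 ^ d = 2 ^ b
+ 2 ^ c`. But `2 ^ c` exceeds `2 ^ a` and `2 ^ d`, hence is at least twice each of them, and `2 ^ b`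
would not be positive. -/
lemma superlinear_four_cycle : (pattern 4 [(0, 2), (0, 3), (1, 2), (1, 3)]).Superlinear := by
  refine superlinear_of_avoids_powerGraph (irreducible_pattern fun h _ he => ?_) fun T h => ?_
  · have e1 := he 0 2 (by decide) (by decide)
    have e2 := he 0 3 (by decide) (by decide)
    have e3 := he 1 2 (by decide) (by decide)
    intro a b
    fin_cases a <;> fin_cases b <;> simp <;> omega
  · obtain ⟨f, hf, hadj⟩ := h.exists_strictMono
    have l1 : f 0 < f 1 := hf (by decide)
    have l2 : f 2 < f 3 := hf (by decide)
    obtain ⟨-, -, a, -, ha⟩ := (ofRel_adj (hf (by decide))).1 (hadj 0 2 (by decide) (by decide))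
    obtain ⟨-, -, b, -, hb⟩ := (ofRel_adj (hf (by decide))).1 (hadj 0 3 (by decide) (by decide))
    obtain ⟨-, -, c, -, hc⟩ := (ofRel_adj (hf (by decide))).1 (hadj 1 2 (by decide) (by decide))
    obtain ⟨-, -, d, -, hd⟩ := (ofRel_adj (hf (by decide))).1 (hadj 1 3 (by decide) (by decide))
    rw [Fin.lt_def] at l1 l2
    have h1 : 2 * 2 ^ a ≤ 2 ^ c := two_mul_two_pow_le (by omega)
    have h2 : 2 * 2 ^ d ≤ 2 ^ c := two_mul_two_pow_le (by omega)
    have : 0 < 2 ^ b := by positivity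
    omega

/-- As for the four-cycle: moving the far end of the second edge beyond vertex `3` only decreases `2
^ b`. -/
lemma superlinear_fork : (pattern 5 [(0, 2), (0, 4), (1, 2), (1, 3)]).Superlinear := by
  refine superlinear_of_avoids_powerGraph (irreducible_pattern fun h _ he => ?_) fun T h => ?_
  · have e1 := he 0 2 (by decide) (by decide)
    have e2 := he 0 4 (by decide) (by decide)
    have e3 := he 1 2 (by decide) (by decide)
    have e4 := he 1 3 (by decide) (by decide)
    intro a b
    fin_cases a <;> fin_cases b <;> simp <;> omega
  · obtain ⟨f, hf, hadj⟩ := h.exists_strictMono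
    have l1 : f 0 < f 1 := hf (by decide)
    have l2 : f 2 < f 3 := hf (by decide)
    have l3 : f 3 < f 4 := hf (by decide)
    obtain ⟨-, -, a, -, ha⟩ := (ofRel_adj (hf (by decide))).1 (hadj 0 2 (by decide) (by decide))
    obtain ⟨-, -, b, -, hb⟩ := (ofRel_adj (hf (by decide))).1 (hadj 0 4 (by decide) (by decide))
    obtain ⟨-, -, c, -, hc⟩ := (ofRel_adj (hf (by decide))).1 (hadj 1 2 (by decide) (by decide))
    obtain ⟨-, -, d, -, hd⟩ := (ofRel_adj (hf (by decide))).1 (hadj 1 3 (by decide) (by decide))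
    rw [Fin.lt_def] at l1 l2 l3
    have h1 : 2 * 2 ^ a ≤ 2 ^ c := two_mul_two_pow_le (by omega)
    have h2 : 2 * 2 ^ d ≤ 2 ^ c := two_mul_two_pow_le (by omega)
    have : 0 < 2 ^ b := by positivity
    omega

/-- With the first part reversed, `2 ^ a` is the power that is at least twice its two competitors `2
^ b` and `2 ^ c`, and now `2 ^ d` would not be positive. -/
lemma superlinear_fork' : (pattern 5 [(0, 2), (0, 3), (1, 2), (1, 4)]).Superlinear := by
  refine superlinear_of_avoids_powerGraph' (irreducible_pattern fun h _ he => ?_) fun T h => ?_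
  · have e1 := he 0 2 (by decide) (by decide)
    have e2 := he 0 3 (by decide) (by decide)
    have e3 := he 1 2 (by decide) (by decide)
    have e4 := he 1 4 (by decide) (by decide)
    intro a b
    fin_cases a <;> fin_cases b <;> simp <;> omega
  · obtain ⟨f, hf, hadj⟩ := h.exists_strictMono
    have l1 : f 0 < f 1 := hf (by decide)
    have l2 : f 2 < f 3 := hf (by decide)
    have l3 : f 3 < f 4 := hf (by decide)
    obtain ⟨-, -, a, -, ha⟩ := (ofRel_adj (hf (by decide))).1 (hadj 0 2 (by decide) (by decide))
    obtain ⟨-, -, b, -, hb⟩ := (ofRel_adj (hf (by decide))).1 (hadj 0 3 (by decide) (by decide))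
    obtain ⟨-, -, c, -, hc⟩ := (ofRel_adj (hf (by decide))).1 (hadj 1 2 (by decide) (by decide))
    obtain ⟨-, -, d, -, hd⟩ := (ofRel_adj (hf (by decide))).1 (hadj 1 4 (by decide) (by decide))
    rw [Fin.lt_def] at l1 l2 l3
    have h1 : 2 * 2 ^ c ≤ 2 ^ a := two_mul_two_pow_le (by omega)
    have h2 : 2 * 2 ^ b ≤ 2 ^ a := two_mul_two_pow_le (by omega)
    have : 0 < 2 ^ d := by positivity
    omega

end OrderedGraph

namespace OrderedGraph

/-! ### Zero-one matrices without alternations -/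

/-- A zero-one matrix `M` in which no rows `a < b` have ones in the columns `c₁ < c₂ < c₃ < c₄` of
`a`, `b`, `a`, `b` respectively. Each row has at least `d` ones, the first of them in the column
`home`. The columns in the range of `home` contain only first ones, exactly `m` each, and the later
ones of two rows with the same home come separately, those of the lower row first. -/
structure AlternationFree {ρ γ : Type} [LinearOrder ρ] [LinearOrder γ] (M : ρ → γ → Prop)
    (home : ρ → γ) (d m : ℕ) : Prop where
  home_mem : ∀ r, M r (home r)
  home_le : ∀ r c, M r c → home r ≤ c
  home_eq : ∀ r r', M r (home r') → home r = home r'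
  fiber : ∀ r, {r' | home r' = home r}.ncard = m
  deg : ∀ r, d ≤ {c | M r c}.ncard
  avoids : ∀ a b, a < b → ∀ c₁ c₂ c₃ c₄, M a c₁ → M b c₂ → M a c₃ → M b c₄ →
    c₁ < c₂ → c₂ < c₃ → c₃ < c₄ → False
  later : ∀ a b, a < b → home a = home b → ∀ c c', M b c → M a c' → home a < c → home a < c' →
    c < c'

/-- There is an alternation free matrix with at least `K` home columns and few other columns. -/
def ExistsAlternationFree (d m K E : ℕ) : Prop :=
  ∃ (ρ γ : Type) (_ : LinearOrder ρ) (_ : LinearOrder γ) (_ : Fintype ρ) (_ : Fintype γ)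
    (M : ρ → γ → Prop) (home : ρ → γ), AlternationFree M home d m ∧ K ≤ (Set.range home).ncard ∧
      {c | ∃ r, M r c}.ncard * E ≤ (d * E + m) * (Set.range home).ncard

/-- Start of the outer recursion: each row has its home as its only one. -/
lemma existsAlternationFree_one {m : ℕ} (hm : 0 < m) (K E : ℕ) :
    ExistsAlternationFree 1 m K E := by
  refine ⟨Fin K ×ₗ Fin m, Fin K, inferInstance, inferInstance, inferInstance, inferInstance,
    fun r c => (ofLex r).1 = c, fun r => (ofLex r).1, ⟨fun _ => rfl, fun _ _ h => h.le,
    fun _ _ h => h, fun r => ?_, fun r => ?_, ?_, ?_⟩, ?_, ?_⟩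
  · have : {r' : Fin K ×ₗ Fin m | (ofLex r').1 = (ofLex r).1} =
        (fun x => toLex ((ofLex r).1, x)) '' Set.univ := by
      ext r'
      simp only [Set.mem_ofPred_eq, Set.image_univ, Set.mem_range]
      constructor
      · intro h
        exact ⟨(ofLex r').2, by rw [← h]; rfl⟩
      · rintro ⟨x, rfl⟩
        rfl
    rw [this, Set.ncard_image_of_injective _ fun x y h => by simpa using h]
    simp
  · simp
  · rintro a b - c₁ c₂ c₃ c₄ rfl - rfl - h1 h2 -
    exact lt_asymm h1 h2
  · rintro a b - h c c' rfl - h1 -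
    exact absurd h1 (by rw [h]; exact lt_irrefl _)
  · have : Set.range (fun r : Fin K ×ₗ Fin m => (ofLex r).1) = Set.univ :=
      Set.eq_univ_of_forall fun c => ⟨toLex (c, ⟨0, hm⟩), rfl⟩
    rw [this]
    simp
  · have : {c : Fin K | ∃ r : Fin K ×ₗ Fin m, (ofLex r).1 = c} =
      Set.range (fun r : Fin K ×ₗ Fin m => (ofLex r).1) := rfl
    rw [this, mul_comm]
    exact Nat.mul_le_mul_right _ (by omega)

/-- Start of the inner recursion: each row has its own block of `d + 1` columns. -/
lemma existsAlternationFree_base (d K E : ℕ) : ExistsAlternationFree (d + 1) 1 K E := by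
  have hcols : ∀ r : Fin K, {c : Fin K ×ₗ Fin (d + 1) | (ofLex c).1 = r} =
      (fun x => toLex (r, x)) '' Set.univ := by
    intro r
    ext c
    simp only [Set.mem_ofPred_eq, Set.image_univ, Set.mem_range]
    constructor
    · rintro rfl
      exact ⟨(ofLex c).2, rfl⟩
    · rintro ⟨x, rfl⟩
      rfl
  have hrange : (Set.range fun r : Fin K => (toLex (r, 0) : Fin K ×ₗ Fin (d + 1))).ncard = K := by
    rw [← Set.image_univ, Set.ncard_image_of_injective _ fun x y h => by simpa using h]
    simp
  refine ⟨Fin K, Fin K ×ₗ Fin (d + 1), inferInstance, inferInstance, inferInstance, inferInstance,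
    fun r c => (ofLex c).1 = r, fun r => toLex (r, 0), ⟨fun _ => rfl, fun r c h => ?_,
    fun r r' h => ?_, fun r => ?_, fun r => ?_, ?_, ?_⟩, ?_, ?_⟩
  · rw [Prod.Lex.le_iff]
    right
    exact ⟨h.symm, Fin.zero_le _⟩
  · rw [← h]; rfl
  · simp
  · rw [hcols, Set.ncard_image_of_injective _ fun x y h => by simpa using h]
    simp
  · rintro a b hab c₁ c₂ c₃ c₄ rfl rfl h3 - h1 h2 -
    rw [Prod.Lex.lt_iff] at h1 h2
    rcases h2 with h2 | h2
    · rw [h3] at h2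
      exact lt_asymm hab h2
    · rw [h3] at h2
      exact hab.ne h2.1.symm
  · intro a b hab h
    exact absurd (by simpa using h) hab.ne
  · rw [hrange]
  · rw [hrange]
    have h1 : {c : Fin K ×ₗ Fin (d + 1) | ∃ r, (ofLex c).1 = r} = Set.univ :=
      Set.eq_univ_of_forall fun c => ⟨_, rfl⟩
    rw [h1, Set.ncard_univ, Nat.card_eq_fintype_card]
    have h2 : Fintype.card (Fin K ×ₗ Fin (d + 1)) = K * (d + 1) := by
      rw [Fintype.card_lex, Fintype.card_prod, Fintype.card_fin, Fintype.card_fin]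
    rw [h2]
    nlinarith

/-- The rows with a given home are listed in order, and so is `S`; the `i`-th row from the front is
matched with the `i`-th element from the back. -/
lemma exists_antitone_bijection {ρ γ δ : Type} [LinearOrder ρ] [LinearOrder γ] [Fintype ρ]
    [Fintype δ] [LinearOrder δ] (home : ρ → γ) (S : Set δ)
    (h : ∀ r, {r' | home r' = home r}.ncard = S.ncard) :
    ∃ φ : ρ → δ, (∀ y, φ y ∈ S) ∧ (∀ y y', y < y' → home y = home y' → φ y' < φ y) ∧
      ∀ y, ∀ z ∈ S, ∃ y', home y' = home y ∧ φ y' = z := by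
  classical
  let S' : Finset δ := S.toFinset
  have hS : S.ncard = S'.card := Set.ncard_eq_toFinset_card' S
  let F : γ → Finset ρ := fun c => Finset.univ.filter fun r => home r = c
  have hF : ∀ r, (F (home r)).card = S'.card := fun r => by
    rw [← hS, ← h r, Set.ncard_eq_toFinset_card']
    congr 1
    ext
    simp [F]
  have hFc : ∀ c, (∃ r, home r = c) → (F c).card = S'.card := by
    rintro c ⟨r, rfl⟩
    exact hF r
  let e : Fin S'.card ≃o S' := S'.orderIsoOfFin rfl
  let ε : ∀ c, (∃ r, home r = c) → (Fin S'.card ≃o F c) := fun c hc =>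
    (F c).orderIsoOfFin (hFc c hc)
  let φ : ρ → δ := fun r =>
    e (((ε (home r) ⟨r, rfl⟩).symm ⟨r, Finset.mem_filter.2 ⟨Finset.mem_univ _, rfl⟩⟩).rev)
  have hφ : ∀ c (hc : ∃ r, home r = c) (i : Fin S'.card),
      home (ε c hc i).1 = c ∧ φ (ε c hc i).1 = e i.rev := by
    intro c hc i
    have h1 : home (ε c hc i).1 = c := (Finset.mem_filter.1 (ε c hc i).2).2
    refine ⟨h1, ?_⟩
    have h2 : ∀ c' (hc' : ∃ r, home r = c') (hm : (ε c hc i).1 ∈ F c'), c' = c →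
        (ε c' hc').symm ⟨(ε c hc i).1, hm⟩ = i := by
      rintro c' hc' hm rfl
      simp
    simp only [φ]
    rw [h2 _ ⟨_, rfl⟩ _ h1]
  have hsurj : ∀ r, ∃ i, (ε (home r) ⟨r, rfl⟩ i).1 = r := fun r =>
    ⟨(ε (home r) ⟨r, rfl⟩).symm ⟨r, Finset.mem_filter.2 ⟨Finset.mem_univ _, rfl⟩⟩, by simp⟩
  refine ⟨φ, fun y => ?_, fun y y' hlt hy => ?_, fun y z hz => ?_⟩
  · have := (e (((ε (home y) ⟨y, rfl⟩).symm
      ⟨y, Finset.mem_filter.2 ⟨Finset.mem_univ _, rfl⟩⟩).rev)).2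
    exact Set.mem_toFinset.1 this
  · obtain ⟨i, hi⟩ := hsurj y
    have hsurj' : ∃ j, (ε (home y) ⟨y, rfl⟩ j).1 = y' :=
      ⟨(ε (home y) ⟨y, rfl⟩).symm ⟨y', Finset.mem_filter.2 ⟨Finset.mem_univ _, hy.symm⟩⟩, by simp⟩
    obtain ⟨j, hj⟩ := hsurj'
    have e1 := (hφ (home y) ⟨y, rfl⟩ i).2
    have e2 := (hφ (home y) ⟨y, rfl⟩ j).2
    rw [hi] at e1
    rw [hj] at e2
    rw [e1, e2]
    have hij : i < j := by
      rw [← (ε (home y) ⟨y, rfl⟩).lt_iff_lt, ← Subtype.coe_lt_coe, hi, hj]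
      exact hlt
    exact Subtype.coe_lt_coe.2 (e.lt_iff_lt.2 (Fin.rev_lt_rev.2 hij))
  · let i := e.symm ⟨z, Set.mem_toFinset.2 hz⟩
    refine ⟨(ε (home y) ⟨y, rfl⟩ i.rev).1, (hφ (home y) ⟨y, rfl⟩ i.rev).1, ?_⟩
    rw [(hφ (home y) ⟨y, rfl⟩ i.rev).2]
    simp [i]

section Composition

variable {ρ γ σ δ : Type}

/-- The composition of two matrices: a copy of `X` is placed in front of each home column of `Y`,
and the rows of `Y` with this home get an extra one in the copy, in the column `φ`. -/
def compMatrix (Y : ρ → γ → Prop) (home : ρ → γ) (X : σ → δ → Prop) (φ : ρ → δ) :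
    ρ ⊕ₗ (Set.range home ×ₗ σ) → γ ×ₗ WithTop δ → Prop := fun r c =>
  Sum.elim (fun y => ((ofLex c).2 = ⊤ ∧ Y y (ofLex c).1) ∨ c = toLex (home y, (φ y : WithTop δ)))
    (fun q => ∃ x : δ, c = toLex ((ofLex q).1.1, (x : WithTop δ)) ∧ X (ofLex q).2 x) (ofLex r)

/-- The home columns of the composition. -/
def compHome (home : ρ → γ) (homeX : σ → δ) (φ : ρ → δ) :
    ρ ⊕ₗ (Set.range home ×ₗ σ) → γ ×ₗ WithTop δ := fun r =>
  Sum.elim (fun y => toLex (home y, (φ y : WithTop δ)))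
    (fun q => toLex ((ofLex q).1.1, (homeX (ofLex q).2 : WithTop δ))) (ofLex r)

variable {Y : ρ → γ → Prop} {home : ρ → γ} {X : σ → δ → Prop} {homeX : σ → δ} {φ : ρ → δ}

lemma compMatrix_inl {y : ρ} {c : γ} {z : WithTop δ} :
    compMatrix Y home X φ (toLex (Sum.inl y)) (toLex (c, z)) ↔
      (z = ⊤ ∧ Y y c) ∨ (c = home y ∧ z = φ y) := by
  simp [compMatrix]

lemma compMatrix_inr {j : Set.range home} {q : σ} {c : γ} {z : WithTop δ} :
    compMatrix Y home X φ (toLex (Sum.inr (toLex (j, q)))) (toLex (c, z)) ↔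
      c = j.1 ∧ ∃ x : δ, z = x ∧ X q x := by
  simp only [compMatrix, ofLex_toLex, Sum.elim_inr, EmbeddingLike.apply_eq_iff_eq, Prod.mk.injEq]
  constructor
  · rintro ⟨x, ⟨h1, h2⟩, h3⟩
    exact ⟨h1, x, h2, h3⟩
  · rintro ⟨h1, x, h2, h3⟩
    exact ⟨x, ⟨h1, h2⟩, h3⟩

lemma toLex_lt_top {γ δ : Type} [LinearOrder γ] [LinearOrder δ] {c c' : γ} {x : δ} (h : c ≤ c') :
    (toLex (c, (x : WithTop δ)) : γ ×ₗ WithTop δ) < toLex (c', ⊤) := by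
  rw [Prod.Lex.toLex_lt_toLex]
  rcases h.lt_or_eq with h | h
  · exact Or.inl h
  · exact Or.inr ⟨h, WithTop.coe_lt_top x⟩

/-- The extra one raises the degree of the rows of `Y` to that of `X`, and puts exactly one further
row into each home column of each copy. Rows of `Y` precede those of the copies, so an alternation
between the two kinds would enclose a one of the `Y`-row in a copy; this is its first one, so none
can precede it. -/
theorem AlternationFree.comp [LinearOrder ρ] [LinearOrder γ] [LinearOrder σ] [LinearOrder δ]
    [Fintype ρ] [Fintype σ] [Fintype γ] [Fintype δ] {d m f : ℕ}
    (hY : AlternationFree Y home d f) (hX : AlternationFree X homeX (d + 1) m)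
    (hφ : ∀ y, φ y ∈ Set.range homeX)
    (hanti : ∀ y y', y < y' → home y = home y' → φ y' < φ y)
    (hsurj : ∀ y, ∀ z ∈ Set.range homeX, ∃ y', home y' = home y ∧ φ y' = z) :
    AlternationFree (compMatrix Y home X φ) (compHome home homeX φ) (d + 1) (m + 1) := by
  have hinl : ∀ y, compHome home homeX φ (toLex (Sum.inl y)) = toLex (home y, (φ y : WithTop δ)) :=
    fun y => rfl
  have hinr : ∀ (j : Set.range home) q, compHome home homeX φ (toLex (Sum.inr (toLex (j, q)))) =
    toLex (j.1, (homeX q : WithTop δ)) := fun j q => rfl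
  have hinj : ∀ y y', home y = home y' → φ y = φ y' → y = y' := fun y y' h1 h2 => by
    rcases lt_trichotomy y y' with h | h | h
    · exact absurd h2 (hanti _ _ h h1).ne'
    · exact h
    · exact absurd h2 (hanti _ _ h h1.symm).ne
  have hle : ∀ r c, compMatrix Y home X φ r c → compHome home homeX φ r ≤ c := by
    rintro (y | ⟨j, q⟩) ⟨c, z⟩ h
    · change toLex (home y, (φ y : WithTop δ)) ≤ toLex (c, z)
      rcases compMatrix_inl.1 h with ⟨rfl, h'⟩ | ⟨rfl, rfl⟩
      · exact (toLex_lt_top (hY.home_le _ _ h')).le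
      · exact le_rfl
    · change toLex (j.1, (homeX q : WithTop δ)) ≤ toLex (c, z)
      obtain ⟨rfl, x, rfl, h'⟩ := compMatrix_inr.1 h
      rw [Prod.Lex.toLex_le_toLex]
      exact Or.inr ⟨rfl, WithTop.coe_le_coe.2 (hX.home_le _ _ h')⟩
  have hproj : ∀ y c z, compMatrix Y home X φ (toLex (Sum.inl y)) (toLex (c, z)) → Y y c := by
    intro y c z h
    rcases compMatrix_inl.1 h with ⟨-, h⟩ | ⟨rfl, -⟩
    · exact h
    · exact hY.home_mem y
  refine ⟨?_, hle, ?_, ?_, ?_, ?_, ?_⟩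
  · rintro (y | ⟨j, q⟩)
    · exact compMatrix_inl.2 (Or.inr ⟨rfl, rfl⟩)
    · exact compMatrix_inr.2 ⟨rfl, _, rfl, hX.home_mem q⟩
  · rintro (y | ⟨j, q⟩) (y' | ⟨j', q'⟩) h
    · rcases compMatrix_inl.1 h with ⟨h, -⟩ | ⟨h1, h2⟩
      · exact absurd h (WithTop.coe_ne_top)
      · exact congrArg toLex (Prod.ext h1.symm h2.symm)
    · rcases compMatrix_inl.1 h with ⟨h, -⟩ | ⟨h1, h2⟩
      · exact absurd h (WithTop.coe_ne_top)
      · exact congrArg toLex (Prod.ext h1.symm h2.symm)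
    · obtain ⟨h1, x, h2, h3⟩ := compMatrix_inr.1 h
      obtain ⟨q', hq'⟩ := hφ y'
      have : x = homeX q' := by rw [hq']; exact (WithTop.coe_injective h2).symm
      rw [this] at h3
      have h4 : homeX q = φ y' := (hX.home_eq _ _ h3).trans hq'
      exact congrArg toLex (Prod.ext h1.symm (congrArg WithTop.some h4))
    · obtain ⟨h1, x, h2, h3⟩ := compMatrix_inr.1 h
      have : x = homeX q' := (WithTop.coe_injective h2).symm
      rw [this] at h3
      exact congrArg toLex (Prod.ext h1.symm (congrArg WithTop.some (hX.home_eq _ _ h3)))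
  · intro r
    obtain ⟨y, q, hr⟩ : ∃ y q, compHome home homeX φ r = toLex (home y, (homeX q : WithTop δ)) := by
      rcases r with (y | ⟨⟨_, y, rfl⟩, q⟩)
      · obtain ⟨q, hq⟩ := hφ y
        exact ⟨y, q, by rw [hq]; rfl⟩
      · exact ⟨y, q, rfl⟩
    obtain ⟨y', hy1, hy2⟩ := hsurj y (homeX q) ⟨q, rfl⟩
    have hset : {r' | compHome home homeX φ r' = compHome home homeX φ r} =
        insert (toLex (Sum.inl y'))
          ((fun q' => (toLex (Sum.inr (toLex ((⟨home y, y, rfl⟩ : Set.range home), q'))) :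
            ρ ⊕ₗ (Set.range home ×ₗ σ))) '' {q' | homeX q' = homeX q}) := by
      ext r'
      rw [hr]
      simp only [Set.mem_ofPred_eq, Set.mem_insert_iff, Set.mem_image]
      constructor
      · rcases r' with (y'' | ⟨j, q'⟩)
        · intro h
          have h' := congrArg ofLex h
          obtain ⟨h1, h2⟩ := Prod.ext_iff.1 h'
          left
          have h3 : φ y'' = homeX q := WithTop.coe_injective h2
          exact congrArg (fun y => toLex (Sum.inl y)) (hinj _ _ (Eq.trans h1 hy1.symm)
            (h3.trans hy2.symm))
        · intro h
          have h' := congrArg ofLex h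
          obtain ⟨h1, h2⟩ := Prod.ext_iff.1 h'
          right
          refine ⟨q', WithTop.coe_injective h2, ?_⟩
          have : (⟨home y, y, rfl⟩ : Set.range home) = j := Subtype.ext h1.symm
          rw [this]
          rfl
      · rintro (rfl | ⟨q', h, rfl⟩)
        · rw [hinl, hy1, hy2]
        · rw [hinr, h]
    have hfin : Function.Injective (fun q' => (toLex (Sum.inr (toLex
        ((⟨home y, y, rfl⟩ : Set.range home), q'))) : ρ ⊕ₗ (Set.range home ×ₗ σ))) := by
      intro a b hab
      simpa using hab
    rw [hset, Set.ncard_insert_of_notMem, Set.ncard_image_of_injective _ hfin, hX.fiber]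
    rintro ⟨q', -, h⟩
    simp at h
  · rintro (y | ⟨j, q⟩)
    · have hsub : insert (toLex (home y, (φ y : WithTop δ)))
          ((fun c => (toLex (c, ⊤) : γ ×ₗ WithTop δ)) '' {c | Y y c}) ⊆
          {c | compMatrix Y home X φ (toLex (Sum.inl y)) c} := by
        rintro c (rfl | ⟨c, hc, rfl⟩)
        · exact (compMatrix_inl (X := X)).2 (Or.inr ⟨rfl, rfl⟩)
        · exact (compMatrix_inl (X := X)).2 (Or.inl ⟨rfl, hc⟩)
      refine le_trans ?_ (Set.ncard_le_ncard hsub (Set.toFinite _))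
      rw [Set.ncard_insert_of_notMem, Set.ncard_image_of_injective]
      · exact Nat.succ_le_succ (hY.deg y)
      · intro a b hab
        simpa using hab
      · rintro ⟨c, -, h⟩
        simp at h
    · have hsub : ((fun x : δ => (toLex (j.1, (x : WithTop δ)) : γ ×ₗ WithTop δ)) '' {x | X q x}) ⊆
          {c | compMatrix Y home X φ (toLex (Sum.inr (toLex (j, q)))) c} := by
        rintro c ⟨x, hx, rfl⟩
        exact (compMatrix_inr (Y := Y) (φ := φ)).2 ⟨rfl, x, rfl, hx⟩
      refine le_trans ?_ (Set.ncard_le_ncard hsub (Set.toFinite _))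
      rw [Set.ncard_image_of_injective]
      · exact hX.deg q
      · intro a b hab
        simpa using hab
  · rintro (y | ⟨j, q⟩) (y' | ⟨j', q'⟩) hab ⟨c₁, z₁⟩ ⟨c₂, z₂⟩ ⟨c₃, z₃⟩ ⟨c₄, z₄⟩ h1 h2 h3 h4 l1 l2 l3
    · have hyy : y < y' := Sum.Lex.inl_lt_inl_iff.1 hab
      have p1 := hproj _ _ _ h1
      have p2 := hproj _ _ _ h2
      have p3 := hproj _ _ _ h3
      have p4 := hproj _ _ _ h4
      have same : ∀ {u v : ρ} {c c' : γ} {z z' : WithTop δ},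
          compMatrix Y home X φ (toLex (Sum.inl u)) (toLex (c, z)) → Y v c' →
          (toLex (c, z) : γ ×ₗ WithTop δ) < toLex (c', z') → ¬ c < c' → home u = home v := by
        intro u v c c' z z' hu hv hlt hcc
        rcases Prod.Lex.toLex_lt_toLex.1 hlt with h | ⟨h, h'⟩
        · exact absurd h hcc
        · simp only at h h'
          rcases compMatrix_inl.1 hu with ⟨rfl, -⟩ | ⟨hc, -⟩
          · exact absurd h' not_top_lt
          · rw [← h, hc] at hv
            exact (hY.home_eq _ _ hv).symm
      -- If the homes differ, the four columns strictly increase already in `Y`. Two of them in one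
      -- block would mean that the left one is an extra one, so that the other row has a one in its
      -- home column.
      have hhome : home y = home y' := by
        by_contra hne
        have e1 : c₁ < c₂ := by_contra fun h => hne (same h1 p2 l1 h)
        have e2 : c₂ < c₃ := by_contra fun h => hne (same h2 p3 l2 h).symm
        have e3 : c₃ < c₄ := by_contra fun h => hne (same h3 p4 l3 h)
        exact hY.avoids _ _ hyy _ _ _ _ p1 p2 p3 p4 e1 e2 e3
      have g1 : toLex (home y, (φ y : WithTop δ)) ≤ toLex (c₁, z₁) := hle _ _ h1
      have g2 := g1.trans_lt l1
      -- For equal homes, `φ` is antitone, so the extra one of `y'` precedes all ones of `y` and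
      -- cannot come second. The third and fourth ones are then later ones in `Y`, in the order
      -- excluded by `later`.
      have hz2 : z₂ = ⊤ := by
        rcases compMatrix_inl.1 h2 with ⟨h, -⟩ | ⟨rfl, rfl⟩
        · exact h
        · rcases Prod.Lex.toLex_lt_toLex.1 g2 with h | ⟨-, h⟩
          · simp only at h
            exact absurd hhome h.ne
          · simp only [WithTop.coe_lt_coe] at h
            exact absurd h (lt_asymm (hanti _ _ hyy hhome))
      have hc3 : c₂ < c₃ := by
        rcases Prod.Lex.toLex_lt_toLex.1 l2 with h | ⟨-, h⟩
        · exact h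
        · simp only [hz2] at h
          exact absurd h not_top_lt
      have hc4 : c₃ ≤ c₄ := by
        rcases Prod.Lex.toLex_lt_toLex.1 l3 with h | ⟨h, -⟩
        · exact h.le
        · exact h.le
      have hc2 : home y ≤ c₂ := by
        rw [hhome]
        exact hY.home_le _ _ p2
      exact absurd (hY.later _ _ hyy hhome _ _ p4 p3 (hc2.trans_lt (hc3.trans_le hc4))
        (hc2.trans_lt hc3)) (not_lt.2 hc4)
    · obtain ⟨rfl, x₂, rfl, -⟩ := compMatrix_inr.1 h2
      obtain ⟨rfl, x₄, rfl, -⟩ := compMatrix_inr.1 h4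
      rcases compMatrix_inl.1 h3 with ⟨rfl, -⟩ | ⟨rfl, rfl⟩
      · rcases Prod.Lex.toLex_lt_toLex.1 l2 with h | ⟨h, -⟩
        · exact lt_asymm l3 (Prod.Lex.toLex_lt_toLex.2 (Or.inl h))
        · rcases Prod.Lex.toLex_lt_toLex.1 l3 with h' | ⟨-, h'⟩
          · exact absurd h h'.ne'
          · exact not_top_lt h'
      · exact lt_irrefl _ (((hle _ _ h1).trans_lt l1).trans l2)
    · exact absurd hab Sum.Lex.not_inr_lt_inl
    · have hlt := Sum.Lex.inr_lt_inr_iff.1 hab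
      obtain ⟨rfl, x₁, rfl, k1⟩ := compMatrix_inr.1 h1
      obtain ⟨rfl, x₂, rfl, k2⟩ := compMatrix_inr.1 h2
      obtain ⟨rfl, x₃, rfl, k3⟩ := compMatrix_inr.1 h3
      obtain ⟨rfl, x₄, rfl, k4⟩ := compMatrix_inr.1 h4
      have hjj : j = j' := by
        rcases Prod.Lex.toLex_lt_toLex.1 l1 with h | ⟨h, -⟩
        · rcases Prod.Lex.toLex_lt_toLex.1 l2 with h' | ⟨h', -⟩
          · exact absurd h (lt_asymm h')
          · exact absurd h' h.ne'
        · exact Subtype.ext h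
      subst hjj
      have hq : q < q' := by
        rcases Prod.Lex.lt_iff.1 hlt with h | ⟨-, h⟩
        · exact absurd h (lt_irrefl _)
        · exact h
      have l1' : toLex (j.1, (x₁ : WithTop δ)) < toLex (j.1, (x₂ : WithTop δ)) := l1
      have l2' : toLex (j.1, (x₂ : WithTop δ)) < toLex (j.1, (x₃ : WithTop δ)) := l2
      have l3' : toLex (j.1, (x₃ : WithTop δ)) < toLex (j.1, (x₄ : WithTop δ)) := l3
      simp only [Prod.Lex.toLex_lt_toLex, lt_irrefl, false_or, true_and, WithTop.coe_lt_coe]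
        at l1' l2' l3'
      exact hX.avoids _ _ hq _ _ _ _ k1 k2 k3 k4 l1' l2' l3'
  · rintro (y | ⟨j, q⟩) (y' | ⟨j', q'⟩) hab hh ⟨c, z⟩ ⟨c', z'⟩ h1 h2 l1 l2
    · have hyy : y < y' := Sum.Lex.inl_lt_inl_iff.1 hab
      obtain ⟨e1, e2⟩ := Prod.ext_iff.1 (congrArg ofLex hh)
      exact absurd (WithTop.coe_injective e2) (hanti _ _ hyy e1).ne'
    · obtain ⟨rfl, x, rfl, -⟩ := compMatrix_inr.1 h1
      obtain ⟨e1, e2⟩ := Prod.ext_iff.1 (congrArg ofLex hh)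
      rcases compMatrix_inl.1 h2 with ⟨rfl, h⟩ | ⟨rfl, rfl⟩
      · refine toLex_lt_top ?_
        have := hY.home_le _ _ h
        exact le_trans (le_of_eq (Eq.symm e1)) this
      · exact absurd l2 (lt_irrefl _)
    · exact absurd hab Sum.Lex.not_inr_lt_inl
    · have hlt := Sum.Lex.inr_lt_inr_iff.1 hab
      obtain ⟨e1, e2⟩ := Prod.ext_iff.1 (congrArg ofLex hh)
      have hjj : j = j' := Subtype.ext e1
      subst hjj
      have hhX : homeX q = homeX q' := WithTop.coe_injective e2
      have hq : q < q' := by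
        rcases Prod.Lex.lt_iff.1 hlt with h | ⟨-, h⟩
        · exact absurd h (lt_irrefl _)
        · exact h
      obtain ⟨rfl, x, rfl, k1⟩ := compMatrix_inr.1 h1
      obtain ⟨rfl, x', rfl, k2⟩ := compMatrix_inr.1 h2
      have l1' : toLex (j.1, (homeX q : WithTop δ)) < toLex (j.1, (x : WithTop δ)) := l1
      have l2' : toLex (j.1, (homeX q : WithTop δ)) < toLex (j.1, (x' : WithTop δ)) := l2
      change toLex (j.1, (x : WithTop δ)) < toLex (j.1, (x' : WithTop δ))
      simp only [Prod.Lex.toLex_lt_toLex, lt_irrefl, false_or, true_and, WithTop.coe_lt_coe]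
        at l1' l2' ⊢
      exact hX.later _ _ hq hhX _ _ k1 k2 l1' l2'

end Composition

end OrderedGraph

/-! ### The Ackermann-type recursion and the superlinearity of alternations -/

namespace OrderedGraph

/-- The copies of `X` contribute `g` times its columns. The columns of `Y` itself, multiplied by
`E`, number at most `(d * E + f / 2) * g`, which is at most `f * g` since `2 * d * E ≤ f`; this is
the increase from `m` to `m + 1`. -/
lemma ExistsAlternationFree.comp {d m f E : ℕ} {σ δ : Type} [LinearOrder σ] [LinearOrder δ]
    [Fintype σ] [Fintype δ] {X : σ → δ → Prop} {homeX : σ → δ}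
    (hX : AlternationFree X homeX (d + 1) m) (hf : (Set.range homeX).ncard = f)
    (hXcols : {c | ∃ r, X r c}.ncard * E ≤ ((d + 1) * E + m) * f) (hfE : 2 * d * E ≤ f)
    (hY : ExistsAlternationFree d f 1 (2 * E)) : ExistsAlternationFree (d + 1) (m + 1) f E := by
  obtain ⟨ρ, γ, _, _, _, _, Y, home, hY, hg, hYcols⟩ := hY
  obtain ⟨φ, hφ, hanti, hsurj⟩ := exists_antitone_bijection home (Set.range homeX)
    (fun r => (hY.fiber r).trans hf.symm)
  have hcomp := hY.comp hX hφ hanti hsurj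
  set g := (Set.range home).ncard with hgdef
  have hrange : Set.range (compHome home homeX φ) =
      (fun p : γ × δ => (toLex (p.1, (p.2 : WithTop δ)) : γ ×ₗ WithTop δ)) ''
        (Set.range home ×ˢ Set.range homeX) := by
    ext c
    constructor
    · rintro ⟨(y | ⟨j, q⟩), rfl⟩
      · exact ⟨(home y, φ y), ⟨⟨y, rfl⟩, hφ y⟩, rfl⟩
      · exact ⟨(j.1, homeX q), ⟨j.2, ⟨q, rfl⟩⟩, rfl⟩
    · rintro ⟨⟨c, x⟩, ⟨hc, ⟨q, rfl⟩⟩, rfl⟩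
      exact ⟨toLex (Sum.inr (toLex (⟨c, hc⟩, q))), rfl⟩
  have hinj : Function.Injective
      (fun p : γ × δ => (toLex (p.1, (p.2 : WithTop δ)) : γ ×ₗ WithTop δ)) := by
    rintro ⟨a, b⟩ ⟨c, d⟩ h
    simpa using h
  have hs : (Set.range (compHome home homeX φ)).ncard = g * f := by
    rw [hrange, Set.ncard_image_of_injective _ hinj, Set.ncard_prod, hf]
  have hcols : {c | ∃ r, compMatrix Y home X φ r c} ⊆
      (fun p : γ × δ => (toLex (p.1, (p.2 : WithTop δ)) : γ ×ₗ WithTop δ)) ''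
        (Set.range home ×ˢ {c | ∃ r, X r c}) ∪
      (fun c : γ => (toLex (c, ⊤) : γ ×ₗ WithTop δ)) '' {c | ∃ r, Y r c} := by
    rintro ⟨c, z⟩ ⟨(y | ⟨j, q⟩), h⟩
    · rcases compMatrix_inl.1 h with ⟨rfl, h'⟩ | ⟨rfl, rfl⟩
      · exact Or.inr ⟨c, ⟨y, h'⟩, rfl⟩
      · obtain ⟨q, hq⟩ := hφ y
        exact Or.inl ⟨(home y, φ y), ⟨⟨y, rfl⟩, q, hq ▸ hX.home_mem q⟩, rfl⟩
    · obtain ⟨rfl, x, rfl, h'⟩ := compMatrix_inr.1 h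
      exact Or.inl ⟨(j.1, x), ⟨j.2, q, h'⟩, rfl⟩
  have hN : {c | ∃ r, compMatrix Y home X φ r c}.ncard ≤
      g * {c | ∃ r, X r c}.ncard + {c | ∃ r, Y r c}.ncard := by
    refine (Set.ncard_le_ncard hcols (Set.toFinite _)).trans ((Set.ncard_union_le _ _).trans ?_)
    refine add_le_add ?_ (Set.ncard_image_le (Set.toFinite _))
    rw [Set.ncard_image_of_injective _ hinj, Set.ncard_prod]
  have : Fintype (Set.range home) := Fintype.ofFinite _
  have : Fintype (ρ ⊕ₗ (Set.range home ×ₗ σ)) :=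
    inferInstanceAs (Fintype (ρ ⊕ (Set.range home × σ)))
  have : Fintype (γ ×ₗ WithTop δ) := inferInstanceAs (Fintype (γ × Option δ))
  refine ⟨ρ ⊕ₗ (Set.range home ×ₗ σ), γ ×ₗ WithTop δ, inferInstance, inferInstance, inferInstance,
    inferInstance, compMatrix Y home X φ, compHome home homeX φ, hcomp, ?_, ?_⟩
  · rw [hs]
    exact Nat.le_mul_of_pos_left _ hg
  · rw [hs]
    have h1 := Nat.mul_le_mul_left (2 * E) hN
    have h2 := Nat.mul_le_mul_left (2 * g) hXcols
    have h3 := Nat.mul_le_mul_right g hfE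
    nlinarith

/-- Double recursion on the degree and the fibre size: raising `m` by one at degree `d + 2` uses a
matrix of degree `d + 1` whose fibre size is the number of home columns found so far. -/
theorem existsAlternationFree (d : ℕ) : ∀ m K E : ℕ, 0 < m →
    ExistsAlternationFree (d + 1) m K E := by
  induction d with
  | zero => exact fun m K E hm => existsAlternationFree_one hm K E
  | succ d ih =>
    intro m K E hm
    -- The surplus in the number of home columns is what the composition needs in order to absorb
    -- the columns of `Y`.
    have key : ∀ m, ExistsAlternationFree (d + 2) (m + 1) (K + 2 * (d + 1) * E + 1) E := by
      intro m
      induction m with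
      | zero => exact existsAlternationFree_base _ _ _
      | succ m ihm =>
        obtain ⟨σ, δ, _, _, _, _, X, homeX, hX, hK, hcols⟩ := ihm
        obtain ⟨ρ, γ, i₁, i₂, i₃, i₄, M, home, h1, h2, h3⟩ :=
          ExistsAlternationFree.comp hX rfl hcols (by omega) (ih _ 1 (2 * E) (by omega))
        exact ⟨ρ, γ, i₁, i₂, i₃, i₄, M, home, h1, hK.trans h2, h3⟩
    obtain ⟨m, rfl⟩ := Nat.exists_eq_succ_of_ne_zero hm.ne'
    obtain ⟨ρ, γ, i₁, i₂, i₃, i₄, M, home, h1, h2, h3⟩ := key m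
    exact ⟨ρ, γ, i₁, i₂, i₃, i₄, M, home, h1, by omega, h3⟩

/-- The bipartite ordered graph with a given bipartite adjacency matrix. -/
def ofMatrix {p N : ℕ} (M : Fin p → Fin N → Prop) : SimpleGraph (Fin (p + N)) :=
  ofRel (p + N) fun a b => ∃ r c, r.val = a ∧ p + c.val = b ∧ M r c

lemma ofMatrix_adj {p N : ℕ} {M : Fin p → Fin N → Prop} {a b : Fin (p + N)} (h : a < b) :
    (ofMatrix M).Adj a b ↔ ∃ r c, r.val = a.val ∧ p + c.val = b.val ∧ M r c :=
  ofRel_adj (R := fun a b => ∃ (r : Fin p) (c : Fin N), r.val = a ∧ p + c.val = b ∧ M r c) h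

lemma card_orderedEdges_ofMatrix {p N d : ℕ} (M : Fin p → Fin N → Prop)
    (hd : ∀ r, d ≤ {c | M r c}.ncard) : d * p ≤ (orderedEdges (ofMatrix M)).card := by
  classical
  have h1 : d * p ≤ ((Finset.univ : Finset (Fin p)).sigma fun r =>
      Finset.univ.filter fun c => M r c).card := by
    rw [Finset.card_sigma]
    calc d * p = ∑ r : Fin p, d := by simp [mul_comm]
      _ ≤ _ := Finset.sum_le_sum fun r _ => by
        refine (hd r).trans (le_of_eq ?_)
        rw [Set.ncard_eq_toFinset_card']
        congr 1
        ext
        simp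
  refine h1.trans (Finset.card_le_card_of_injOn
    (fun q => (Fin.castAdd N q.1, Fin.natAdd p q.2)) ?_ ?_)
  · rintro ⟨r, c⟩ hq
    have hlt : Fin.castAdd N r < Fin.natAdd p c := by
      rw [Fin.lt_def, Fin.val_castAdd, Fin.val_natAdd]
      have := r.isLt
      omega
    refine mem_orderedEdges.2 ⟨hlt, (ofMatrix_adj hlt).2 ⟨r, c, rfl, rfl, ?_⟩⟩
    exact (Finset.mem_filter.1 (Finset.mem_sigma.1 hq).2).2
  · rintro ⟨r, c⟩ - ⟨r', c'⟩ - h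
    simp only [Prod.mk.injEq] at h
    have e1 := Fin.castAdd_injective _ _ h.1
    have e2 := Fin.natAdd_injective _ _ h.2
    subst e1 e2
    rfl

/-- For each `K` there is a matrix with many more than `K` ones per row and column in which no rows
`a < b` alternate `a`, `b`, `a`, `b`. -/
theorem exists_matrix_without_alternation (K : ℕ) : ∃ (p N : ℕ) (M : Fin p → Fin N → Prop),
    0 < p ∧ (∃ d, (∀ r, d ≤ {c | M r c}.ncard) ∧ K * (p + N) ≤ d * p) ∧
    ∀ a b, a < b → ∀ c₁ c₂ c₃ c₄, M a c₁ → M b c₂ → M a c₃ → M b c₄ →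
      c₁ < c₂ → c₂ < c₃ → c₃ < c₄ → False := by
  classical
  -- With fibre size equal to `d` and `E = 1`, `s` home columns give `d * s` rows and at most `2 * d
  -- * s` columns, so `d = 3 * K + 1` ones per row suffice.
  obtain ⟨ρ, γ, _, _, _, _, M, home, h, hs, hN⟩ :=
    existsAlternationFree (3 * K) (3 * K + 1) 1 1 (Nat.succ_pos _)
  set d := 3 * K + 1 with hd
  set s := (Set.range home).ncard with hsdef
  let C : Set γ := {c | ∃ r, M r c}
  let σ : Fin (Fintype.card ρ) ≃o ρ := Fintype.orderIsoFinOfCardEq ρ rfl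
  let τ : Fin (Fintype.card C) ≃o C := Fintype.orderIsoFinOfCardEq C rfl
  have hp : Fintype.card ρ = d * s := by
    have h1 : ∀ c ∈ (Set.range home).toFinset,
        (Finset.univ.filter fun r => home r = c).card = d := by
      intro c hc
      obtain ⟨r, rfl⟩ := Set.mem_toFinset.1 hc
      rw [← h.fiber r, Set.ncard_eq_toFinset_card']
      congr 1
      ext
      simp
    have h2 := Finset.card_eq_sum_card_fiberwise (s := (Finset.univ : Finset ρ)) (f := home)
      (t := (Set.range home).toFinset) (fun r _ => by simp)
    rw [Finset.sum_congr rfl h1, Finset.card_univ, Finset.sum_const, smul_eq_mul] at h2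
    rw [h2, hsdef, Set.ncard_eq_toFinset_card', mul_comm]
  have hC : Fintype.card C ≤ 2 * d * s := by
    have : Fintype.card C = C.ncard := by
      rw [← Nat.card_eq_fintype_card, Nat.card_coe_set_eq]
    rw [this]
    nlinarith
  refine ⟨Fintype.card ρ, Fintype.card C, fun r c => M (σ r) (τ c).1, ?_, ⟨d, fun r => ?_, ?_⟩, ?_⟩
  · rw [hp]
    exact Nat.mul_pos (Nat.succ_pos _) hs
  · refine (h.deg (σ r)).trans ?_
    have : {c | M (σ r) c} = (fun c => (τ c).1) '' {c | M (σ r) (τ c).1} := by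
      ext c
      constructor
      · intro hc
        exact ⟨τ.symm ⟨c, σ r, hc⟩, by simpa using hc, by simp⟩
      · rintro ⟨c, hc, rfl⟩
        exact hc
    rw [this]
    exact Set.ncard_image_le (Set.toFinite _)
  · rw [hp]
    nlinarith [Nat.zero_le (K * d * s)]
  · intro a b hab c₁ c₂ c₃ c₄ h1 h2 h3 h4 l1 l2 l3
    exact h.avoids _ _ (σ.lt_iff_lt.2 hab) _ _ _ _ h1 h2 h3 h4 (τ.lt_iff_lt.2 l1)
      (τ.lt_iff_lt.2 l2) (τ.lt_iff_lt.2 l3)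

lemma superlinear_alternation :
    (pattern 6 [(0, 2), (1, 3), (0, 4), (1, 5)]).Superlinear := by
  refine superlinear_of_irreducible (irreducible_pattern fun h hm he => ?_) fun K => ?_
  · have e1 := he 0 2 (by decide) (by decide)
    have e2 := he 1 3 (by decide) (by decide)
    have e3 := he 0 4 (by decide) (by decide)
    have e4 := he 1 5 (by decide) (by decide)
    -- The two components interleave, so monotonicity forces them into the same block.
    have m1 := hm (show (0 : Fin 6) ≤ 1 by decide)
    have m2 := hm (show (1 : Fin 6) ≤ 2 by decide)
    intro a b
    fin_cases a <;> fin_cases b <;> simp <;> omega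
  · obtain ⟨p, N, M, hp, ⟨d, hd, hK⟩, hM⟩ := exists_matrix_without_alternation K
    refine ⟨p + N, by omega, ofMatrix M, fun h => ?_, hK.trans (card_orderedEdges_ofMatrix M hd)⟩
    obtain ⟨f, hf, hadj⟩ := h.exists_strictMono
    have l1 : f 0 < f 1 := hf (by decide)
    have l2 : f 2 < f 3 := hf (by decide)
    have l3 : f 3 < f 4 := hf (by decide)
    have l4 : f 4 < f 5 := hf (by decide)
    obtain ⟨a, c₁, ha, hc₁, h1⟩ := (ofMatrix_adj (hf (by decide))).1 (hadj 0 2 (by decide) (by decide))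
    obtain ⟨b, c₂, hb, hc₂, h2⟩ := (ofMatrix_adj (hf (by decide))).1 (hadj 1 3 (by decide) (by decide))
    obtain ⟨a', c₃, ha', hc₃, h3⟩ := (ofMatrix_adj (hf (by decide))).1 (hadj 0 4 (by decide) (by decide))
    obtain ⟨b', c₄, hb', hc₄, h4⟩ := (ofMatrix_adj (hf (by decide))).1 (hadj 1 5 (by decide) (by decide))
    obtain rfl : a = a' := Fin.ext (by omega)
    obtain rfl : b = b' := Fin.ext (by omega)
    rw [Fin.lt_def] at l1 l2 l3 l4
    refine hM a b ?_ c₁ c₂ c₃ c₄ h1 h2 h3 h4 ?_ ?_ ?_ <;> rw [Fin.lt_def] <;> omega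

lemma superlinear_alternation' :
    (pattern 6 [(1, 2), (0, 3), (1, 4), (0, 5)]).Superlinear := by
  refine superlinear_of_irreducible (irreducible_pattern fun h hm he => ?_) fun K => ?_
  · have e1 := he 1 2 (by decide) (by decide)
    have e2 := he 0 3 (by decide) (by decide)
    have e3 := he 1 4 (by decide) (by decide)
    have e4 := he 0 5 (by decide) (by decide)
    have m1 := hm (show (2 : Fin 6) ≤ 3 by decide)
    have m2 := hm (show (3 : Fin 6) ≤ 4 by decide)
    intro a b
    fin_cases a <;> fin_cases b <;> simp <;> omega
  · obtain ⟨p, N, M, hp, ⟨d, hd, hK⟩, hM⟩ := exists_matrix_without_alternation K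
    refine ⟨p + N, by omega, ofMatrix fun r => M r.rev, fun h => ?_,
      hK.trans (card_orderedEdges_ofMatrix _ fun r => hd r.rev)⟩
    obtain ⟨f, hf, hadj⟩ := h.exists_strictMono
    have l1 : f 0 < f 1 := hf (by decide)
    have l2 : f 2 < f 3 := hf (by decide)
    have l3 : f 3 < f 4 := hf (by decide)
    have l4 : f 4 < f 5 := hf (by decide)
    obtain ⟨a, c₁, ha, hc₁, h1⟩ := (ofMatrix_adj (hf (by decide))).1 (hadj 1 2 (by decide) (by decide))
    obtain ⟨b, c₂, hb, hc₂, h2⟩ := (ofMatrix_adj (hf (by decide))).1 (hadj 0 3 (by decide) (by decide))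
    obtain ⟨a', c₃, ha', hc₃, h3⟩ := (ofMatrix_adj (hf (by decide))).1 (hadj 1 4 (by decide) (by decide))
    obtain ⟨b', c₄, hb', hc₄, h4⟩ := (ofMatrix_adj (hf (by decide))).1 (hadj 0 5 (by decide) (by decide))
    obtain rfl : a = a' := Fin.ext (by omega)
    obtain rfl : b = b' := Fin.ext (by omega)
    rw [Fin.lt_def] at l1 l2 l3 l4
    refine hM a.rev b.rev (Fin.rev_lt_rev.2 ?_) c₁ c₂ c₃ c₄ h1 h2 h3 h4 ?_ ?_ ?_ <;>
    rw [Fin.lt_def] <;> omega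

end OrderedGraph

namespace OrderedGraph

/-! ### Structure of minimally non-linear ordered graphs -/

lemma contains_pattern {n m : ℕ} {G : SimpleGraph (Fin n)} {E : List (ℕ × ℕ)} (f : Fin m → Fin n)
    (hf : StrictMono f) (h : ∀ a b : Fin m, a < b → (a.val, b.val) ∈ E → G.Adj (f a) (f b)) :
    (⟨n, G⟩ : OrderedGraph).Contains (pattern m E) :=
  contains_of_strictMono (H := ⟨n, G⟩) (G := pattern m E) f hf fun a b hab hadj =>
    h a b hab ((pattern_adj hab).1 hadj)

lemma contains_alternation {n : ℕ} {G : SimpleGraph (Fin n)} {a b c₁ c₂ c₃ c₄ : Fin n} (hab : a < b)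
    (h1 : b < c₁) (h12 : c₁ < c₂) (h23 : c₂ < c₃) (h34 : c₃ < c₄) (e1 : G.Adj a c₁)
    (e2 : G.Adj b c₂) (e3 : G.Adj a c₃) (e4 : G.Adj b c₄) :
    (⟨n, G⟩ : OrderedGraph).Contains (pattern 6 [(0, 2), (1, 3), (0, 4), (1, 5)]) := by
  refine contains_pattern ![a, b, c₁, c₂, c₃, c₄] ?_ ?_
  · rw [Fin.strictMono_iff_lt_succ]
    intro i
    fin_cases i <;> assumption
  · intro i j hij hE
    fin_cases i <;> fin_cases j <;> first | assumption | simp at hE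

lemma contains_alternation' {n : ℕ} {G : SimpleGraph (Fin n)} {a b c₁ c₂ c₃ c₄ : Fin n}
    (hab : a < b) (h1 : b < c₁) (h12 : c₁ < c₂) (h23 : c₂ < c₃) (h34 : c₃ < c₄) (e1 : G.Adj b c₁)
    (e2 : G.Adj a c₂) (e3 : G.Adj b c₃) (e4 : G.Adj a c₄) :
    (⟨n, G⟩ : OrderedGraph).Contains (pattern 6 [(1, 2), (0, 3), (1, 4), (0, 5)]) := by
  refine contains_pattern ![a, b, c₁, c₂, c₃, c₄] ?_ ?_
  · rw [Fin.strictMono_iff_lt_succ]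
    intro i
    fin_cases i <;> assumption
  · intro i j hij hE
    fin_cases i <;> fin_cases j <;> first | assumption | simp at hE

lemma eq_of_mk_eq_pattern {n m : ℕ} {G : SimpleGraph (Fin n)} {E : List (ℕ × ℕ)}
    (h : (⟨n, G⟩ : OrderedGraph) = pattern m E) : n = m := congrArg order h

instance (n : ℕ) (R : ℕ → ℕ → Prop) [∀ a b, Decidable (R a b)] (a b : Fin n) :
    Decidable ((ofRel n R).Adj a b) :=
  inferInstanceAs (Decidable ((a < b ∧ R a b) ∨ (b < a ∧ R b a)))

set_option synthInstance.maxSize 1000 in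
set_option synthInstance.maxHeartbeats 200000 in
/-- Four alternating edges force a minimally non-linear graph to be a pattern with six vertices, all
of degree at most two. -/
theorem MinimallyNonlinear.of_alternation {n : ℕ} {G : SimpleGraph (Fin n)}
    (hG : (⟨n, G⟩ : OrderedGraph).MinimallyNonlinear) {a b c₁ c₂ c₃ c₄ : Fin n} (hab : a ≠ b)
    (ha : a < c₁) (hb : b < c₁) (h12 : c₁ < c₂) (h23 : c₂ < c₃) (h34 : c₃ < c₄) (e1 : G.Adj a c₁)
    (e2 : G.Adj b c₂) (e3 : G.Adj a c₃) (e4 : G.Adj b c₄) :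
    n = 6 ∧ ∀ v x y z, x < y → y < z → G.Adj v x → G.Adj v y → G.Adj v z → False := by
  rcases lt_or_gt_of_ne hab with h | h
  · have heq := hG.eq_of_contains superlinear_alternation
      (contains_alternation h hb h12 h23 h34 e1 e2 e3 e4)
    obtain rfl := eq_of_mk_eq_pattern heq
    refine ⟨rfl, ?_⟩
    have hG' : G = ofRel 6 fun a b => (a, b) ∈ [(0, 2), (1, 3), (0, 4), (1, 5)] := by
      simpa [pattern] using heq
    subst hG'
    decide
  · have heq := hG.eq_of_contains superlinear_alternation'
      (contains_alternation' h ha h12 h23 h34 e1 e2 e3 e4)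
    obtain rfl := eq_of_mk_eq_pattern heq
    refine ⟨rfl, ?_⟩
    have hG' : G = ofRel 6 fun a b => (a, b) ∈ [(1, 2), (0, 3), (1, 4), (0, 5)] := by
      simpa [pattern] using heq
    subst hG'
    decide

/-- A minimally non-linear graph in which every edge has exactly one end in `U`, where `U` has more
than two elements. -/
structure IsMinimalWithPart {n : ℕ} (G : SimpleGraph (Fin n)) (U : Finset (Fin n)) : Prop where
  minimal : (⟨n, G⟩ : OrderedGraph).MinimallyNonlinear
  bipartite : ∀ a b, G.Adj a b → (a ∈ U ↔ b ∉ U)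
  two_lt : 2 < U.card

lemma mem_map_revPerm {n : ℕ} {U : Finset (Fin n)} {a : Fin n} :
    a ∈ U.map Fin.revPerm.toEmbedding ↔ a.rev ∈ U := by
  simp only [Finset.mem_map_equiv]
  rfl

variable {n : ℕ} {G : SimpleGraph (Fin n)} {U : Finset (Fin n)}

lemma IsMinimalWithPart.reverse (h : IsMinimalWithPart G U) :
    IsMinimalWithPart (G.comap Fin.rev) (U.map Fin.revPerm.toEmbedding) where
  minimal := h.minimal.reverse
  bipartite a b hab := by
    rw [mem_map_revPerm, mem_map_revPerm]
    exact h.bipartite _ _ hab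
  two_lt := by
    rw [Finset.card_map]
    exact h.two_lt

lemma card_add_card_le_of_disjoint {n : ℕ} {U W : Finset (Fin n)} (h : Disjoint U W) :
    U.card + W.card ≤ n := by
  rw [← Finset.card_union_of_disjoint h]
  simpa using Finset.card_le_univ (U ∪ W)

lemma IsMinimalWithPart.lt_of_notMem_of_notMem (h : IsMinimalWithPart G U) {v w : Fin n}
    (hvw : v ≠ w) (hv : v ∉ U) (hw : w ∉ U) : 4 < n := by
  have := card_add_card_le_of_disjoint (U := U) (W := {v, w}) (by simp [hv, hw])
  have h2 := h.two_lt
  rw [Finset.card_pair hvw] at this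
  omega

/-- The gap lies behind the largest left end of an edge. An edge ending before it forms a monotone
path or two consecutive edges with the edge having that left end, and these patterns have too few
vertices for `U`. -/
lemma IsMinimalWithPart.exists_crossing (h : IsMinimalWithPart G U) :
    ∃ t ≤ n, Crossing G t := by
  classical
  by_contra hcon
  push Not at hcon
  let t := (orderedEdges G).sup fun p => p.1.val + 1
  have hle : ∀ a b, G.Adj a b → a < b → a.val < t := fun a b hab hlt =>
    Finset.le_sup (f := fun p : Fin n × Fin n => p.1.val + 1) (b := (a, b))
      (mem_orderedEdges.2 ⟨hlt, hab⟩)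
  have htn : t ≤ n := Finset.sup_le fun p _ => p.1.isLt
  have hnot := hcon t htn
  unfold Crossing at hnot
  push Not at hnot
  obtain ⟨c, d, hcd, hlt, hd⟩ := hnot
  have hd := hd (hle c d hcd hlt)
  obtain ⟨⟨a, b⟩, hab, hda⟩ := (Finset.lt_sup_iff (a := d.val)).1 hd
  obtain ⟨hab, hadj⟩ := mem_orderedEdges.1 hab
  simp only at hab hadj hda
  rcases (Nat.lt_succ_iff.1 hda).lt_or_eq with hda | hda
  · have hda : d < a := hda
    have hc : (⟨n, G⟩ : OrderedGraph).Contains (pattern 4 [(0, 1), (2, 3)]) := by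
      refine contains_pattern ![c, d, a, b] ?_ ?_
      · rw [Fin.strictMono_iff_lt_succ]
        intro i
        fin_cases i <;> assumption
      · intro i j hij hE
        fin_cases i <;> fin_cases j <;> first | assumption | simp at hE
    have hn := eq_of_mk_eq_pattern (h.minimal.eq_of_contains superlinear_consecutive_edges hc)
    have h1 : ∃ v ∉ U, v = c ∨ v = d := by
      by_cases hcU : c ∈ U
      · exact ⟨d, (h.bipartite _ _ hcd).1 hcU, Or.inr rfl⟩
      · exact ⟨c, hcU, Or.inl rfl⟩
    have h2 : ∃ v ∉ U, v = a ∨ v = b := by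
      by_cases hcU : a ∈ U
      · exact ⟨b, (h.bipartite _ _ hadj).1 hcU, Or.inr rfl⟩
      · exact ⟨a, hcU, Or.inl rfl⟩
    obtain ⟨v, hv, hv'⟩ := h1
    obtain ⟨w, hw, hw'⟩ := h2
    have hvw : v < w := by
      rcases hv' with rfl | rfl <;> rcases hw' with rfl | rfl
      · exact hlt.trans hda
      · exact (hlt.trans hda).trans hab
      · exact hda
      · exact hda.trans hab
    have := h.lt_of_notMem_of_notMem hvw.ne hv hw
    omega
  · have hda : d = a := Fin.ext hda
    subst hda
    have hc : (⟨n, G⟩ : OrderedGraph).Contains (pattern 3 [(0, 1), (1, 2)]) := by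
      refine contains_pattern ![c, d, b] ?_ ?_
      · rw [Fin.strictMono_iff_lt_succ]
        intro i
        fin_cases i <;> assumption
      · intro i j hij hE
        fin_cases i <;> fin_cases j <;> first | assumption | simp at hE
    have hn := eq_of_mk_eq_pattern (h.minimal.eq_of_contains superlinear_monotone_path hc)
    have h1 : ∃ v, v ∉ U := by
      by_cases hcU : c ∈ U
      · exact ⟨d, (h.bipartite _ _ hcd).1 hcU⟩
      · exact ⟨c, hcU⟩
    obtain ⟨v, hv⟩ := h1
    have := card_add_card_le_of_disjoint (U := U) (W := {v}) (by simp [hv])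
    have := h.two_lt
    rw [Finset.card_singleton] at *
    omega

lemma IsMinimalWithPart.exists_adj (h : IsMinimalWithPart G U) (v : Fin n) : ∃ w, G.Adj v w := by
  obtain ⟨t, -, ht⟩ := h.exists_crossing
  exact h.minimal.exists_adj ht v

/-- Two neighbours `u < u'` of a vertex `w` outside `U` do not both have larger neighbours. -/
lemma IsMinimalWithPart.not_fork (h : IsMinimalWithPart G U) {w u u' x x' : Fin n} (hw : w ∉ U)
    (huu : u ≠ u') (hu : u < w) (hu' : u' < w) (e1 : G.Adj u w) (e2 : G.Adj u' w)
    (hx : w < x) (hx' : w < x') (e3 : G.Adj u x) (e4 : G.Adj u' x') : False := by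
  wlog hlt : u < u' generalizing u u' x x'
  · exact this huu.symm hu' hu e2 e1 hx' hx e4 e3 (lt_of_le_of_ne (not_lt.1 hlt) huu.symm)
  have huU : u ∈ U := (h.bipartite _ _ e1).2 hw
  have hu'U : u' ∈ U := (h.bipartite _ _ e2).2 hw
  have hxU : x ∉ U := (h.bipartite _ _ e3).1 huU
  have hx'U : x' ∉ U := (h.bipartite _ _ e4).1 hu'U
  -- With three vertices outside `U` there are at least six in all, more than a fork has.
  have key : x ≠ x' → n = 5 → False := by
    intro hne hn
    have := card_add_card_le_of_disjoint (U := U) (W := {w, x, x'}) (by simp [hw, hxU, hx'U])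
    have h2 := h.two_lt
    rw [Finset.card_eq_three.2 ⟨w, x, x', hx.ne, hx'.ne, hne, rfl⟩] at this
    omega
  rcases lt_trichotomy x x' with hxx | rfl | hxx
  · have hc : (⟨n, G⟩ : OrderedGraph).Contains (pattern 5 [(0, 2), (0, 3), (1, 2), (1, 4)]) := by
      refine contains_pattern ![u, u', w, x, x'] ?_ ?_
      · rw [Fin.strictMono_iff_lt_succ]
        intro i
        fin_cases i <;> assumption
      · intro i j hij hE
        fin_cases i <;> fin_cases j <;> first | assumption | simp at hE
    exact key hxx.ne (eq_of_mk_eq_pattern (h.minimal.eq_of_contains superlinear_fork' hc))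
  · have hc : (⟨n, G⟩ : OrderedGraph).Contains (pattern 4 [(0, 2), (0, 3), (1, 2), (1, 3)]) := by
      refine contains_pattern ![u, u', w, x] ?_ ?_
      · rw [Fin.strictMono_iff_lt_succ]
        intro i
        fin_cases i <;> assumption
      · intro i j hij hE
        fin_cases i <;> fin_cases j <;> first | assumption | simp at hE
    have hn := eq_of_mk_eq_pattern (h.minimal.eq_of_contains superlinear_four_cycle hc)
    have := h.lt_of_notMem_of_notMem hx.ne hw hxU
    omega
  · have hc : (⟨n, G⟩ : OrderedGraph).Contains (pattern 5 [(0, 2), (0, 4), (1, 2), (1, 3)]) := by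
      refine contains_pattern ![u, u', w, x', x] ?_ ?_
      · rw [Fin.strictMono_iff_lt_succ]
        intro i
        fin_cases i <;> assumption
      · intro i j hij hE
        fin_cases i <;> fin_cases j <;> first | assumption | simp at hE
    exact key hxx.ne' (eq_of_mk_eq_pattern (h.minimal.eq_of_contains superlinear_fork hc))

lemma IsMinimalWithPart.not_fork_left (h : IsMinimalWithPart G U) {w u u' x x' : Fin n}
    (hw : w ∉ U) (huu : u ≠ u') (hu : w < u) (hu' : w < u') (e1 : G.Adj u w) (e2 : G.Adj u' w)
    (hx : x < w) (hx' : x' < w) (e3 : G.Adj u x) (e4 : G.Adj u' x') : False := by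
  refine h.reverse.not_fork (w := w.rev) (u := u.rev) (u' := u'.rev) (x := x.rev) (x' := x'.rev)
    ?_ ?_ (Fin.rev_lt_rev.2 hu) (Fin.rev_lt_rev.2 hu') ?_ ?_ (Fin.rev_lt_rev.2 hx)
    (Fin.rev_lt_rev.2 hx') ?_ ?_
  · rw [mem_map_revPerm, Fin.rev_rev]
    exact hw
  · exact fun h => huu (Fin.rev_injective h)
  all_goals simpa

/-! ### The sizes of the two sides -/

/-- Each vertex behind the gap chooses a neighbour `σ` before it, and the resulting sequence is
treated as a Davenport-Schinzel sequence over `t` letters: it has at most `2 * t - 2` changes, and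
no three equal consecutive terms. -/
theorem MinimallyNonlinear.sub_le_of_crossing {t : ℕ}
    (hG : (⟨n, G⟩ : OrderedGraph).MinimallyNonlinear) (ht : Crossing G t) (htn : t ≤ n) :
    n - t ≤ 4 * t - 2 := by
  classical
  have hadj := hG.exists_adj ht
  rcases htn.eq_or_lt with rfl | htn
  · simp
  have hcol : ∀ w : Fin n, t ≤ w.val → ∀ u, G.Adj w u → u < w ∧ u.val < t := by
    intro w hw u hu
    rcases lt_or_gt_of_ne hu.ne with h | h
    · have := (ht w u hu h).1
      omega
    · exact ⟨h, (ht u w hu.symm h).1⟩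
  -- The previous choice is repeated only if there is no other neighbour, so a repetition marks a
  -- leaf.
  have step : ∀ w prev : Fin n, ∃ u, G.Adj w u ∧ (u = prev → ∀ u', G.Adj w u' → u' = u) := by
    intro w prev
    by_cases h : ∃ u, G.Adj w u ∧ u ≠ prev
    · obtain ⟨u, hu, hne⟩ := h
      exact ⟨u, hu, fun h => absurd h hne⟩
    · push Not at h
      obtain ⟨u, hu⟩ := hadj w
      exact ⟨u, hu, fun _ u' hu' => (h u' hu').trans (h u hu).symm⟩
  choose next hnext1 hnext2 using step
  -- The recursion runs through all vertices from `0` on; the initial value and the values beyond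
  -- `n` play no role.
  let s : ℕ → Fin n := fun j => Nat.rec (motive := fun _ => Fin n) ⟨0, by omega⟩
    (fun j prev => if h : j < n then next ⟨j, h⟩ prev else prev) j
  have hs : ∀ (j : ℕ) (h : j < n), s (j + 1) = next ⟨j, h⟩ (s j) := fun j h => by
    simp only [s, h, dif_pos]
  let σ : ℕ → Fin n := fun j => s (j + 1)
  have hσ : ∀ (j : ℕ) (h : j < n), G.Adj ⟨j, h⟩ (σ j) := fun j h => by
    simp only [σ, hs j h]
    exact hnext1 _ _
  have hleaf : ∀ (j : ℕ) (h : j + 1 < n), σ (j + 1) = σ j →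
      ∀ u, G.Adj ⟨j + 1, h⟩ u → u = σ j := by
    intro j h heq u hu
    rw [← heq]
    simp only [σ] at heq ⊢
    rw [hs (j + 1) h] at heq ⊢
    exact hnext2 _ _ heq u hu
  have hσt : ∀ j, t ≤ j → j < n → (σ j).val < t := fun j h1 h2 => (hcol ⟨j, h2⟩ h1 _ (hσ j h2)).2
  have ht0 : 0 < t := by
    have := hσt t le_rfl htn
    omega
  by_cases halt : ∃ (i j l : ℕ), t ≤ i ∧ i < j ∧ j + 1 < l ∧ l < n ∧ σ i = σ (j + 1) ∧ σ j = σ l ∧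
      σ j ≠ σ (j + 1)
  · obtain ⟨i, j, l, h1, h2, h3, h4, e1, e2, hne⟩ := halt
    have a1 := hσ i (by omega)
    have a2 := hσ j (by omega)
    have a3 := hσ (j + 1) (by omega)
    have a4 := hσ l h4
    rw [e1] at a1
    rw [← e2] at a4
    have b1 := hσt j (by omega) (by omega)
    have b2 := hσt (j + 1) (by omega) (by omega)
    have hn := (hG.of_alternation hne.symm (c₁ := ⟨i, by omega⟩) (c₂ := ⟨j, by omega⟩)
      (c₃ := ⟨j + 1, by omega⟩) (c₄ := ⟨l, h4⟩) (by rw [Fin.lt_def]; simp only; omega)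
      (by rw [Fin.lt_def]; simp only; omega) (by rw [Fin.mk_lt_mk]; omega)
      (by rw [Fin.mk_lt_mk]; omega) (by rw [Fin.mk_lt_mk]; omega)
      a1.symm a2.symm a3.symm a4.symm).1
    have : (σ j).val ≠ (σ (j + 1)).val := fun h => hne (Fin.ext h)
    omega
  push Not at halt
  let D := (Finset.Ico t (n - 1)).filter fun j => σ j ≠ σ (j + 1)
  let E := (Finset.Ico t (n - 1)).filter fun j => σ j = σ (j + 1)
  have hDE : D.card + E.card = n - 1 - t := by
    rw [add_comm, ← Nat.card_Ico t (n - 1)]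
    exact Finset.card_filter_add_card_filter_not (s := Finset.Ico t (n - 1))
      (fun j => σ j = σ (j + 1))
  -- A repetition is followed by a change or by the end: two repetitions in a row would put a leaf
  -- between two neighbours of the same vertex.
  have hE : E.card ≤ D.card + 1 := by
    refine le_trans ?_ (Finset.card_insert_le (n - 1) D)
    refine Finset.card_le_card_of_injOn (fun j => j + 1) ?_ (fun a _ b _ h => by simpa using h)
    intro j hj
    obtain ⟨hj, hjeq⟩ := Finset.mem_filter.1 hj
    rw [Finset.mem_Ico] at hj
    change j + 1 ∈ insert (n - 1) D
    rw [Finset.mem_insert]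
    by_cases hlast : j + 1 = n - 1
    · exact Or.inl hlast
    refine Or.inr (Finset.mem_filter.2 ⟨Finset.mem_Ico.2 ⟨by omega, by omega⟩, fun heq => ?_⟩)
    have a1 := hσ j (by omega)
    have a3 := hσ (j + 2) (by omega)
    rw [show σ (j + 2) = σ j from (hjeq.trans heq).symm] at a3
    refine hG.not_leaf_between (u := σ j) (x := ⟨j, by omega⟩) (v := ⟨j + 1, by omega⟩)
      (y := ⟨j + 2, by omega⟩) ?_ rfl rfl a1.symm a3.symm (hleaf j (by omega) hjeq.symm)
    have := hσt j (by omega) (by omega)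
    rw [Fin.lt_def]
    simp only
    omega
  let L : Finset (Fin n) := Finset.univ.filter fun v => v.val < t
  have hL : L.card = t := by
    simp only [L]
    rw [Fin.card_filter_val_lt]
    omega
  have hLmem : ∀ j, t ≤ j → j < n → σ j ∈ L := fun j h1 h2 =>
    Finset.mem_filter.2 ⟨Finset.mem_univ _, hσt j h1 h2⟩
  -- Without alternations, a change leaves a letter for the last time or reaches one for the first
  -- time. The letter at the end of the sequence is never left for the last time, and the one at its
  -- start is not reached for the first time by a change, whence `t - 1` in both cases.
  let D₁ := D.filter fun j => ∀ l, j < l → l < n → σ l ≠ σ j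
  let D₂ := D.filter fun j => ∀ i, t ≤ i → i ≤ j → σ i ≠ σ (j + 1)
  have hD : D ⊆ D₁ ∪ D₂ := by
    intro j hj
    have hj' := Finset.mem_filter.1 hj
    rw [Finset.mem_Ico] at hj'
    by_contra hcon
    have hcon1 : ¬ ∀ l, j < l → l < n → σ l ≠ σ j := fun h =>
      hcon (Finset.mem_union_left _ (Finset.mem_filter.2 ⟨hj, h⟩))
    have hcon2 : ¬ ∀ i, t ≤ i → i ≤ j → σ i ≠ σ (j + 1) := fun h =>
      hcon (Finset.mem_union_right _ (Finset.mem_filter.2 ⟨hj, h⟩))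
    push Not at hcon1 hcon2
    obtain ⟨l, h1, h2, h3⟩ := hcon1
    obtain ⟨i, h4, h5, h6⟩ := hcon2
    have hij : i ≠ j := fun h => hj'.2 (by rw [← h, h6, h])
    have hjl : l ≠ j + 1 := fun h => hj'.2 (by rw [← h3, h])
    exact hj'.2 (halt i j l h4 (by omega) (by omega) h2 h6 h3.symm)
  have hD₁ : D₁.card ≤ t - 1 := by
    rw [← hL, ← Finset.card_erase_of_mem (hLmem (n - 1) (by omega) (by omega))]
    refine Finset.card_le_card_of_injOn σ ?_ ?_
    · intro j hj
      obtain ⟨hj, hlast⟩ := Finset.mem_filter.1 hj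
      have hj := Finset.mem_Ico.1 (Finset.mem_filter.1 hj).1
      exact Finset.mem_erase.2 ⟨(hlast _ hj.2 (by omega)).symm, hLmem j hj.1 (by omega)⟩
    · intro i hi j hj hij
      obtain ⟨hi, hi'⟩ := Finset.mem_filter.1 hi
      obtain ⟨hj, hj'⟩ := Finset.mem_filter.1 hj
      have hi := Finset.mem_Ico.1 (Finset.mem_filter.1 hi).1
      have hj := Finset.mem_Ico.1 (Finset.mem_filter.1 hj).1
      rcases lt_trichotomy i j with h | h | h
      · exact absurd hij.symm (hi' j h (by omega))
      · exact h
      · exact absurd hij (hj' i h (by omega))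
  have hD₂ : D₂.card ≤ t - 1 := by
    rw [← hL, ← Finset.card_erase_of_mem (hLmem t le_rfl htn)]
    refine Finset.card_le_card_of_injOn (fun j => σ (j + 1)) ?_ ?_
    · intro j hj
      obtain ⟨hj, hfirst⟩ := Finset.mem_filter.1 hj
      have hj := Finset.mem_Ico.1 (Finset.mem_filter.1 hj).1
      exact Finset.mem_erase.2 ⟨(hfirst _ le_rfl hj.1).symm, hLmem _ (by omega) (by omega)⟩
    · intro i hi j hj hij
      obtain ⟨hi, hi'⟩ := Finset.mem_filter.1 hi
      obtain ⟨hj, hj'⟩ := Finset.mem_filter.1 hj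
      have hi := Finset.mem_Ico.1 (Finset.mem_filter.1 hi).1
      have hj := Finset.mem_Ico.1 (Finset.mem_filter.1 hj).1
      simp only at hij
      rcases lt_trichotomy i j with h | h | h
      · exact absurd hij (hj' (i + 1) (by omega) (by omega))
      · exact h
      · exact absurd hij.symm (hi' (j + 1) (by omega) (by omega))
  have hcard := (Finset.card_le_card hD).trans (Finset.card_union_le _ _)
  omega

lemma Crossing.reverse {t : ℕ} (h : Crossing G t) (htn : t ≤ n) :
    Crossing (G.comap Fin.rev) (n - t) := by
  intro a b hab hlt
  have := h _ _ hab.symm (Fin.rev_lt_rev.2 hlt)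
  rw [Fin.val_rev, Fin.val_rev] at this
  omega

theorem MinimallyNonlinear.le_of_crossing {t : ℕ}
    (hG : (⟨n, G⟩ : OrderedGraph).MinimallyNonlinear) (ht : Crossing G t) (htn : t ≤ n) :
    t ≤ 4 * (n - t) - 2 := by
  have h1 := hG.reverse.sub_le_of_crossing (G := G.comap Fin.rev) (t := n - t) (ht.reverse htn)
    (Nat.sub_le n t)
  have h2 : n - (n - t) ≤ 4 * (n - t) - 2 := h1
  omega

lemma MinimallyNonlinear.not_leaf_between_right
    (hG : (⟨n, G⟩ : OrderedGraph).MinimallyNonlinear) {u x v y : Fin n} (hux : y < u)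
    (hxv : x.val + 1 = v.val) (hvy : v.val + 1 = y.val) (h1 : G.Adj u x) (h2 : G.Adj u y)
    (hleaf : ∀ w, G.Adj v w → w = u) : False := by
  refine hG.reverse.not_leaf_between (G := G.comap Fin.rev) (u := u.rev) (x := y.rev) (v := v.rev)
    (y := x.rev) (Fin.rev_lt_rev.2 hux) ?_ ?_ ?_ ?_ ?_
  · rw [Fin.val_rev, Fin.val_rev]
    omega
  · rw [Fin.val_rev, Fin.val_rev]
    omega
  · simpa using h2
  · simpa using h1
  · intro w hw
    have := hleaf w.rev (by simpa using hw)
    rw [← this, Fin.rev_rev]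

end OrderedGraph

namespace OrderedGraph

/-! ### Counting graphs encoded by two functions -/

lemma encard_biUnion_le {ι α : Type*} (s : Finset ι) (f : ι → Set α) :
    (⋃ i ∈ s, f i).encard ≤ ∑ i ∈ s, (f i).encard := by
  classical
  induction s using Finset.induction_on with
  | empty => simp
  | insert a s ha ih =>
    rw [Finset.set_biUnion_insert, Finset.sum_insert ha]
    exact (Set.encard_union_le _ _).trans (by gcongr)

lemma encard_biUnion_le_mul {ι α : Type*} {s : Set ι} {f : ι → Set α} {a b : ℕ}
    (hs : s.encard ≤ a) (hf : ∀ i ∈ s, (f i).encard ≤ b) : (⋃ i ∈ s, f i).encard ≤ (a * b : ℕ) := by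
  have hfin : s.Finite := Set.finite_of_encard_le_coe hs
  rw [hfin.encard_eq_coe_toFinset_card, Nat.cast_le] at hs
  have h := encard_biUnion_le hfin.toFinset f
  simp only [Set.Finite.mem_toFinset] at h
  refine h.trans ((Finset.sum_le_sum fun i hi => hf i (hfin.mem_toFinset.1 hi)).trans ?_)
  rw [Finset.sum_const, nsmul_eq_mul]
  exact_mod_cast Nat.mul_le_mul_right b hs

/-- The edges of `G` are given by a map `F` from `U` to its complement, which takes the value `w₀`,
and by at most one further edge at each vertex outside `U`, with none at the elements of `Z`. -/
structure IsCoded {V : Type*} (G : SimpleGraph V) (U Z : Finset V) (w₀ : V) : Prop where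
  bipartite : ∀ a b, G.Adj a b → (a ∈ U ↔ b ∉ U)
  exists_adj : ∀ v, ∃ w, G.Adj v w
  exists_map : ∃ F : V → V, (∀ u, G.Adj u (F u)) ∧ (∃ u ∈ U, F u = w₀) ∧
    (∀ w ∈ Z, ∀ u, G.Adj u w → F u = w) ∧
    ∀ w ∉ U, ∀ u u', G.Adj u w → G.Adj u' w → F u ≠ w → F u' ≠ w → u = u'

lemma card_maps_hitting {A B : Type*} [Fintype A] [Fintype B] [DecidableEq A] [DecidableEq B]
    (b₀ : B) : Fintype.card {f : A → B // ∃ a, f a = b₀} =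
      Fintype.card B ^ Fintype.card A - (Fintype.card B - 1) ^ Fintype.card A := by
  have h := Fintype.card_subtype_compl fun f : A → B => ∀ a, f a ≠ b₀
  have h2 : Fintype.card {f : A → B // ∀ a, f a ≠ b₀} =
      (Fintype.card B - 1) ^ Fintype.card A := by
    rw [Fintype.card_congr (Equiv.subtypePiEquivPi (p := fun _ b => b ≠ b₀)), Fintype.card_fun]
    simp [Fintype.card_subtype_compl]
  rw [h2, Fintype.card_fun] at h
  rw [← h]
  exact Fintype.card_congr (Equiv.subtypeEquivRight fun f => by simp)

/-- The factor with the difference of powers counts maps from `U` to its complement that take the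
value `w₀`; the other one counts the choices of a second neighbour outside `U ∪ Z`. -/
theorem encard_isCoded_le {V : Type*} [Fintype V] [DecidableEq V] {U Z : Finset V} {w₀ : V}
    {k i z : ℕ} (hk : U.card = k) (hi : Fintype.card V = k + i) (hw₀ : w₀ ∉ U)
    (hZ : ∀ v ∈ Z, v ∉ U) (hz : Z.card = z) :
    {G : SimpleGraph V | IsCoded G U Z w₀}.encard ≤
      ((i ^ k - (i - 1) ^ k) * k ^ (i - z) : ℕ) := by
  classical
  let W := {v : V // v ∉ U}
  let A := {f : U → W // ∃ u, f u = ⟨w₀, hw₀⟩}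
  let B := {v : V // v ∉ U ∪ Z} → U
  have hW : Fintype.card W = i := by
    simp only [W]
    rw [Fintype.card_subtype_compl, hi]
    simp [hk]
  have hUZ : Fintype.card {v : V // v ∉ U ∪ Z} = i - z := by
    rw [Fintype.card_subtype_compl, hi, Fintype.card_coe, Finset.card_union_of_disjoint, hk, hz]
    · omega
    · exact Finset.disjoint_left.2 fun v hv hv' => hZ v hv' hv
  have hAB : Fintype.card (A × B) = (i ^ k - (i - 1) ^ k) * k ^ (i - z) := by
    simp only [A, B]
    rw [Fintype.card_prod, card_maps_hitting, Fintype.card_fun, hW, hUZ, Fintype.card_coe, hk]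
  let dec : A × B → SimpleGraph V := fun p => SimpleGraph.fromRel fun a b =>
    ∃ (ha : a ∈ U) (hb : b ∉ U), p.1.1 ⟨a, ha⟩ = ⟨b, hb⟩ ∨
      ∃ hz : b ∉ U ∪ Z, p.2 ⟨b, hz⟩ = ⟨a, ha⟩
  have hsub : {G : SimpleGraph V | IsCoded G U Z w₀} ⊆ dec '' Set.univ := by
    rintro G ⟨hbip, hadj, F, hF, ⟨u₀, hu₀, hFu₀⟩, hFZ, huniq⟩
    have hFW : ∀ u ∈ U, F u ∉ U := fun u hu => (hbip _ _ (hF u)).1 hu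
    have hg : ∀ w : {v : V // v ∉ U ∪ Z}, ∃ u : U, G.Adj u w ∧
        ∀ u', G.Adj u' w → F u' ≠ w → u' = u := by
      rintro ⟨w, hw⟩
      -- If `w` has no further edge, an arbitrary neighbour serves as its value, since decoding then
      -- adds only an edge that is already present.
      rw [Finset.mem_union, not_or] at hw
      have hU : ∀ u, G.Adj u w → u ∈ U := fun u hu => (hbip _ _ hu).2 hw.1
      by_cases h : ∃ u, G.Adj u w ∧ F u ≠ w
      · obtain ⟨u, hu, hne⟩ := h
        exact ⟨⟨u, hU u hu⟩, hu, fun u' hu' hne' => huniq w hw.1 u' u hu' hu hne' hne⟩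
      · push Not at h
        obtain ⟨u, hu⟩ := hadj w
        exact ⟨⟨u, hU u hu.symm⟩, hu.symm, fun u' hu' hne' => absurd (h u' hu') hne'⟩
    choose g hg1 hg2 using hg
    refine ⟨(⟨fun u => ⟨F u, hFW u u.2⟩, ⟨u₀, hu₀⟩, Subtype.ext hFu₀⟩, g), trivial, ?_⟩
    have key : ∀ a b, (∃ (ha : a ∈ U) (hb : b ∉ U), (⟨F a, hFW a ha⟩ : W) = ⟨b, hb⟩ ∨
        ∃ hz : b ∉ U ∪ Z, g ⟨b, hz⟩ = ⟨a, ha⟩) ↔ G.Adj a b ∧ a ∈ U := by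
      intro a b
      constructor
      · rintro ⟨ha, hb, h | ⟨hz, h⟩⟩
        · rw [← (Subtype.mk.injEq .. ▸ h : F a = b)]
          exact ⟨hF a, ha⟩
        · have := hg1 ⟨b, hz⟩
          rw [h] at this
          exact ⟨this, ha⟩
      · rintro ⟨h, ha⟩
        have hb : b ∉ U := (hbip _ _ h).1 ha
        refine ⟨ha, hb, ?_⟩
        by_cases hFa : F a = b
        · exact Or.inl (Subtype.ext hFa)
        · have hbZ : b ∉ Z := fun hb => hFa (hFZ b hb a h)
          have hz : b ∉ U ∪ Z := by simp [hb, hbZ]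
          exact Or.inr ⟨hz, Subtype.ext (hg2 ⟨b, hz⟩ a h hFa).symm⟩
    ext a b
    simp only [dec, SimpleGraph.fromRel_adj]
    rw [key, key]
    constructor
    · rintro ⟨-, h | h⟩
      · exact h.1
      · exact h.1.symm
    · intro h
      refine ⟨h.ne, ?_⟩
      by_cases ha : a ∈ U
      · exact Or.inl ⟨h, ha⟩
      · exact Or.inr ⟨h.symm, (hbip _ _ h.symm).2 ha⟩
  refine (Set.encard_le_encard hsub).trans ((Set.encard_image_le _ _).trans ?_)
  rw [Set.encard_univ, ENat.card_eq_coe_fintype_card, hAB]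

end OrderedGraph

namespace OrderedGraph

/-! ### The core of a minimally non-linear graph -/

section

variable {n : ℕ} {G : SimpleGraph (Fin n)} {U : Finset (Fin n)}

lemma Crossing.lt_iff {t : ℕ} (ht : Crossing G t) {a b : Fin n} (h : G.Adj a b) :
    a.val < t ↔ t ≤ b.val := by
  rcases lt_or_gt_of_ne h.ne with hab | hab
  · have := ht a b h hab
    omega
  · have := ht b a h.symm hab
    omega

lemma Crossing.lt_of_adj {t : ℕ} (ht : Crossing G t) {a b : Fin n} (h : G.Adj a b)
    (ha : a.val < t) : a < b := by
  have := (ht.lt_iff h).1 ha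
  rw [Fin.lt_def]
  omega

lemma Crossing.lt_of_adj_of_lt {t : ℕ} (ht : Crossing G t) {u x y : Fin n} (h : G.Adj u x)
    (hux : u < x) (h' : G.Adj u y) : u < y :=
  ht.lt_of_adj h' (ht u x h hux).1

lemma Crossing.gt_of_adj_of_gt {t : ℕ} (ht : Crossing G t) {u x y : Fin n} (h : G.Adj u x)
    (hux : x < u) (h' : G.Adj u y) : y < u := by
  refine lt_of_le_of_ne (not_lt.1 fun hlt => ?_) h'.ne'
  exact absurd (ht.lt_of_adj_of_lt h' hlt h) (lt_asymm hux)

lemma exists_max_adj {u w : Fin n} (h : G.Adj u w) :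
    ∃ y, G.Adj u y ∧ w ≤ y ∧ ∀ x, G.Adj u x → x ≤ y := by
  classical
  obtain ⟨y, hy, hmax⟩ := (Finset.univ.filter (G.Adj u)).exists_max_image id ⟨w, by simpa using h⟩
  simp only [Finset.mem_filter, Finset.mem_univ, true_and, id] at hy hmax
  exact ⟨y, hy, hmax w h, hmax⟩

lemma exists_min_adj {u w : Fin n} (h : G.Adj u w) :
    ∃ y, G.Adj u y ∧ y ≤ w ∧ ∀ x, G.Adj u x → y ≤ x := by
  classical
  obtain ⟨y, hy, hmin⟩ := (Finset.univ.filter (G.Adj u)).exists_min_image id ⟨w, by simpa using h⟩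
  simp only [Finset.mem_filter, Finset.mem_univ, true_and, id] at hy hmin
  exact ⟨y, hy, hmin w h, hmin⟩

/-- `F` sends each vertex to its farthest neighbour. -/
lemma Crossing.exists_farthest {t : ℕ} (ht : Crossing G t) (hadj : ∀ v, ∃ w, G.Adj v w) :
    ∃ F : Fin n → Fin n, (∀ u, G.Adj u (F u)) ∧
      ∀ u x, G.Adj u x → (u < x → x ≤ F u) ∧ (x < u → F u ≤ x) := by
  have h : ∀ u, ∃ y, G.Adj u y ∧ ∀ x, G.Adj u x → (u < x → x ≤ y) ∧ (x < u → y ≤ x) := by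
    intro u
    obtain ⟨w, hw⟩ := hadj u
    rcases lt_or_gt_of_ne hw.ne with huw | huw
    · obtain ⟨y, hy, -, hmax⟩ := exists_max_adj hw
      exact ⟨y, hy, fun x hx => ⟨fun _ => hmax x hx, fun h =>
        absurd (ht.lt_of_adj_of_lt hw huw hx) (lt_asymm h)⟩⟩
    · obtain ⟨y, hy, -, hmin⟩ := exists_min_adj hw
      exact ⟨y, hy, fun x hx => ⟨fun h => absurd (ht.gt_of_adj_of_gt hw huw hx) (lt_asymm h),
        fun _ => hmin x hx⟩⟩
  choose F hF using h
  exact ⟨F, fun u => (hF u).1, fun u => (hF u).2⟩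

/-- The vertices of `U`, and the first and the last neighbours of each vertex of `U`. -/
def IsCore (G : SimpleGraph (Fin n)) (U : Finset (Fin n)) (v : Fin n) : Prop :=
  v ∈ U ∨ ∃ u ∈ U, G.Adj u v ∧ ((∀ x, G.Adj u x → x ≤ v) ∨ ∀ x, G.Adj u x → v ≤ x)

lemma exists_lt_lt_of_not_isCore {u w : Fin n} (hw : ¬ IsCore G U w) (hu : u ∈ U)
    (h : G.Adj u w) : ∃ x y, G.Adj u x ∧ G.Adj u y ∧ x < w ∧ w < y ∧ IsCore G U x ∧
      IsCore G U y ∧ ∀ z, G.Adj u z → x ≤ z ∧ z ≤ y := by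
  obtain ⟨x, hx, hxw, hmin⟩ := exists_min_adj h
  obtain ⟨y, hy, hyw, hmax⟩ := exists_max_adj h
  have cx : IsCore G U x := Or.inr ⟨u, hu, hx, Or.inr hmin⟩
  have cy : IsCore G U y := Or.inr ⟨u, hu, hy, Or.inl hmax⟩
  exact ⟨x, y, hx, hy, lt_of_le_of_ne hxw fun h => hw (h ▸ cx),
    lt_of_le_of_ne hyw fun h => hw (h ▸ cy), cx, cy, fun z hz => ⟨hmin z hz, hmax z hz⟩⟩

/-- A vertex `w` whose neighbour `u` has neighbours on both sides of `w` is adjacent to the open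
vertex whose first neighbour is last. -/
lemma IsMinimalWithPart.lt_of_open (h : IsMinimalWithPart G U) {w u u' x x' y y' : Fin n}
    (hw : w ∉ U) (huu : u ≠ u') (huw : u < w) (e : G.Adj u w) (ex : G.Adj u x) (hx : x < w)
    (ey : G.Adj u y) (hy : w < y) (ex' : G.Adj u' x') (hx' : x' < w) (ey' : G.Adj u' y')
    (hy' : w < y') : x' < x := by
  obtain ⟨t, -, ht⟩ := h.exists_crossing
  have hut : u.val < t := (ht u w e huw).1
  have hwt : t ≤ w.val := (ht u w e huw).2
  have hu't : u'.val < t := by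
    rw [ht.lt_iff ey']
    have : w.val < y'.val := hy'
    omega
  by_contra hcon
  -- A common first neighbour would be the middle of a fork. If `x` came before `x'`, then `x`,
  -- `x'`, `w`, `y'` would alternate, although `u` has the three neighbours `x`, `w`, `y`.
  rcases (not_lt.1 hcon).eq_or_lt with heq | hlt
  · subst heq
    exact h.not_fork ((h.bipartite _ _ ex).1 ((h.bipartite _ _ e).2 hw)) huu
      (ht.lt_of_adj ex hut) (ht.lt_of_adj ex' hu't) ex ex' hx (hx.trans hy') e ey'
  · have hu'x : u' < x := by
      have := (ht.lt_iff ex).1 hut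
      rw [Fin.lt_def]
      omega
    exact (h.minimal.of_alternation huu (ht.lt_of_adj ex hut) hu'x hlt hx' hy' ex ex' e ey').2
      u x w y hx hy ex e ey

lemma IsMinimalWithPart.lt_of_open_left (h : IsMinimalWithPart G U) {w u u' x x' y y' : Fin n}
    (hw : w ∉ U) (huu : u ≠ u') (huw : w < u) (e : G.Adj u w) (ex : G.Adj u x) (hx : x < w)
    (ey : G.Adj u y) (hy : w < y) (ex' : G.Adj u' x') (hx' : x' < w) (ey' : G.Adj u' y')
    (hy' : w < y') : y < y' := by
  have := h.reverse.lt_of_open (w := w.rev) (u := u.rev) (u' := u'.rev) (x := y.rev)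
    (x' := y'.rev) (y := x.rev) (y' := x'.rev) (by rwa [mem_map_revPerm, Fin.rev_rev])
    (fun h => huu (Fin.rev_injective h)) (Fin.rev_lt_rev.2 huw) (by simpa) (by simpa)
    (Fin.rev_lt_rev.2 hy) (by simpa) (Fin.rev_lt_rev.2 hx) (by simpa) (Fin.rev_lt_rev.2 hy')
    (by simpa) (Fin.rev_lt_rev.2 hx')
  exact Fin.rev_lt_rev.1 this

/-- A vertex outside the core has only one neighbour. -/
lemma IsMinimalWithPart.eq_of_not_isCore (h : IsMinimalWithPart G U) {w u u' : Fin n}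
    (hw : ¬ IsCore G U w) (e : G.Adj u w) (e' : G.Adj u' w) : u = u' := by
  by_contra hne
  obtain ⟨t, -, ht⟩ := h.exists_crossing
  have hwU : w ∉ U := fun h => hw (Or.inl h)
  obtain ⟨x, y, ex, ey, hx, hy, -⟩ :=
    exists_lt_lt_of_not_isCore hw ((h.bipartite _ _ e).2 hwU) e
  obtain ⟨x', y', ex', ey', hx', hy', -⟩ :=
    exists_lt_lt_of_not_isCore hw ((h.bipartite _ _ e').2 hwU) e'
  rcases lt_or_gt_of_ne e.ne with hlt | hlt
  · exact h.not_fork hwU hne hlt (ht.gt_of_adj_of_gt e.symm hlt e'.symm) e e' hy hy' ey ey'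
  · exact h.not_fork_left hwU hne hlt (ht.lt_of_adj_of_lt e.symm hlt e'.symm) e e' hx hx' ex ex'

/-- If `w` had different neighbours `u` and `u'` in the two graphs, both would be open at `w` in
both graphs, because this only concerns core edges. The extremality of the neighbour of `w` among
the open vertices would order their extreme neighbours in opposite ways. -/
lemma IsMinimalWithPart.adj_of_core {G' : SimpleGraph (Fin n)} (h : IsMinimalWithPart G U)
    (h' : IsMinimalWithPart G' U) (hcore : ∀ v, IsCore G U v ↔ IsCore G' U v)
    (hadj : ∀ a b, IsCore G U a → IsCore G U b → (G.Adj a b ↔ G'.Adj a b)) {u w : Fin n}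
    (hu : u ∈ U) (e : G.Adj u w) : G'.Adj u w := by
  by_cases hw : IsCore G U w
  · exact (hadj u w (Or.inl hu) hw).1 e
  have hw' : ¬ IsCore G' U w := fun h => hw ((hcore w).2 h)
  have hwU : w ∉ U := fun h => hw (Or.inl h)
  obtain ⟨u', e'⟩ := h'.exists_adj w
  replace e' := e'.symm
  have hu' : u' ∈ U := (h'.bipartite _ _ e').2 hwU
  suffices heq : u = u' by rwa [heq]
  by_contra hne
  obtain ⟨x, y, ex, ey, hx, hy, cx, cy, -⟩ := exists_lt_lt_of_not_isCore hw hu e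
  obtain ⟨x', y', ex', ey', hx', hy', cx', cy', -⟩ := exists_lt_lt_of_not_isCore hw' hu' e'
  rw [← hcore] at cx' cy'
  have fx := (hadj u x (Or.inl hu) cx).1 ex
  have fy := (hadj u y (Or.inl hu) cy).1 ey
  have fx' := (hadj u' x' (Or.inl hu') cx').2 ex'
  have fy' := (hadj u' y' (Or.inl hu') cy').2 ey'
  obtain ⟨t, -, ht⟩ := h.exists_crossing
  rcases lt_or_gt_of_ne e.ne with hlt | hlt
  · have hlt' : u' < w := by
      have h1 := ht u w e hlt
      have h2 := (ht.lt_iff fy').2 (by have : w.val < y'.val := hy'; omega)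
      rw [Fin.lt_def]
      omega
    exact lt_asymm (h.lt_of_open hwU hne hlt e ex hx ey hy fx' hx' fy' hy')
      (h'.lt_of_open hwU (Ne.symm hne) hlt' e' ex' hx' ey' hy' fx hx fy hy)
  · have hlt' : w < u' := by
      have h1 := ht w u e.symm hlt
      have h2 := (ht.lt_iff fx').not.2 (by have : x'.val < w.val := hx'; omega)
      rw [Fin.lt_def]
      omega
    exact lt_asymm (h.lt_of_open_left hwU hne hlt e ex hx ey hy fx' hx' fy' hy')
      (h'.lt_of_open_left hwU (Ne.symm hne) hlt' e' ex' hx' ey' hy' fx hx fy hy)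

/-- A graph is determined by its core and the position of the core. -/
theorem IsMinimalWithPart.eq_of_core {G' : SimpleGraph (Fin n)} (h : IsMinimalWithPart G U)
    (h' : IsMinimalWithPart G' U) (hcore : ∀ v, IsCore G U v ↔ IsCore G' U v)
    (hadj : ∀ a b, IsCore G U a → IsCore G U b → (G.Adj a b ↔ G'.Adj a b)) : G = G' := by
  have hle : ∀ a b, G.Adj a b → G'.Adj a b := by
    intro a b e
    by_cases ha : a ∈ U
    · exact h.adj_of_core h' hcore hadj ha e
    · exact (h.adj_of_core h' hcore hadj ((h.bipartite _ _ e.symm).2 ha) e.symm).symm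
  have hge : ∀ a b, G'.Adj a b → G.Adj a b := by
    have hadj' : ∀ a b, IsCore G' U a → IsCore G' U b → (G'.Adj a b ↔ G.Adj a b) :=
      fun a b ha hb => (hadj a b ((hcore a).2 ha) ((hcore b).2 hb)).symm
    intro a b e
    by_cases ha : a ∈ U
    · exact h'.adj_of_core h (fun v => (hcore v).symm) hadj' ha e
    · exact (h'.adj_of_core h (fun v => (hcore v).symm) hadj'
        ((h'.bipartite _ _ e.symm).2 ha) e.symm).symm
  ext a b
  exact ⟨hle a b, hge a b⟩

/-- Consecutive vertices outside the core, on the same side, have the same neighbour. -/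
lemma IsMinimalWithPart.eq_of_consecutive (h : IsMinimalWithPart G U) {w w' u u' : Fin n}
    (hww : w.val + 1 = w'.val) (hw : ¬ IsCore G U w) (hw' : ¬ IsCore G U w') (e : G.Adj u w)
    (e' : G.Adj u' w') (hside : u < w ∧ u' < w' ∨ w < u ∧ w' < u') : u = u' := by
  by_contra hne
  have hwU : w ∉ U := fun h => hw (Or.inl h)
  have hwU' : w' ∉ U := fun h => hw' (Or.inl h)
  obtain ⟨x, y, ex, ey, hx, hy, -, cy, -⟩ :=
    exists_lt_lt_of_not_isCore hw ((h.bipartite _ _ e).2 hwU) e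
  obtain ⟨x', y', ex', ey', hx', hy', cx', -⟩ :=
    exists_lt_lt_of_not_isCore hw' ((h.bipartite _ _ e').2 hwU') e'
  -- The extreme neighbours belong to the core, so they differ from `w` and `w'`; hence `u` and `u'`
  -- are open at both vertices, and the two orderings contradict each other.
  have hyw : w' < y := by
    refine lt_of_le_of_ne ?_ fun h => hw' (h ▸ cy)
    rw [Fin.lt_def] at hy
    rw [Fin.le_def]
    omega
  have hxw : x' < w := by
    refine lt_of_le_of_ne ?_ fun h => hw (h ▸ cx')
    rw [Fin.lt_def] at hx'
    rw [Fin.le_def]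
    omega
  have hlt : w < w' := by
    rw [Fin.lt_def]
    omega
  rcases hside with ⟨h1, h2⟩ | ⟨h1, h2⟩
  · exact lt_asymm (h.lt_of_open hwU hne h1 e ex hx ey hy ex' hxw ey' (hlt.trans hy'))
      (h.lt_of_open hwU' (Ne.symm hne) h2 e' ex' hx' ey' hy' ex (hx.trans hlt) ey hyw)
  · exact lt_asymm (h.lt_of_open_left hwU hne h1 e ex hx ey hy ex' hxw ey' (hlt.trans hy'))
      (h.lt_of_open_left hwU' (Ne.symm hne) h2 e' ex' hx' ey' hy' ex (hx.trans hlt) ey hyw)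

/-- Of three consecutive vertices on the same side, one belongs to the core. -/
lemma IsMinimalWithPart.isCore_of_consecutive (h : IsMinimalWithPart G U) {t : ℕ}
    (ht : Crossing G t) {w₁ w₂ w₃ : Fin n} (h12 : w₁.val + 1 = w₂.val)
    (h23 : w₂.val + 1 = w₃.val) (hside : w₃.val < t ∨ t ≤ w₁.val) (h1 : ¬ IsCore G U w₁)
    (h2 : ¬ IsCore G U w₂) (h3 : ¬ IsCore G U w₃) : False := by
  obtain ⟨u₁, e1⟩ := h.exists_adj w₁
  obtain ⟨u₂, e2⟩ := h.exists_adj w₂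
  obtain ⟨u₃, e3⟩ := h.exists_adj w₃
  have s1 := ht.lt_iff e1
  have s2 := ht.lt_iff e2
  have s3 := ht.lt_iff e3
  have hs12 : u₁ < w₁ ∧ u₂ < w₂ ∨ w₁ < u₁ ∧ w₂ < u₂ := by
    simp only [Fin.lt_def]
    omega
  have hs23 : u₂ < w₂ ∧ u₃ < w₃ ∨ w₂ < u₂ ∧ w₃ < u₃ := by
    simp only [Fin.lt_def]
    omega
  obtain rfl := h.eq_of_consecutive h12 h1 h2 e1.symm e2.symm hs12
  obtain rfl := h.eq_of_consecutive h23 h2 h3 e2.symm e3.symm hs23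
  have hleaf : ∀ w, G.Adj w₂ w → w = u₁ := fun w hw => h.eq_of_not_isCore h2 hw.symm e2.symm
  rcases hs12 with hs | hs
  · exact h.minimal.not_leaf_between hs.1 h12 h23 e1.symm e3.symm hleaf
  · refine h.minimal.not_leaf_between_right (y := w₃) ?_ h12 h23 e1.symm e3.symm hleaf
    simp only [Fin.lt_def] at *
    omega

end

end OrderedGraph

/-! ### Encoding induced subgraphs by farthest neighbours -/

namespace OrderedGraph

section

variable {n m : ℕ} {G : SimpleGraph (Fin n)} {U : Finset (Fin n)} {G₀ : SimpleGraph (Fin m)}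
  {U₀ : Finset (Fin m)} {e : Fin m ↪o Fin n}

lemma exists_val_lt_iff (e : Fin m ↪o Fin n) (t : ℕ) :
    ∃ t₀ ≤ m, ∀ j : Fin m, j.val < t₀ ↔ (e j).val < t := by
  classical
  refine ⟨(Finset.univ.filter fun j => (e j).val < t).sup fun j => j.val + 1,
    Finset.sup_le fun j _ => j.isLt, fun j => ?_⟩
  rw [Finset.lt_sup_iff]
  constructor
  · rintro ⟨j', hj', hlt⟩
    have h1 := (Finset.mem_filter.1 hj').2
    have h2 : (e j).val ≤ (e j').val := e.monotone (show j.val ≤ j'.val by omega)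
    omega
  · intro h
    exact ⟨j, by simpa using h, Nat.lt_succ_self _⟩

lemma Crossing.exists_comap {t : ℕ} (ht : Crossing G t) (e : Fin m ↪o Fin n)
    (hadj : ∀ a b, G₀.Adj a b ↔ G.Adj (e a) (e b)) :
    ∃ t₀ ≤ m, Crossing G₀ t₀ ∧ ∀ j : Fin m, j.val < t₀ ↔ (e j).val < t := by
  obtain ⟨t₀, h0, h⟩ := exists_val_lt_iff e t
  refine ⟨t₀, h0, fun a b hab hlt => ?_, h⟩
  have := ht _ _ ((hadj a b).1 hab) (e.strictMono hlt)
  have h1 := h a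
  have h2 := h b
  omega

/-- The map is the farthest neighbour. Two neighbours of `w` that both reach beyond `w` are excluded
by `not_fork` or its mirror image, so `w` has at most one further edge. -/
theorem IsMinimalWithPart.isCoded_comap (h : IsMinimalWithPart G U) (e : Fin m ↪o Fin n)
    (hmem : ∀ j, j ∈ U₀ ↔ e j ∈ U) (hadj : ∀ a b, G₀.Adj a b ↔ G.Adj (e a) (e b))
    (hiso : ∀ v, ∃ w, G₀.Adj v w) {Z : Finset (Fin m)} {w₀ : Fin m} (hw₀ : w₀ ∈ Z)
    (hZU : ∀ w ∈ Z, w ∉ U₀) (hZ : ∀ w ∈ Z, ∀ u, G₀.Adj u w → ∀ x, G₀.Adj u x →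
      (u < x → x ≤ w) ∧ (x < u → w ≤ x)) : IsCoded G₀ U₀ Z w₀ := by
  obtain ⟨t, -, ht⟩ := h.exists_crossing
  obtain ⟨t₀, -, ht₀, -⟩ := ht.exists_comap e hadj
  obtain ⟨F, hF, hfar⟩ := ht₀.exists_farthest hiso
  have hbip : ∀ a b, G₀.Adj a b → (a ∈ U₀ ↔ b ∉ U₀) := fun a b hab => by
    rw [hmem, hmem]
    exact h.bipartite _ _ ((hadj a b).1 hab)
  have hFZ : ∀ w ∈ Z, ∀ u, G₀.Adj u w → F u = w := by
    intro w hw u hu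
    rcases lt_or_gt_of_ne hu.ne with hlt | hlt
    · exact le_antisymm ((hZ w hw u hu _ (hF u)).1 (ht₀.lt_of_adj_of_lt hu hlt (hF u)))
        ((hfar u w hu).1 hlt)
    · exact le_antisymm ((hfar u w hu).2 hlt)
        ((hZ w hw u hu _ (hF u)).2 (ht₀.gt_of_adj_of_gt hu hlt (hF u)))
  refine ⟨hbip, hiso, F, hF, ?_, hFZ, ?_⟩
  · obtain ⟨u, hu⟩ := hiso w₀
    exact ⟨u, (hbip _ _ hu.symm).2 (hZU _ hw₀), hFZ _ hw₀ u hu.symm⟩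
  · intro w hw u u' e1 e2 hu hu'
    by_contra hne
    have hne' : e u ≠ e u' := fun h => hne (e.injective h)
    have hw' : e w ∉ U := fun h => hw ((hmem w).2 h)
    rcases lt_or_gt_of_ne e1.ne with hlt | hlt
    · have hlt' : u' < w := ht₀.gt_of_adj_of_gt e1.symm hlt e2.symm
      exact h.not_fork hw' hne' (e.strictMono hlt) (e.strictMono hlt') ((hadj _ _).1 e1)
        ((hadj _ _).1 e2) (e.strictMono (lt_of_le_of_ne ((hfar u w e1).1 hlt) hu.symm))
        (e.strictMono (lt_of_le_of_ne ((hfar u' w e2).1 hlt') hu'.symm)) ((hadj _ _).1 (hF u))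
        ((hadj _ _).1 (hF u'))
    · have hlt' : w < u' := ht₀.lt_of_adj_of_lt e1.symm hlt e2.symm
      exact h.not_fork_left hw' hne' (e.strictMono hlt) (e.strictMono hlt') ((hadj _ _).1 e1)
        ((hadj _ _).1 e2) (e.strictMono (lt_of_le_of_ne ((hfar u w e1).2 hlt) hu))
        (e.strictMono (lt_of_le_of_ne ((hfar u' w e2).2 hlt') hu')) ((hadj _ _).1 (hF u))
        ((hadj _ _).1 (hF u'))

end

/-! ### Graphs whose part is one side of the crossing -/

/-- The last vertex is the farthest neighbour of all its neighbours, so it is hit by the first map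
and has no further edge. -/
theorem encard_part_eq_left_le (k i : ℕ) :
    {G : SimpleGraph (Fin (k + i)) | ∃ U t, IsMinimalWithPart G U ∧ Crossing G t ∧ U.card = k ∧
      ∀ v : Fin (k + i), v ∈ U ↔ v.val < t}.encard ≤
      ((i ^ k - (i - 1) ^ k) * k ^ (i - 1) : ℕ) := by
  rcases Nat.eq_zero_or_pos i with rfl | hi
  · refine le_of_eq_of_le (Set.encard_eq_zero.2 ?_) zero_le
    rw [Set.eq_empty_iff_forall_notMem]
    rintro G ⟨U, t, h, ht, hU, hUt⟩
    have hU' : U = Finset.univ := Finset.eq_univ_of_card _ (by simpa using hU)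
    have h2 := h.two_lt
    obtain ⟨w, hw⟩ := h.exists_adj ⟨0, by omega⟩
    have := h.bipartite _ _ hw
    simp [hU'] at this
  have hcard : (Finset.univ.filter fun v : Fin (k + i) => v.val < k).card = k := by
    rw [Fin.card_filter_val_lt]
    omega
  refine (Set.encard_le_encard ?_).trans (encard_isCoded_le
    (U := Finset.univ.filter fun v : Fin (k + i) => v.val < k) (Z := {⟨k + i - 1, by omega⟩})
    (w₀ := ⟨k + i - 1, by omega⟩) hcard (by simp) ?_ ?_ rfl)
  · rintro G ⟨U, t, h, ht, hU, hUt⟩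
    have hle := Finset.card_le_univ U
    have htk : t = k := by
      have hU' : U = Finset.univ.filter fun v : Fin (k + i) => v.val < t := by
        ext v
        simp [hUt]
      rw [hU', Fin.card_filter_val_lt] at hU
      have : ¬ k + i ≤ t := by omega
      omega
    subst htk
    have hmem : ∀ v : Fin (t + i), v ∈ (Finset.univ.filter fun v : Fin (t + i) => v.val < t) ↔
        v ∈ U := by simp [hUt]
    refine h.isCoded_comap (OrderIso.refl _).toOrderEmbedding hmem (fun _ _ => Iff.rfl)
      h.exists_adj (Finset.mem_singleton_self _) ?_ ?_
    · intro w hw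
      rw [Finset.mem_singleton] at hw
      subst hw
      simp only [Finset.mem_filter, Finset.mem_univ, true_and]
      omega
    · intro w hw u hu x hx
      rw [Finset.mem_singleton] at hw
      subst hw
      have h1 := ht.lt_iff hu
      have h2 := ht.lt_iff hx
      simp only [Fin.lt_def, Fin.le_def] at *
      omega
  · simp only [Finset.mem_filter, Finset.mem_univ, true_and]
    omega
  · intro w hw
    rw [Finset.mem_singleton] at hw
    subst hw
    simp only [Finset.mem_filter, Finset.mem_univ, true_and]
    omega

theorem encard_part_eq_right_le (k i : ℕ) :
    {G : SimpleGraph (Fin (k + i)) | ∃ U t, IsMinimalWithPart G U ∧ Crossing G t ∧ U.card = k ∧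
      ∀ v : Fin (k + i), v ∈ U ↔ t ≤ v.val}.encard ≤
      ((i ^ k - (i - 1) ^ k) * k ^ (i - 1) : ℕ) := by
  refine le_trans ?_ (encard_part_eq_left_le k i)
  have hinj : Function.Injective fun G : SimpleGraph (Fin (k + i)) => G.comap Fin.rev := by
    intro G G' h
    ext a b
    have := congrArg (fun H : SimpleGraph (Fin (k + i)) => H.Adj a.rev b.rev) h
    simpa using this
  refine (Set.encard_le_encard_of_injOn (f := fun G => G.comap Fin.rev) ?_ hinj.injOn)
  rintro G ⟨U, t, h, ht, hU, hUt⟩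
  have htn : t ≤ k + i := by
    obtain ⟨u, hu⟩ := Finset.card_pos.1 (by have := h.two_lt; omega : 0 < U.card)
    have := (hUt u).1 hu
    omega
  refine ⟨_, _, h.reverse, ht.reverse htn, by rw [Finset.card_map, hU], fun v => ?_⟩
  rw [mem_map_revPerm, hUt, Fin.val_rev]
  omega

end OrderedGraph

namespace OrderedGraph

/-! ### Graphs whose part meets both sides of the crossing -/

section

variable {n m : ℕ} {G : SimpleGraph (Fin n)} {U : Finset (Fin n)} {G₀ : SimpleGraph (Fin m)}
  {U₀ : Finset (Fin m)} {e : Fin m ↪o Fin n}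

/-- `e` identifies `G₀` with the subgraph of `G` on its core. -/
structure IsCoreOf (G₀ : SimpleGraph (Fin m)) (U₀ : Finset (Fin m)) (e : Fin m ↪o Fin n)
    (G : SimpleGraph (Fin n)) (U : Finset (Fin n)) : Prop where
  part : IsMinimalWithPart G U
  mem_range : ∀ v, IsCore G U v ↔ ∃ j, e j = v
  mem_iff : ∀ j, j ∈ U₀ ↔ e j ∈ U
  adj_iff : ∀ a b, G₀.Adj a b ↔ G.Adj (e a) (e b)

lemma IsCoreOf.eq {G' : SimpleGraph (Fin n)} {U' : Finset (Fin n)} (h : IsCoreOf G₀ U₀ e G U)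
    (h' : IsCoreOf G₀ U₀ e G' U') : G = G' := by
  have hcore : ∀ v, IsCore G U v ↔ IsCore G' U' v := fun v =>
    (h.mem_range v).trans (h'.mem_range v).symm
  have hU : U = U' := by
    ext v
    constructor
    · intro hv
      obtain ⟨j, rfl⟩ := (h.mem_range v).1 (Or.inl hv)
      rwa [← h'.mem_iff, h.mem_iff]
    · intro hv
      obtain ⟨j, rfl⟩ := (h'.mem_range v).1 (Or.inl hv)
      rwa [← h.mem_iff, h'.mem_iff]
  subst hU
  refine h.part.eq_of_core h'.part hcore fun a b ha hb => ?_
  obtain ⟨a, rfl⟩ := (h.mem_range a).1 ha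
  obtain ⟨b, rfl⟩ := (h.mem_range b).1 hb
  rw [← h.adj_iff, h'.adj_iff]

/-- Every graph has a core. -/
lemma IsMinimalWithPart.exists_isCoreOf (h : IsMinimalWithPart G U) :
    ∃ (m : ℕ) (G₀ : SimpleGraph (Fin m)) (U₀ : Finset (Fin m)) (e : Fin m ↪o Fin n),
      IsCoreOf G₀ U₀ e G U := by
  classical
  let S : Finset (Fin n) := Finset.univ.filter (IsCore G U)
  let e : Fin S.card ↪o Fin n := S.orderEmbOfFin rfl
  have hS : ∀ v, IsCore G U v ↔ ∃ j, e j = v := fun v => by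
    have h1 : v ∈ Set.range e ↔ v ∈ S := by
      simp only [e, Finset.range_orderEmbOfFin, Finset.mem_coe]
    rw [Set.mem_range] at h1
    rw [h1]
    simp [S]
  exact ⟨S.card, G.comap e, Finset.univ.filter fun j => e j ∈ U, e, h, hS, fun j => by simp,
    fun _ _ => Iff.rfl⟩

lemma IsCoreOf.card_eq (h : IsCoreOf G₀ U₀ e G U) : U₀.card = U.card := by
  have : U₀.map e.toEmbedding = U := by
    ext v
    rw [Finset.mem_map]
    constructor
    · rintro ⟨j, hj, rfl⟩
      exact (h.mem_iff j).1 hj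
    · intro hv
      obtain ⟨j, rfl⟩ := (h.mem_range v).1 (Or.inl hv)
      exact ⟨j, (h.mem_iff j).2 hv, rfl⟩
  rw [← this, Finset.card_map]

lemma IsCoreOf.exists_adj (h : IsCoreOf G₀ U₀ e G U) (j : Fin m) : ∃ j', G₀.Adj j j' := by
  by_cases hj : e j ∈ U
  · obtain ⟨w, hw⟩ := h.part.exists_adj (e j)
    obtain ⟨y, hy, -, hmax⟩ := exists_max_adj hw
    obtain ⟨j', rfl⟩ := (h.mem_range y).1 (Or.inr ⟨e j, hj, hy, Or.inl hmax⟩)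
    exact ⟨j', (h.adj_iff _ _).2 hy⟩
  · rcases (h.mem_range (e j)).2 ⟨j, rfl⟩ with hj' | ⟨u, hu, hadj, -⟩
    · exact absurd hj' hj
    · obtain ⟨j', rfl⟩ := (h.mem_range u).1 (Or.inl hu)
      exact ⟨j', (h.adj_iff _ _).2 hadj.symm⟩

/-- The core has at most two vertices outside `U` for each element of `U`. -/
lemma IsCoreOf.card_le (h : IsCoreOf G₀ U₀ e G U) : m ≤ U₀.card + 2 * U₀.card := by
  classical
  obtain ⟨mx, hmx⟩ : ∃ f : Fin m → Fin m, ∀ u, G₀.Adj u (f u) ∧ ∀ x, G₀.Adj u x → x ≤ f u := by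
    choose f hf using fun u => exists_max_adj (h.exists_adj u).choose_spec
    exact ⟨f, fun u => ⟨(hf u).1, (hf u).2.2⟩⟩
  obtain ⟨mn, hmn⟩ : ∃ f : Fin m → Fin m, ∀ u, G₀.Adj u (f u) ∧ ∀ x, G₀.Adj u x → f u ≤ x := by
    choose f hf using fun u => exists_min_adj (h.exists_adj u).choose_spec
    exact ⟨f, fun u => ⟨(hf u).1, (hf u).2.2⟩⟩
  have hsub : (Finset.univ : Finset (Fin m)) ⊆ U₀ ∪ (U₀.image mx ∪ U₀.image mn) := by
    intro j _
    rcases (h.mem_range (e j)).2 ⟨j, rfl⟩ with hj | ⟨u, hu, hadj, hext⟩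
    · exact Finset.mem_union_left _ ((h.mem_iff j).2 hj)
    · obtain ⟨i, rfl⟩ := (h.mem_range u).1 (Or.inl hu)
      have hi := (h.mem_iff i).2 hu
      have hij := (h.adj_iff _ _).2 hadj
      refine Finset.mem_union_right _ ?_
      rcases hext with hext | hext
      · refine Finset.mem_union_left _ (Finset.mem_image.2 ⟨i, hi, ?_⟩)
        exact le_antisymm (e.le_iff_le.1 (hext _ ((h.adj_iff _ _).1 (hmx i).1))) ((hmx i).2 j hij)
      · refine Finset.mem_union_right _ (Finset.mem_image.2 ⟨i, hi, ?_⟩)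
        exact le_antisymm ((hmn i).2 j hij) (e.le_iff_le.1 (hext _ ((h.adj_iff _ _).1 (hmn i).1)))
  have h1 := Finset.card_le_card hsub
  have h2 := Finset.card_union_le U₀ (U₀.image mx ∪ U₀.image mn)
  have h3 := Finset.card_union_le (U₀.image mx) (U₀.image mn)
  have h4 := Finset.card_image_le (s := U₀) (f := mx)
  have h5 := Finset.card_image_le (s := U₀) (f := mn)
  rw [Finset.card_univ, Fintype.card_fin] at h1
  omega

/-- Applied to the first and last vertices and to those next to the gap, which are extreme for all
their neighbours. -/
lemma isCore_of_extreme (h : IsMinimalWithPart G U) {v : Fin n}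
    (hv : ∀ u, G.Adj u v → (∀ x, G.Adj u x → x ≤ v) ∨ ∀ x, G.Adj u x → v ≤ x) :
    IsCore G U v := by
  by_cases hU : v ∈ U
  · exact Or.inl hU
  · obtain ⟨u, hu⟩ := h.exists_adj v
    exact Or.inr ⟨u, (h.bipartite _ _ hu.symm).2 hU, hu.symm, hv u hu.symm⟩

lemma Crossing.isCore {t : ℕ} (h : IsMinimalWithPart G U) (ht : Crossing G t) {v : Fin n}
    (hv : v.val + 1 = t ∨ v.val = t) : IsCore G U v := by
  refine isCore_of_extreme h fun u hu => ?_
  rcases hv with hv | hv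
  · refine Or.inl fun x hx => ?_
    have h1 := ht.lt_iff hu
    have h2 := ht.lt_iff hx
    rw [Fin.le_def]
    omega
  · refine Or.inr fun x hx => ?_
    have h1 := ht.lt_iff hu
    have h2 := ht.lt_iff hx
    rw [Fin.le_def]
    omega

lemma IsCoreOf.val_zero (h : IsCoreOf G₀ U₀ e G U) (hm : 0 < m) : (e ⟨0, hm⟩).val = 0 := by
  have hn : 0 < n := (e ⟨0, hm⟩).pos
  obtain ⟨j, hj⟩ := (h.mem_range ⟨0, hn⟩).1
    (isCore_of_extreme h.part fun u _ => Or.inr fun x _ => Nat.zero_le _)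
  have h1 : (e ⟨0, hm⟩).val ≤ (e j).val := e.monotone (Nat.zero_le _)
  rw [hj] at h1
  exact Nat.le_zero.1 h1

lemma IsCoreOf.val_last (h : IsCoreOf G₀ U₀ e G U) (hm : 0 < m) :
    (e ⟨m - 1, by omega⟩).val + 1 = n := by
  have hn : 0 < n := (e ⟨0, hm⟩).pos
  obtain ⟨j, hj⟩ := (h.mem_range ⟨n - 1, by omega⟩).1
    (isCore_of_extreme h.part fun u _ => Or.inl fun x _ => by rw [Fin.le_def]; simp only; omega)
  have h1 : (e j).val ≤ (e ⟨m - 1, by omega⟩).val :=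
    e.monotone (show j.val ≤ m - 1 by omega)
  rw [hj] at h1
  simp only at h1
  omega

lemma IsCoreOf.lt_of_between (h : IsCoreOf G₀ U₀ e G U) {j : ℕ} (hj : j + 1 < m) {v : Fin n}
    (h1 : e ⟨j, by omega⟩ < v) (h2 : v < e ⟨j + 1, hj⟩) : ¬ IsCore G U v := by
  intro hv
  obtain ⟨i, rfl⟩ := (h.mem_range v).1 hv
  have h1 := e.lt_iff_lt.1 h1
  have h2 := e.lt_iff_lt.1 h2
  rw [Fin.lt_def] at h1 h2
  simp only at h1 h2
  omega

/-- Consecutive elements of the core have at most two vertices between them. -/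
lemma IsCoreOf.val_succ_le (h : IsCoreOf G₀ U₀ e G U) {j : ℕ} (hj : j + 1 < m) :
    (e ⟨j + 1, hj⟩).val ≤ (e ⟨j, by omega⟩).val + 3 := by
  obtain ⟨t, -, ht⟩ := h.part.exists_crossing
  by_contra hcon
  push Not at hcon
  have hlt := (e ⟨j + 1, hj⟩).isLt
  have hnot : ∀ (i : ℕ) (hi : (e ⟨j, by omega⟩).val + i + 1 < n), i < 3 →
      ¬ IsCore G U ⟨(e ⟨j, by omega⟩).val + i + 1, hi⟩ := fun i hi h3 =>
    h.lt_of_between hj (by rw [Fin.lt_def]; simp only; omega)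
      (by rw [Fin.lt_def]; simp only; omega)
  have c0 := hnot 0 (by omega) (by omega)
  have c1 := hnot 1 (by omega) (by omega)
  have c2 := hnot 2 (by omega) (by omega)
  -- Three consecutive vertices outside the core lie on one side, since the two vertices next to the
  -- gap belong to the core.
  refine h.part.isCore_of_consecutive ht rfl rfl ?_ c0 c1 c2
  simp only
  by_contra hside
  have hside : t = (e ⟨j, by omega⟩).val + 1 + 1 ∨ t = (e ⟨j, by omega⟩).val + 2 + 1 := by omega
  rcases hside with hs | hs
  · exact c1 (ht.isCore h.part (Or.inr hs.symm))
  · exact c2 (ht.isCore h.part (Or.inr hs.symm))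

/-- A vertex inserted here would leave a vertex next to the gap of `G` outside the core. This saves
one factor `3` in the count. -/
lemma IsCoreOf.val_succ_eq_of_crossing (h : IsCoreOf G₀ U₀ e G U) {j : ℕ} (hj : j + 1 < m)
    (hcross : Crossing G₀ (j + 1)) : (e ⟨j + 1, hj⟩).val = (e ⟨j, by omega⟩).val + 1 := by
  obtain ⟨t, -, ht⟩ := h.part.exists_crossing
  obtain ⟨a, ha⟩ := h.exists_adj ⟨j, by omega⟩
  obtain ⟨b, hb⟩ := h.exists_adj ⟨j + 1, hj⟩
  have ha' := (hcross.lt_iff ha).1 (Nat.lt_succ_self _)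
  have hb' : b.val < j + 1 := (hcross.lt_iff hb.symm).2 le_rfl
  have h1 := (ht _ _ ((h.adj_iff _ _).1 ha)
    (e.strictMono (show j < a.val by omega : (⟨j, _⟩ : Fin m) < a))).1
  have h2 := (ht _ _ ((h.adj_iff _ _).1 hb.symm)
    (e.strictMono (show b.val < j + 1 by omega : b < (⟨j + 1, hj⟩ : Fin m)))).2
  have hlt := (e ⟨j + 1, hj⟩).isLt
  by_contra hne
  have hcase : (e ⟨j, by omega⟩).val + 1 < t ∨ t < (e ⟨j + 1, hj⟩).val := by omega
  rcases hcase with hc | hc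
  · exact h.lt_of_between hj (v := ⟨t - 1, by omega⟩) (by rw [Fin.lt_def]; simp only; omega)
      (by rw [Fin.lt_def]; simp only; omega) (ht.isCore h.part (Or.inl (by simp only; omega)))
  · exact h.lt_of_between hj (v := ⟨t, by omega⟩) (by rw [Fin.lt_def]; simp only; omega)
      (by rw [Fin.lt_def]; simp only; omega) (ht.isCore h.part (Or.inr rfl))

lemma IsCoreOf.exists_crossing (h : IsCoreOf G₀ U₀ e G U) (hm : 0 < m) :
    ∃ j, j + 1 < m ∧ Crossing G₀ (j + 1) := by
  obtain ⟨t, -, ht⟩ := h.part.exists_crossing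
  obtain ⟨t₀, -, ht₀, -⟩ := ht.exists_comap e h.adj_iff
  obtain ⟨a, ha⟩ := h.exists_adj ⟨0, hm⟩
  have hne : a.val ≠ 0 := fun h => ha.ne (Fin.ext h.symm)
  have := ht₀ _ _ ha (Nat.pos_of_ne_zero hne)
  simp only at this
  obtain ⟨j, rfl⟩ : ∃ j, t₀ = j + 1 := ⟨t₀ - 1, by omega⟩
  exact ⟨j, by omega, ht₀⟩

/-- The core of a graph with vertices outside `U` on both sides is encoded by two functions. -/
lemma IsCoreOf.isCoded (h : IsCoreOf G₀ U₀ e G U) {t : ℕ} (ht : Crossing G t) {a b : Fin n}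
    (ha : a ∉ U) (hat : a.val < t) (hb : b ∉ U) (hbt : t ≤ b.val) {z₁ z₂ : Fin m} (hz₁ : z₁ ∉ U₀)
    (hz₂ : z₂ ∉ U₀) (hz : ∀ j ∉ U₀, z₁ ≤ j ∧ j ≤ z₂) :
    z₁ ≠ z₂ ∧ IsCoded G₀ U₀ {z₁, z₂} z₂ := by
  classical
  -- The given `a` and `b` need not lie in the core, but the extreme neighbours of a neighbour do,
  -- and they are on the same side. Hence `z₁` and `z₂` are on different sides and each is farthest
  -- for its neighbours.
  have hcore : ∀ w ∉ U, ∃ j j', j ∉ U₀ ∧ j' ∉ U₀ ∧ e j ≤ w ∧ w ≤ e j' ∧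
      ((e j).val < t ↔ w.val < t) ∧ ((e j').val < t ↔ w.val < t) := by
    intro w hw
    obtain ⟨u, hu⟩ := h.part.exists_adj w
    have huU := (h.part.bipartite _ _ hu.symm).2 hw
    obtain ⟨x, hx, hxw, hmin⟩ := exists_min_adj hu.symm
    obtain ⟨y, hy, hyw, hmax⟩ := exists_max_adj hu.symm
    obtain ⟨j, rfl⟩ := (h.mem_range x).1 (Or.inr ⟨u, huU, hx, Or.inr hmin⟩)
    obtain ⟨j', rfl⟩ := (h.mem_range y).1 (Or.inr ⟨u, huU, hy, Or.inl hmax⟩)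
    simp only [h.mem_iff]
    refine ⟨_, _, (h.part.bipartite _ _ hx).1 huU, (h.part.bipartite _ _ hy).1 huU, hxw, hyw, ?_⟩
    have h1 := ht.lt_iff hx.symm
    have h2 := ht.lt_iff hy.symm
    have h3 := ht.lt_iff hu
    exact ⟨h1.trans h3.symm, h2.trans h3.symm⟩
  obtain ⟨t₀, -, ht₀, htt₀⟩ := ht.exists_comap e h.adj_iff
  have h1 : z₁.val < t₀ := by
    obtain ⟨j, -, hj, -, -, -, hja, -⟩ := hcore a ha
    have h2 : (e z₁).val ≤ (e j).val := e.monotone (hz j hj).1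
    rw [htt₀]
    have := hja.2 hat
    omega
  have h2 : t₀ ≤ z₂.val := by
    obtain ⟨-, j, -, hj, -, -, -, hjb⟩ := hcore b hb
    have h2 : (e j).val ≤ (e z₂).val := e.monotone (hz j hj).2
    by_contra hcon
    have h3 := (htt₀ z₂).1 (not_le.1 hcon)
    have := hjb.1 (by omega)
    omega
  refine ⟨fun h => ?_, h.part.isCoded_comap e h.mem_iff h.adj_iff h.exists_adj (by simp) ?_ ?_⟩
  · rw [h] at h1
    omega
  · intro w hw
    rw [Finset.mem_insert, Finset.mem_singleton] at hw
    rcases hw with rfl | rfl <;> assumption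
  · intro w hw u hu x hx
    have hxU : w ∉ U₀ → x ∉ U₀ := by
      rw [h.mem_iff, h.mem_iff]
      intro hw
      exact (h.part.bipartite _ _ ((h.adj_iff _ _).1 hx)).1
        ((h.part.bipartite _ _ ((h.adj_iff _ _).1 hu)).2 hw)
    have e1 := ht₀.lt_iff hu
    have e2 := ht₀.lt_iff hx
    rw [Finset.mem_insert, Finset.mem_singleton] at hw
    rcases hw with rfl | rfl
    · have := (hz x (hxU hz₁)).1
      simp only [Fin.lt_def, Fin.le_def] at *
      omega
    · have := (hz x (hxU hz₂)).2
      simp only [Fin.lt_def, Fin.le_def] at *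
      omega

end

end OrderedGraph

/-! ### Counting the mixed graphs -/

namespace OrderedGraph

/-- The core contains the first and the last vertex, so its gap sizes fix both the embedding and
`n`; then `IsCoreOf.eq` applies. -/
lemma IsCoreOf.mk_eq {m n n' : ℕ} {G₀ : SimpleGraph (Fin m)} {U₀ : Finset (Fin m)}
    {e : Fin m ↪o Fin n} {e' : Fin m ↪o Fin n'} {G : SimpleGraph (Fin n)} {U : Finset (Fin n)}
    {G' : SimpleGraph (Fin n')} {U' : Finset (Fin n')} (hm : 0 < m) (h : IsCoreOf G₀ U₀ e G U)
    (h' : IsCoreOf G₀ U₀ e' G' U') (c : ℕ → ℕ)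
    (hc : ∀ (j : ℕ) (hj : j + 1 < m), (e ⟨j + 1, hj⟩).val = (e ⟨j, by omega⟩).val + 1 + c j)
    (hc' : ∀ (j : ℕ) (hj : j + 1 < m), (e' ⟨j + 1, hj⟩).val = (e' ⟨j, by omega⟩).val + 1 + c j) :
    (⟨n, G⟩ : OrderedGraph) = ⟨n', G'⟩ := by
  have hval : ∀ (j : ℕ) (hj : j < m), (e ⟨j, hj⟩).val = (e' ⟨j, hj⟩).val := by
    intro j
    induction j with
    | zero =>
      intro hj
      rw [h.val_zero, h'.val_zero]
    | succ j ih =>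
      intro hj
      rw [hc, hc', ih]
  obtain rfl : n = n' := by
    have h1 := h.val_last hm
    have h2 := h'.val_last hm
    have h3 := hval (m - 1) (by omega)
    omega
  obtain rfl : e = e' := by
    ext j
    exact hval j j.isLt
  rw [h.eq h']

lemma card_filter_zero_le {p : ℕ} (P : ℕ → Prop) (hP : ∃ j < p, P j) :
    {c : Fin p → Fin 3 | ∀ j : Fin p, P j → c j = 0}.encard ≤ (3 ^ (p - 1) : ℕ) := by
  classical
  obtain ⟨j, hj, hPj⟩ := hP
  obtain ⟨q, rfl⟩ : ∃ q, p = q + 1 := ⟨p - 1, by omega⟩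
  have hinj : Set.InjOn (fun c : Fin (q + 1) → Fin 3 => (⟨j, hj⟩ : Fin (q + 1)).removeNth c)
      {c : Fin (q + 1) → Fin 3 | ∀ j : Fin (q + 1), P j → c j = 0} := by
    intro c hc c' hc' h
    rw [← Fin.insertNth_self_removeNth ⟨j, hj⟩ c, ← Fin.insertNth_self_removeNth ⟨j, hj⟩ c',
      show c ⟨j, hj⟩ = 0 from hc _ hPj, show c' ⟨j, hj⟩ = 0 from hc' _ hPj]
    simp only at h
    rw [h]
  refine (Set.encard_le_encard_of_injOn (Set.mapsTo_univ _ _) hinj).trans ?_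
  rw [Set.encard_univ, ENat.card_eq_coe_fintype_card]
  simp

/-- The possible cores with a given part. -/
def coreGraphs {m : ℕ} (U₀ : Finset (Fin m)) : Set (SimpleGraph (Fin m)) :=
  {G₀ | (∀ z₁ z₂, z₁ ∉ U₀ → z₂ ∉ U₀ → (∀ j ∉ U₀, z₁ ≤ j ∧ j ≤ z₂) →
    z₁ ≠ z₂ ∧ IsCoded G₀ U₀ {z₁, z₂} z₂) ∧ ∃ j < m - 1, Crossing G₀ (j + 1)}

/-- Both extreme vertices outside `U₀` have no further edge, hence the exponent `i - 2`. -/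
lemma encard_coreGraphs_le {k i : ℕ} (hi : 0 < i) {U₀ : Finset (Fin (k + i))} (hk : U₀.card = k) :
    (coreGraphs U₀).encard ≤ ((i ^ k - (i - 1) ^ k) * k ^ (i - 2) : ℕ) := by
  classical
  have hne : U₀ᶜ.Nonempty := by
    rw [← Finset.card_pos, Finset.card_compl, Fintype.card_fin]
    omega
  have h1 : U₀ᶜ.min' hne ∉ U₀ := Finset.mem_compl.1 (U₀ᶜ.min'_mem hne)
  have h2 : U₀ᶜ.max' hne ∉ U₀ := Finset.mem_compl.1 (U₀ᶜ.max'_mem hne)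
  have h3 : ∀ j ∉ U₀, U₀ᶜ.min' hne ≤ j ∧ j ≤ U₀ᶜ.max' hne := fun j hj =>
    ⟨U₀ᶜ.min'_le _ (Finset.mem_compl.2 hj), U₀ᶜ.le_max' _ (Finset.mem_compl.2 hj)⟩
  by_cases heq : U₀ᶜ.min' hne = U₀ᶜ.max' hne
  · refine le_of_eq_of_le (Set.encard_eq_zero.2 ?_) zero_le
    rw [Set.eq_empty_iff_forall_notMem]
    exact fun G hG => (hG.1 _ _ h1 h2 h3).1 heq
  · refine (Set.encard_le_encard fun G hG => (hG.1 _ _ h1 h2 h3).2).trans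
      (encard_isCoded_le hk (by simp) h2 ?_ (Finset.card_pair heq))
    intro w hw
    rw [Finset.mem_insert, Finset.mem_singleton] at hw
    rcases hw with rfl | rfl <;> assumption

/-- The minimally non-linear graphs with `k` vertices in the part `U`, some vertices outside `U` on
both sides of the crossing, and a core of `m` vertices. -/
def mixedGraphs (k m : ℕ) : Set OrderedGraph :=
  {H | ∃ (n : ℕ) (G : SimpleGraph (Fin n)) (U : Finset (Fin n)) (G₀ : SimpleGraph (Fin m))
    (U₀ : Finset (Fin m)) (e : Fin m ↪o Fin n), H = ⟨n, G⟩ ∧ IsCoreOf G₀ U₀ e G U ∧ U.card = k ∧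
    ∃ t a b, Crossing G t ∧ a ∉ U ∧ a.val < t ∧ b ∉ U ∧ t ≤ b.val}

/-- The factors count the positions of the part in the core, the cores, and the gap sizes `0`, `1`,
`2`, of which the one at the crossing is `0`. -/
theorem encard_mixedGraphs_le {k i : ℕ} (hi : 0 < i) :
    (mixedGraphs k (k + i)).encard ≤ ((k + i).choose k *
      ((i ^ k - (i - 1) ^ k) * k ^ (i - 2) * 3 ^ (k + i - 2)) : ℕ) := by
  classical
  have hsub : mixedGraphs k (k + i) ⊆ ⋃ U₀ ∈ {U₀ : Finset (Fin (k + i)) | U₀.card = k},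
      ⋃ G₀ ∈ coreGraphs U₀, ⋃ c ∈ {c : Fin (k + i - 1) → Fin 3 |
        ∀ j : Fin (k + i - 1), Crossing G₀ (j.val + 1) → c j = 0},
      {H : OrderedGraph | ∃ (n : ℕ) (G : SimpleGraph (Fin n)) (U : Finset (Fin n))
        (e : Fin (k + i) ↪o Fin n),
        H = ⟨n, G⟩ ∧ IsCoreOf G₀ U₀ e G U ∧ ∀ (j : ℕ) (hj : j + 1 < k + i),
          (e ⟨j + 1, hj⟩).val = (e ⟨j, by omega⟩).val + 1 + (c ⟨j, by omega⟩).val} := by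
    rintro H ⟨n, G, U, G₀, U₀, e, rfl, h, hU, t, a, b, ht, ha, hat, hb, hbt⟩
    simp only [Set.mem_iUnion, exists_prop]
    have hc : ∀ j : Fin (k + i - 1), ∃ c : Fin 3, (e ⟨j.val + 1, by omega⟩).val =
        (e ⟨j.val, by omega⟩).val + 1 + c.val := by
      intro j
      have h1 := h.val_succ_le (j := j.val) (by omega)
      have h2 : (e ⟨j.val, by omega⟩).val < (e ⟨j.val + 1, by omega⟩).val :=
        e.strictMono (Nat.lt_succ_self j.val)
      exact ⟨⟨(e ⟨j.val + 1, by omega⟩).val - (e ⟨j.val, by omega⟩).val - 1, by omega⟩,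
        by simp only; omega⟩
    choose c hc using hc
    refine ⟨U₀, h.card_eq.trans hU, G₀, ⟨fun z₁ z₂ hz₁ hz₂ hz =>
      h.isCoded ht ha hat hb hbt hz₁ hz₂ hz, ?_⟩, c, ?_, n, G, U, e, rfl, h, fun j hj =>
        hc ⟨j, by omega⟩⟩
    · obtain ⟨j, hj, hcross⟩ := h.exists_crossing (by omega)
      exact ⟨j, by omega, hcross⟩
    · intro j hj
      have h1 := h.val_succ_eq_of_crossing (by omega) hj
      have h2 := hc j
      exact Fin.ext (by simp only [Fin.val_zero]; omega)
  refine (Set.encard_le_encard hsub).trans (encard_biUnion_le_mul ?_ fun U₀ hU₀ => ?_)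
  · have hcoe : {U₀ : Finset (Fin (k + i)) | U₀.card = k} =
        (Finset.powersetCard k Finset.univ : Finset (Finset (Fin (k + i)))) := by
      ext U₀
      simp [Finset.mem_powersetCard]
    rw [hcoe, Set.encard_coe_eq_coe_finsetCard, Finset.card_powersetCard]
    simp
  · refine encard_biUnion_le_mul (encard_coreGraphs_le hi hU₀) fun G₀ hG₀ => ?_
    have h3 := encard_biUnion_le_mul (b := 1) (card_filter_zero_le (p := k + i - 1)
      (fun j => Crossing G₀ (j + 1)) hG₀.2)
      (f := fun c : Fin (k + i - 1) → Fin 3 =>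
      {H : OrderedGraph | ∃ (n : ℕ) (G : SimpleGraph (Fin n)) (U : Finset (Fin n))
        (e : Fin (k + i) ↪o Fin n),
        H = ⟨n, G⟩ ∧ IsCoreOf G₀ U₀ e G U ∧ ∀ (j : ℕ) (hj : j + 1 < k + i),
          (e ⟨j + 1, hj⟩).val = (e ⟨j, by omega⟩).val + 1 + (c ⟨j, by omega⟩).val}) ?_
    · rwa [mul_one, Nat.sub_sub] at h3
    · intro c _
      rw [Nat.cast_one, Set.encard_le_one_iff]
      rintro H H' ⟨n, G, U, e, rfl, h, hc⟩ ⟨n', G', U', e', rfl, h', hc'⟩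
      refine h.mk_eq (by omega) h' (fun j => if hj : j < k + i - 1 then (c ⟨j, hj⟩).val else 0)
        (fun j hj => ?_) fun j hj => ?_
      · rw [hc j hj, dif_pos (by omega)]
      · rw [hc' j hj, dif_pos (by omega)]

end OrderedGraph

namespace OrderedGraph

/-! ### The numerical estimate -/

lemma add_one_pow_le (a p : ℕ) : (a + 1) ^ (p + 1) ≤ a ^ (p + 1) + (p + 1) * (a + 1) ^ p := by
  induction p with
  | zero => simp
  | succ p ih =>
    calc (a + 1) ^ (p + 1 + 1) = a * (a + 1) ^ (p + 1) + (a + 1) ^ (p + 1) := by ring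
      _ ≤ a * (a ^ (p + 1) + (p + 1) * (a + 1) ^ p) + (a + 1) ^ (p + 1) := by gcongr
      _ = a ^ (p + 1 + 1) + (p + 1) * (a * (a + 1) ^ p) + (a + 1) ^ (p + 1) := by ring
      _ ≤ a ^ (p + 1 + 1) + (p + 1) * ((a + 1) * (a + 1) ^ p) + (a + 1) ^ (p + 1) := by
        gcongr
        omega
      _ = a ^ (p + 1 + 1) + (p + 1 + 1) * (a + 1) ^ (p + 1) := by ring

lemma le_add_one_pow (a p : ℕ) : a ^ (p + 1) + (p + 1) * a ^ p ≤ (a + 1) ^ (p + 1) := by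
  induction p with
  | zero => simp
  | succ p ih =>
    calc a ^ (p + 1 + 1) + (p + 1 + 1) * a ^ (p + 1)
        = a * (a ^ (p + 1) + (p + 1) * a ^ p) + a ^ (p + 1) := by ring
      _ ≤ a * (a + 1) ^ (p + 1) + (a + 1) ^ (p + 1) := by
        gcongr
        omega
      _ = (a + 1) ^ (p + 1 + 1) := by ring

lemma pow_sub_pow_le (i p : ℕ) : i ^ (p + 1) - (i - 1) ^ (p + 1) ≤ (p + 1) * i ^ p := by
  obtain _ | a := i
  · simp
  · have := add_one_pow_le a p
    simp only [Nat.add_sub_cancel]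
    omega

lemma le_pow_sub_pow (a p : ℕ) : (p + 1) * a ^ p ≤ (a + 1) ^ (p + 1) - a ^ (p + 1) := by
  have := le_add_one_pow a p
  omega

lemma six_mul_pow_le {p : ℕ} (hp : 4 ≤ p) : 6 * 270 ^ p ≤ 425 ^ p := by
  induction p, hp using Nat.le_induction with
  | base => norm_num
  | succ p _ ih =>
    rw [pow_succ, pow_succ]
    omega

/-- For `p ≥ 4`, `17 * (p + 1) ≤ 5 * (4 * p + 1)` and `25 ≤ (p + 1) ^ 2`. This reduces the claim to
comparing `270 = 5 * 2 * 3 ^ 3` with `425 = 17 * 25`. -/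
lemma two_mul_pow_le {p : ℕ} (hp : 4 ≤ p) :
    2 * ((2 * (p + 1)) ^ p * 3 ^ (3 * p + 1)) ≤ (4 * p + 1) ^ p * (p + 1) ^ (2 * p) := by
  have h1 : 6 * 270 ^ p ≤ (17 * (p + 1) ^ 2) ^ p :=
    (six_mul_pow_le hp).trans (Nat.pow_le_pow_left (by nlinarith) p)
  have h2 : (17 * (p + 1)) ^ p ≤ (5 * (4 * p + 1)) ^ p := Nat.pow_le_pow_left (by omega) p
  refine Nat.le_of_mul_le_mul_left ?_ (show 0 < 5 ^ p by positivity)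
  calc 5 ^ p * (2 * ((2 * (p + 1)) ^ p * 3 ^ (3 * p + 1)))
      = (p + 1) ^ p * (6 * ((5 * 2 * 3 ^ 3) ^ p)) := by
        rw [mul_pow, mul_pow, mul_pow, pow_succ, pow_mul]
        ring
    _ ≤ (p + 1) ^ p * (17 * (p + 1) ^ 2) ^ p := Nat.mul_le_mul_left _ (by simpa using h1)
    _ = (17 * (p + 1)) ^ p * (p + 1) ^ (2 * p) := by
        rw [mul_pow, mul_pow, pow_mul]
        ring
    _ ≤ (5 * (4 * p + 1)) ^ p * (p + 1) ^ (2 * p) := Nat.mul_le_mul_right _ h2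
    _ = 5 ^ p * ((4 * p + 1) ^ p * (p + 1) ^ (2 * p)) := by
        rw [mul_pow]
        ring

lemma two_le_choose {n r : ℕ} (hr : 0 < r) (hn : r < n) : 2 ≤ n.choose r := by
  obtain ⟨n, rfl⟩ : ∃ m, n = m + 1 := ⟨n - 1, by omega⟩
  obtain ⟨r, rfl⟩ : ∃ m, r = m + 1 := ⟨r - 1, by omega⟩
  rw [Nat.choose_succ_succ']
  have h1 : 0 < n.choose r := Nat.choose_pos (by omega)
  have h2 : 0 < n.choose (r + 1) := Nat.choose_pos (by omega)
  omega

lemma choose_add_two_le {k : ℕ} (hk : 2 < k) : (3 * k).choose k + 2 ≤ (5 * k - 2).choose k := by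
  obtain ⟨p, rfl⟩ : ∃ p, k = p + 1 := ⟨k - 1, by omega⟩
  have h1 : (3 * (p + 1) + 1).choose (p + 1) ≤ (5 * (p + 1) - 2).choose (p + 1) :=
    Nat.choose_le_choose _ (by omega)
  rw [Nat.choose_succ_succ'] at h1
  have h2 : 2 ≤ (3 * (p + 1)).choose p := two_le_choose (by omega) (by omega)
  omega

/-- The bound for the number of mixed graphs is at most the part of the last term that the other
graphs leave free. -/
theorem sum_mixed_le {k : ℕ} (hk : 2 < k) :
    ∑ i ∈ Finset.Icc 2 (2 * k),
      (k + i).choose k * ((i ^ k - (i - 1) ^ k) * k ^ (i - 2) * 3 ^ (k + i - 2)) ≤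
    ((5 * k - 2).choose k - 2) * (((4 * k - 2) ^ k - (4 * k - 3) ^ k) * k ^ (4 * k - 3)) := by
  -- The crude estimates below need `k ≥ 5`: there each summand is bounded by the values at `i = 2 *
  -- k`.
  obtain rfl | rfl | hk5 : k = 3 ∨ k = 4 ∨ 5 ≤ k := by omega
  · norm_num [Finset.sum_Icc_succ_top, Nat.choose]
  · norm_num [Finset.sum_Icc_succ_top, Nat.choose]
  obtain ⟨p, rfl⟩ : ∃ p, k = p + 1 := ⟨k - 1, by omega⟩
  have hterm : ∀ i ∈ Finset.Icc 2 (2 * (p + 1)), (p + 1 + i).choose (p + 1) *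
      ((i ^ (p + 1) - (i - 1) ^ (p + 1)) * (p + 1) ^ (i - 2) * 3 ^ (p + 1 + i - 2)) ≤
      (3 * (p + 1)).choose (p + 1) * (((p + 1) * (2 * (p + 1)) ^ p) * (p + 1) ^ (2 * p) *
        3 ^ (3 * p + 1)) := by
    intro i hi
    rw [Finset.mem_Icc] at hi
    have h1 := pow_sub_pow_le i p
    refine Nat.mul_le_mul (Nat.choose_le_choose _ (by omega)) (Nat.mul_le_mul (Nat.mul_le_mul
      (h1.trans (Nat.mul_le_mul_left _ (Nat.pow_le_pow_left hi.2 p))) ?_) ?_)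
    · exact Nat.pow_le_pow_right (by omega) (by omega)
    · exact Nat.pow_le_pow_right (by omega) (by omega)
  refine (Finset.sum_le_card_nsmul _ _ _ hterm).trans ?_
  rw [Nat.card_Icc, smul_eq_mul]
  have hchoose := choose_add_two_le hk
  have hpow := le_pow_sub_pow (4 * p + 1) p
  have e1 : 4 * (p + 1) - 2 = 4 * p + 1 + 1 := by omega
  have e2 : 4 * (p + 1) - 3 = 4 * p + 1 := by omega
  rw [e1, e2]
  calc (2 * (p + 1) + 1 - 2) * ((3 * (p + 1)).choose (p + 1) * (((p + 1) * (2 * (p + 1)) ^ p) *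
        (p + 1) ^ (2 * p) * 3 ^ (3 * p + 1)))
      ≤ (2 * (p + 1)) * ((3 * (p + 1)).choose (p + 1) * (((p + 1) * (2 * (p + 1)) ^ p) *
        (p + 1) ^ (2 * p) * 3 ^ (3 * p + 1))) := Nat.mul_le_mul_right _ (by omega)
    _ = (3 * (p + 1)).choose (p + 1) * ((p + 1) * (p + 1) ^ (2 * p + 1)) *
        (2 * ((2 * (p + 1)) ^ p * 3 ^ (3 * p + 1))) := by ring
    _ ≤ (3 * (p + 1)).choose (p + 1) * ((p + 1) * (p + 1) ^ (2 * p + 1)) *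
        ((4 * p + 1) ^ p * (p + 1) ^ (2 * p)) := Nat.mul_le_mul_left _ (two_mul_pow_le (by omega))
    _ = (3 * (p + 1)).choose (p + 1) * (((p + 1) * (4 * p + 1) ^ p) * (p + 1) ^ (4 * p + 1)) := by
        ring
    _ ≤ _ := Nat.mul_le_mul (by omega) (Nat.mul_le_mul_right _ hpow)

end OrderedGraph

/-! ### The two kinds of graphs and the final count -/

namespace OrderedGraph

section

variable {n m : ℕ} {G : SimpleGraph (Fin n)} {U : Finset (Fin n)} {G₀ : SimpleGraph (Fin m)}
  {U₀ : Finset (Fin m)} {e : Fin m ↪o Fin n}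

lemma IsCoreOf.card_add_two_le (h : IsCoreOf G₀ U₀ e G U) {t : ℕ} (ht : Crossing G t) {a b : Fin n}
    (ha : a ∉ U) (hat : a.val < t) (hb : b ∉ U) (hbt : t ≤ b.val) : U.card + 2 ≤ m := by
  classical
  have h2 := h.part.two_lt
  rw [← h.card_eq] at h2 ⊢
  obtain ⟨u, hu⟩ := Finset.card_pos.1 (by omega : 0 < U₀.card)
  obtain ⟨w, hw⟩ := h.exists_adj u
  have hwU : w ∉ U₀ := by
    rw [h.mem_iff] at hu ⊢
    exact (h.part.bipartite _ _ ((h.adj_iff _ _).1 hw)).1 hu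
  have hne : U₀ᶜ.Nonempty := ⟨w, Finset.mem_compl.2 hwU⟩
  have h1 : U₀ᶜ.min' hne ∉ U₀ := Finset.mem_compl.1 (U₀ᶜ.min'_mem hne)
  have h2 : U₀ᶜ.max' hne ∉ U₀ := Finset.mem_compl.1 (U₀ᶜ.max'_mem hne)
  have h3 := (h.isCoded ht ha hat hb hbt h1 h2 fun j hj =>
    ⟨U₀ᶜ.min'_le _ (Finset.mem_compl.2 hj), U₀ᶜ.le_max' _ (Finset.mem_compl.2 hj)⟩).1
  have := card_add_card_le_of_disjoint (U := U₀) (W := {U₀ᶜ.min' hne, U₀ᶜ.max' hne})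
    (by simp [h1, h2])
  rwa [Finset.card_pair h3] at this

lemma IsMinimalWithPart.mem_iff_lt (h : IsMinimalWithPart G U) {t : ℕ} (ht : Crossing G t)
    (hU : ∀ v ∉ U, t ≤ v.val) (v : Fin n) : v ∈ U ↔ v.val < t := by
  refine ⟨fun hv => ?_, fun hv => ?_⟩
  · obtain ⟨w, hw⟩ := h.exists_adj v
    exact (ht.lt_iff hw).2 (hU w ((h.bipartite _ _ hw).1 hv))
  · by_contra hcon
    have := hU v hcon
    omega

lemma IsMinimalWithPart.mem_iff_le (h : IsMinimalWithPart G U) {t : ℕ} (ht : Crossing G t)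
    (hU : ∀ v ∉ U, v.val < t) (v : Fin n) : v ∈ U ↔ t ≤ v.val := by
  refine ⟨fun hv => ?_, fun hv => ?_⟩
  · obtain ⟨w, hw⟩ := h.exists_adj v
    exact (ht.lt_iff hw.symm).1 (hU w ((h.bipartite _ _ hw).1 hv))
  · by_contra hcon
    have := hU v hcon
    omega

end

/-- The minimally non-linear graphs whose part of `k` vertices is one side of the crossing, with `i`
vertices on the other side. -/
def unmixedGraphs (k i : ℕ) : Set OrderedGraph :=
  (fun G => ⟨k + i, G⟩) '' {G : SimpleGraph (Fin (k + i)) | ∃ U t, IsMinimalWithPart G U ∧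
    Crossing G t ∧ U.card = k ∧ ∀ v : Fin (k + i), v ∈ U ↔ v.val < t} ∪
  (fun G => ⟨k + i, G⟩) '' {G : SimpleGraph (Fin (k + i)) | ∃ U t, IsMinimalWithPart G U ∧
    Crossing G t ∧ U.card = k ∧ ∀ v : Fin (k + i), v ∈ U ↔ t ≤ v.val}

lemma encard_unmixedGraphs_le (k i : ℕ) :
    (unmixedGraphs k i).encard ≤ (2 * ((i ^ k - (i - 1) ^ k) * k ^ (i - 1)) : ℕ) := by
  refine (Set.encard_union_le _ _).trans ?_
  rw [two_mul, Nat.cast_add]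
  exact add_le_add ((Set.encard_image_le _ _).trans (encard_part_eq_left_le k i))
    ((Set.encard_image_le _ _).trans (encard_part_eq_right_le k i))

/-- When the part is one side, the size comparison in both directions gives `i ≤ 4 * k - 2` and `k ≤
4 * i - 2`; the latter is the lower end of the range of summation. -/
lemma mem_unmixedGraphs_or_mem_mixedGraphs {k : ℕ} (hk : 2 < k) {H : OrderedGraph}
    (hH : H.MinimallyNonlinear) (hHk : H.IsBipartiteWithPart k) :
    (∃ i ∈ Finset.Icc ⌈((k : ℚ) + 2) / 4⌉₊ (4 * k - 2), H ∈ unmixedGraphs k i) ∨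
      ∃ i ∈ Finset.Icc 2 (2 * k), H ∈ mixedGraphs k (k + i) := by
  obtain ⟨n, G⟩ := H
  obtain ⟨U, hU, hbip⟩ : ∃ U : Finset (Fin n), U.card = k ∧
    G.IsBipartiteWith (U : Set (Fin n)) (U : Set (Fin n))ᶜ := hHk
  have h : IsMinimalWithPart G U := by
    refine ⟨hH, fun a b hab => ?_, by omega⟩
    have := hbip.mem_of_adj hab
    simp only [Finset.mem_coe, Set.mem_compl_iff] at this
    tauto
  obtain ⟨t, htn, ht⟩ := h.exists_crossing
  have hright := hH.sub_le_of_crossing ht htn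
  have hleft := hH.le_of_crossing ht htn
  have hceil : ∀ i : ℕ, k + 2 ≤ 4 * i → ⌈((k : ℚ) + 2) / 4⌉₊ ≤ i := fun i hi => by
    rw [Nat.ceil_le, div_le_iff₀ (by norm_num)]
    have : ((k + 2 : ℕ) : ℚ) ≤ ((4 * i : ℕ) : ℚ) := by exact_mod_cast hi
    push_cast at this
    linarith
  by_cases h1 : ∀ v ∉ U, t ≤ v.val
  · left
    have hmem := h.mem_iff_lt ht h1
    have hcard : U = Finset.univ.filter fun v : Fin n => v.val < t := by
      ext v
      simp [hmem]
    have htk : t = k := by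
      rw [hcard, Fin.card_filter_val_lt] at hU
      omega
    subst htk
    obtain ⟨i, rfl⟩ : ∃ i, n = t + i := ⟨n - t, by omega⟩
    exact ⟨i, Finset.mem_Icc.2 ⟨hceil i (by omega), by omega⟩, Or.inl ⟨G, ⟨U, t, h, ht, hU, hmem⟩,
      rfl⟩⟩
  by_cases h2 : ∀ v ∉ U, v.val < t
  · left
    have hmem := h.mem_iff_le ht h2
    have hcard : Uᶜ = Finset.univ.filter fun v : Fin n => v.val < t := by
      ext v
      simp [hmem]
    have htk : n - k = t := by
      have := congrArg Finset.card hcard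
      rw [Fin.card_filter_val_lt, Finset.card_compl, Fintype.card_fin, hU] at this
      omega
    have hkn : k ≤ n := by
      have := Finset.card_le_univ U
      rw [Fintype.card_fin] at this
      omega
    obtain ⟨i, rfl⟩ : ∃ i, n = k + i := ⟨n - k, by omega⟩
    exact ⟨i, Finset.mem_Icc.2 ⟨hceil i (by omega), by omega⟩, Or.inr ⟨G, ⟨U, t, h, ht, hU, hmem⟩,
      rfl⟩⟩
  right
  push Not at h1 h2
  obtain ⟨a, ha, hat⟩ := h1
  obtain ⟨b, hb, hbt⟩ := h2
  obtain ⟨m, G₀, U₀, e, hcore⟩ := h.exists_isCoreOf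
  have hm := hcore.card_le
  have hm' := hcore.card_add_two_le ht ha hat hb hbt
  rw [hcore.card_eq] at hm
  obtain ⟨i, rfl⟩ : ∃ i, m = k + i := ⟨m - k, by omega⟩
  exact ⟨i, Finset.mem_Icc.2 ⟨by omega, by omega⟩, n, G, U, G₀, U₀, e, rfl, hcore, hU, t, a, b, ht,
    ha, hat, hb, hbt⟩

end OrderedGraph

theorem mainTheorem7 (k : ℕ) (hk : 2 < k) :
    {G : OrderedGraph | G.MinimallyNonlinear ∧ G.IsBipartiteWithPart k}.encard ≤
      ((∑ i ∈ Finset.Icc ⌈((k : ℚ) + 2) / 4⌉₊ (4 * k - 2),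
        (k + i).choose k * (i ^ k - (i - 1) ^ k) * k ^ (i - 1) : ℕ) : ℕ∞) := by
  set s := Finset.Icc ⌈((k : ℚ) + 2) / 4⌉₊ (4 * k - 2) with hs
  have hceil : ⌈((k : ℚ) + 2) / 4⌉₊ ≤ 4 * k - 2 := by
    rw [Nat.ceil_le, Nat.cast_sub (by omega)]
    have : (2 : ℚ) < k := by exact_mod_cast hk
    push_cast
    linarith
  have hpos : ∀ i ∈ s, 0 < i := fun i hi => by
    refine lt_of_lt_of_le (Nat.ceil_pos.2 ?_) (Finset.mem_Icc.1 hi).1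
    positivity
  have hsub : {G : OrderedGraph | G.MinimallyNonlinear ∧ G.IsBipartiteWithPart k} ⊆
      (⋃ i ∈ s, OrderedGraph.unmixedGraphs k i) ∪
        ⋃ i ∈ Finset.Icc 2 (2 * k), OrderedGraph.mixedGraphs k (k + i) := by
    rintro H ⟨hH, hHk⟩
    simpa only [Set.mem_union, Set.mem_iUnion, exists_prop] using
      OrderedGraph.mem_unmixedGraphs_or_mem_mixedGraphs hk hH hHk
  have hunmixed := (OrderedGraph.encard_biUnion_le s (OrderedGraph.unmixedGraphs k)).trans
    (Finset.sum_le_sum fun i _ => OrderedGraph.encard_unmixedGraphs_le k i)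
  have hmixed := (OrderedGraph.encard_biUnion_le (Finset.Icc 2 (2 * k))
    fun i => OrderedGraph.mixedGraphs k (k + i)).trans (Finset.sum_le_sum fun i hi =>
      OrderedGraph.encard_mixedGraphs_le (by have := (Finset.mem_Icc.1 hi).1; omega))
  refine (Set.encard_le_encard hsub).trans ((Set.encard_union_le _ _).trans
    ((add_le_add hunmixed hmixed).trans ?_))
  rw [← Nat.cast_sum, ← Nat.cast_sum, ← Nat.cast_add, Nat.cast_le]
  -- Two copies of each summand are spent on the two sides that the part can occupy; the remainder
  -- of the summand `i = 4 * k - 2` receives the mixed graphs.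
  have hsplit : ∀ i ∈ s, (k + i).choose k * (i ^ k - (i - 1) ^ k) * k ^ (i - 1) =
      2 * ((i ^ k - (i - 1) ^ k) * k ^ (i - 1)) +
        ((k + i).choose k - 2) * ((i ^ k - (i - 1) ^ k) * k ^ (i - 1)) := by
    intro i hi
    have h2 := OrderedGraph.two_le_choose (n := k + i) (r := k) (by omega)
      (by have := hpos i hi; omega)
    rw [← add_mul, Nat.add_sub_cancel' h2, mul_assoc]
  rw [Finset.sum_congr rfl hsplit, Finset.sum_add_distrib]
  refine Nat.add_le_add_left ((OrderedGraph.sum_mixed_le hk).trans ?_) _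
  have hlast := Finset.single_le_sum (s := s) (f := fun i => ((k + i).choose k - 2) *
    ((i ^ k - (i - 1) ^ k) * k ^ (i - 1))) (fun i _ => Nat.zero_le _)
    (Finset.mem_Icc.2 ⟨hceil, le_rfl⟩ : 4 * k - 2 ∈ s)
  have e1 : k + (4 * k - 2) = 5 * k - 2 := by omega
  have e2 : 4 * k - 2 - 1 = 4 * k - 3 := by omega
  simpa only [e1, e2] using hlast
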